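/- Let $n\in\{2,3\}$ and let $\Gamma$ be a non-empty bounded open subset of $\mathbb{R}^{n-1}$, identified with the planar screen $\Gamma\times\{0\}\subset\mathbb{R}^n$; no regularity of $\partial\Gamma$ is assumed. Let $k>0$ and $L:=\operatorname{diam}\Gamma$. For $s\in\mathbb{R}$ and $\hat u(\xi)=(2\pi)^{-(n-1)/2}\int_{\mathbb{R}^{n-1}}e^{-i\xi\cdot x}u(x)\,dx$, the space $H^s(\mathbb{R}^{n-1})$ carries the norm $\|u\|_{H^s_k}^2=\int_{\mathbb{R}^{n-1}}(k^2+|\xi|^2)^s|\hat u(\xi)|^2\,d\xi$ (for different $k$ these norms are equivalent); $\tilde H^{s}(\Gamma)$ is the closure of $C_0^\infty(\Gamma)$ in $H^{s}(\mathbb{R}^{n-1})$, with norm $\|\cdot\|_{\tilde H^s_k(\Gamma)}=\|\cdot\|_{H^s_k}$; and $H^{-1/2}(\Gamma)$ is the space of restrictions to $\Gamma$ of elements of $H^{-1/2}(\mathbb{R}^{n-1})$. Let $\Phi(x,y)=\frac{e^{ik|x-y|}}{4\pi|x-y|}$ if $n=3$ and $\Phi(x,y)=\frac i4H^{(1)}_0(k|x-y|)$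 if $n=2$. For $\phi\in\tilde H^{1/2}(\Gamma)$ let $$\mathcal D_k\phi(x)=\int_{\mathbb{R}^{n-1}}\frac{\partial\Phi(x,(\tilde y,y_n))}{\partial y_n}\Big|_{y_n=0}\phi(\tilde y)\,d\tilde y,\qquad x_n>0,$$ be the double layer potential, and let $T_k\phi$ be the restriction to $\Gamma$ of the weak normal derivative of $\mathcal D_k\phi$ on $\{x_n=0\}$, taken from $U^+=\{x_n>0\}$ in the direction of $x_n$: for $\psi\in C_0^\infty(\Gamma)$ and any $v\in C_0^\infty(\mathbb{R}^n)$ with $v(\cdot,0)=\psi$, $$\langle T_k\phi,\psi\rangle=-\int_{U^+}\big(\nabla\mathcal D_k\phi\cdot\nabla\bar v+\bar v\,\Delta\mathcal D_k\phi\big)\,dx .$$ Then $T_k\phi\in H^{-1/2}(\Gamma)$ for all $\phi\in\tilde H^{1/2}(\Gamma)$, and the sesquilinear form $$b(\phi,\psi):=\langle T_k\phi,\psi\rangle_{H^{-1/2}(\Gamma)\times\tilde H^{1/2}(\Gamma)}:=\int_{\mathbb{R}^{n-1}}\hat U(\xi)\overline{\hat\psi(\xi)}\,d\xi,\qquad \phi,\psi\in\tilde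 H^{1/2}(\Gamma),$$ where $U\in H^{-1/2}(\mathbb{R}^{n-1})$ is any extension of $T_k\phi$, is well defined (the value does not depend on the choice of $U$). Moreover, for every $k_0>0$ there is a constant $C>0$ depending only on $k_0$ such that, for all such $n$ and $\Gamma$ and all $k>0$ with $kL\ge k_0$, $$|b(\phi,\phi)|\ \ge\ C\,(kL)^{\beta}\,\|\phi\|^2_{\tilde H^{1/2}_k(\Gamma)},\qquad \phi\in\tilde H^{1/2}(\Gamma),$$ where $\beta=-\tfrac23$ if $n=3$ and $\beta=-\tfrac12$ if $n=2$. -/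

import Mathlib

open MeasureTheory
open scoped SchwartzMap ContDiff ComplexConjugate

noncomputable section

namespace ScreenScattering

/-- The Euclidean space `ℝ^m`. -/
abbrev E (m : ℕ) : Type := EuclideanSpace ℝ (Fin m)

/-! ### Sobolev spaces with wavenumber-dependent norms -/

/-- The Bessel potential operator with symbol `(k² + |ξ|²)^(s/2)`, where `ξ` is the angular
frequency. Mathlib's Fourier transform has the kernel `exp (-2πi η·x)`, so `ξ = 2πη`. -/
def besselPotentialK {m : ℕ} (k s : ℝ) : 𝓢'(E m, ℂ) →L[ℂ] 𝓢'(E m, ℂ) :=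
  TemperedDistribution.fourierMultiplierCLM ℂ
    (fun η : E m ↦ (((k ^ 2 + (2 * Real.pi * ‖η‖) ^ 2) ^ (s / 2) : ℝ) : ℂ))

open Classical in
/-- For `u ∈ H^s(ℝ^m)`, the (unique) `L²` function representing the Bessel potential of `u` of
order `s` (with wavenumber `k`); zero if `u ∉ H^s(ℝ^m)`. -/
def besselRep {m : ℕ} (k s : ℝ) (u : 𝓢'(E m, ℂ)) : Lp ℂ 2 (volume : Measure (E m)) :=
  if h : ∃ f : Lp ℂ 2 (volume : Measure (E m)), besselPotentialK k s u = (f : 𝓢'(E m, ℂ))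
  then h.choose else 0

/-- The norm `‖u‖ = (∫ (k² + |ξ|²)^s |û(ξ)|² dξ)^(1/2)` of `H^s_k(ℝ^m)`. -/
def sobolevNorm {m : ℕ} (k s : ℝ) (u : 𝓢'(E m, ℂ)) : ℝ := ‖besselRep k s u‖

/-- The duality pairing `⟨u, v⟩_s = ∫ û(ξ) conj(v̂(ξ)) dξ` on `H^{-s}(ℝ^m) × H^s(ℝ^m)`: the `L²`
inner product (linear in `u`, antilinear in `v`) of the Bessel potentials of `u` of order `-s` and
of `v` of order `s`. -/
def dualPairing {m : ℕ} (s : ℝ) (u v : 𝓢'(E m, ℂ)) : ℂ :=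
  inner ℂ (besselRep 1 s v) (besselRep 1 (-s) u)

/-- The space `𝒟(Γ)`, as a subset of the Schwartz space. -/
def IsTestFunctionOn {m : ℕ} (Γ : Set (E m)) (ψ : 𝓢(E m, ℂ)) : Prop :=
  HasCompactSupport ψ ∧ tsupport ψ ⊆ Γ

/-- Membership in `H̃^s(Γ)`, the closure of `𝒟(Γ)` in `H^s(ℝ^m)`. -/
def MemTildeH {m : ℕ} (s : ℝ) (Γ : Set (E m)) (u : 𝓢'(E m, ℂ)) : Prop :=
  TemperedDistribution.MemSobolev s 2 u ∧
    ∀ ε > 0, ∃ ψ : 𝓢(E m, ℂ), IsTestFunctionOn Γ ψ ∧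
      sobolevNorm 1 s (u - (ψ : 𝓢'(E m, ℂ))) < ε

/-! ### The fundamental solution of the Helmholtz equation -/

/-- The Hankel function `H_0^{(1)} = J_0 + i Y_0` on `(0, ∞)`, by Hankel's integral
`H_0^{(1)}(x) = (2/(πx))^{1/2} e^{i(x - π/4)} Γ(1/2)⁻¹ ∫_0^∞ e^{-t} t^{-1/2} (1 + it/(2x))^{-1/2} dt`. -/
def hankelH0 (x : ℝ) : ℂ :=
  (Real.sqrt (2 / (Real.pi * x)) : ℂ) * Complex.exp (Complex.I * (x - Real.pi / 4)) *
    ((1 / Real.Gamma (1 / 2) : ℝ) : ℂ) *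
    ∫ t in Set.Ioi (0 : ℝ), ((Real.exp (-t) * t ^ (-(1 / 2) : ℝ) : ℝ) : ℂ) *
      (1 + Complex.I * t / (2 * x)) ^ (-(1 / 2) : ℂ)

/-- The outgoing fundamental solution `Φ(x, y)` of `Δ + k²` in `ℝ^n`, for `n = 2` and `n = 3`
(the value `0` for other `n` is a dummy). -/
def fundamentalSolution (n : ℕ) (k : ℝ) (x y : E n) : ℂ :=
  if n = 2 then Complex.I / 4 * hankelH0 (k * ‖x - y‖)
  else if n = 3 then Complex.exp (Complex.I * k * ‖x - y‖) / (4 * Real.pi * ‖x - y‖)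
  else 0

/-! ### The double layer potential and the hypersingular operator

The screen lies in the hyperplane `ℝ^d × {0}` of `ℝ^{d+1}`, which is identified with `ℝ^d`. -/

/-- The point `(x, t) ∈ ℝ^{d+1}`, for `x ∈ ℝ^d` and `t ∈ ℝ`. -/
def point {d : ℕ} (x : E d) (t : ℝ) : E (d + 1) :=
  WithLp.toLp 2 (Fin.snoc (α := fun _ ↦ ℝ) (fun i ↦ x i) t)

/-- The upper half-space `U⁺` of `ℝ^{d+1}`. -/
def upperHalfSpace (d : ℕ) : Set (E (d + 1)) := {x | 0 < x (Fin.last d)}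

/-- The double layer potential `𝒟_k φ(x) = ∫ ∂Φ(x, y)/∂n(y) φ(y) ds(y)` with density `φ`, where
`n` is the unit normal in the direction of the last coordinate. -/
def doubleLayer {d : ℕ} (k : ℝ) (φ : Lp ℂ 2 (volume : Measure (E d))) (x : E (d + 1)) : ℂ :=
  ∫ y : E d, deriv (fun t : ℝ ↦ fundamentalSolution (d + 1) k x (point y t)) 0 * φ y

/-- The weak normal derivative (trace from `U⁺`, in the direction of the last coordinate) of `u`,
acting bilinearly on the boundary values of `v`:
`- ∫_{U⁺} (∇u · ∇v + v Δu) dx`. -/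
def weakNormalDerivative {d : ℕ} (u v : E (d + 1) → ℂ) : ℂ :=
  - ∫ x in upperHalfSpace d,
      ((∑ i : Fin (d + 1), fderiv ℝ u x (EuclideanSpace.single i (1 : ℝ)) *
          fderiv ℝ v x (EuclideanSpace.single i (1 : ℝ))) +
        v x * Laplacian.laplacian u x)

/-- `U ∈ H^{-1/2}(ℝ^d)` and `U|_Γ = T_k φ`, where `T_k φ` is the restriction to `Γ` of the weak
normal derivative of the double layer potential `𝒟_k φ`. In other words, `T_k φ ∈ H^{-1/2}(Γ)` and
`U` is an extension of it to `ℝ^d`.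

Here `ψ` runs through `𝒟(Γ)` and `v` through its extensions to test functions on `ℝ^{d+1}`. A
cut-off `χ ∈ 𝒟(ℝ^{d+1})` multiplying `𝒟_k φ`, with `χ = 1` near `Γ` and near the compact support of
`v`, would not change the value of the integral. -/
def ExtendsHypersingular {d : ℕ} (Γ : Set (E d)) (k : ℝ) (φ : Lp ℂ 2 (volume : Measure (E d)))
    (U : 𝓢'(E d, ℂ)) : Prop :=
  TemperedDistribution.MemSobolev (-(1 / 2)) 2 U ∧
    ∀ (ψ : 𝓢(E d, ℂ)) (v : E (d + 1) → ℂ), IsTestFunctionOn Γ ψ →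
      ContDiff ℝ ∞ v → HasCompactSupport v → (∀ x : E d, v (point x 0) = ψ x) →
      U ψ = weakNormalDerivative (doubleLayer k φ) v

open Classical in
/-- The form `b(φ, ψ) = ⟨T_k φ, ψ⟩_{H^{-1/2}(Γ) × H̃^{1/2}(Γ)} = ⟨U, ψ⟩_{1/2}`, where `U` is any
extension of `T_k φ` to an element of `H^{-1/2}(ℝ^d)`; zero if there is no such extension. -/
def hypersingularForm {d : ℕ} (Γ : Set (E d)) (k : ℝ)
    (φ ψ : Lp ℂ 2 (volume : Measure (E d))) : ℂ :=
  if h : ∃ U : 𝓢'(E d, ℂ), ExtendsHypersingular Γ k φ U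
  then dualPairing (1 / 2) h.choose (ψ : 𝓢'(E d, ℂ)) else 0

end ScreenScattering

end

open ScreenScattering

/-!
On the Fourier side the hypersingular operator of a flat screen is multiplication by `(i/2) Z(ξ)`,
where `ξ = 2πη` is the horizontal frequency and `Z(ξ) = √(k² - |ξ|²)` is the vertical wavenumber
(`verticalWavenumber`), real for `|ξ| ≤ k` and in `i[0, ∞)` beyond.

*The kernel.* The kernel of the double layer potential at height `t` is the inverse Fourier
transform of `½ e^{itZ}` (`deriv_fundamentalSolution`). For `Δ - μ²` with `μ > 0` in the place of
the Helmholtz operator this is subordination: `e^{-t√(|ξ|² + μ²)}` is an integral of Gaussians in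
`ξ`, so its inverse transform is an integral of heat kernels
(`integral_exp_neg_mul_sqrt_mul_exp_inner`). These integrals (`heatIntegral`) satisfy a recursion
under differentiation in `R`, and their closed forms give the exponential for `d = 2` and Hankel's
integral for `d = 1`. Both sides are holomorphic in `μ`, so the identity extends to `Re μ > 0`
(`integral_exp_neg_mul_decayRate`), and limiting absorption `μ → -ik` gives the Helmholtz case
(`integral_exp_verticalWavenumber`).

*The operator.* Hence `𝒟_k φ` is a superposition of plane waves with amplitude `½ φ̂`
(`doubleLayer_eq_waveIntegral`). It solves the Helmholtz equation, and as `φ ∈ H^{1/2}`, Plancherel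
on horizontal slices shows that it and its gradient are square integrable near the boundary. Green's
formula above height `ε` and the limit `ε → 0` then show that the weak normal derivative has the
Fourier transform `(i/2) Z φ̂` (`IsAmplitude.weakNormalDerivative_eq`,
`exists_extendsHypersingular`), which lies in the weighted `L²` space of `H^{-1/2}`. The pairing
does not depend on the extension because test functions are dense in `H̃^{1/2}(Γ)`
(`dualPairing_eq_of_eq_on_testFunctions`).

*Coercivity.* So `b(φ, φ) = ∫ (i/2) Z |φ̂|²`. Both `Re Z` and `Im Z` are non-negative, so there is
no cancellation and `|b(φ, φ)| ≥ ¼ ∫ √|k² - |ξ|²| |φ̂|²` (`norm_integral_verticalWavenumber_ge`).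
This weight falls short of `√(k² + |ξ|²)` only near the sphere `|ξ| = k`. As `φ` is supported in a
set of diameter `L`, its transform varies slowly on the scale `1/L`
(`exists_unimodular_fourier_shift`), hence a fixed share of `∫ |φ̂|²` comes from
`||ξ| - k| ≥ 1/(16 L)` (`integral_norm_sq_le_setIntegral_compl_annulus`), where the weight is at
least of order `√(k/L)`. The loss is therefore a factor `(kL)^{1/2}`
(`sobolev_energy_le_verticalWeight_energy`), in both dimensions; for `d = 2` this is stronger than
the exponent `-2/3` when `kL` is bounded below.
-/

noncomputable section

namespace ScreenScattering

open FourierTransform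

variable {d : ℕ}

/-! ### Parametric integrals and the Fourier transform on `L¹ ∩ L²` -/

/-- A parametric integral of holomorphic functions that are locally dominated is holomorphic. The
derivatives are dominated as well, by Cauchy's estimate. -/
theorem differentiableOn_integral_of_locally_dominated {α : Type*} [MeasurableSpace α]
    {μ : Measure α} {Ω : Set ℂ} (hΩ : IsOpen Ω) {F : ℂ → α → ℂ}
    (hmeas : ∀ z ∈ Ω, AEStronglyMeasurable (F z) μ)
    (hdiff : ∀ᵐ a ∂μ, DifferentiableOn ℂ (fun z ↦ F z a) Ω)
    (hbd : ∀ z ∈ Ω, ∃ r > 0, ∃ g : α → ℝ, Integrable g μ ∧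
      ∀ᵐ a ∂μ, ∀ w ∈ Metric.ball z r ∩ Ω, ‖F w a‖ ≤ g a) :
    DifferentiableOn ℂ (fun z ↦ ∫ a, F z a ∂μ) Ω := by
  intro z hz
  obtain ⟨r, hr, g, hg, hgb⟩ := hbd z hz
  obtain ⟨r', hr', hball⟩ := Metric.isOpen_iff.1 hΩ z hz
  set ρ := min r r' / 4 with hρ
  have hρ0 : 0 < ρ := by positivity
  have hsub : ∀ w ∈ Metric.ball z ρ, Metric.closedBall w ρ ⊆ Metric.ball z r ∩ Ω := by
    intro w hw y hy
    rw [Metric.mem_ball] at hw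
    rw [Metric.mem_closedBall] at hy
    have h1 : dist y z < min r r' := by
      have := dist_triangle y w z
      have : 0 < min r r' := by positivity
      linarith
    exact ⟨lt_of_lt_of_le h1 (min_le_left _ _), hball (lt_of_lt_of_le h1 (min_le_right _ _))⟩
  have hnear : ∀ w ∈ Metric.ball z ρ, w ∈ Metric.ball z r ∩ Ω := fun w hw ↦
    hsub w hw (Metric.mem_closedBall_self hρ0.le)
  have hcont : Integrable (F z) μ := by
    refine Integrable.mono' hg (hmeas z hz) ?_
    filter_upwards [hgb] with a ha
    exact ha z (hnear z (Metric.mem_ball_self hρ0))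
  have hderiv : ∀ᵐ a ∂μ, ∀ w ∈ Metric.ball z ρ,
      HasDerivAt (fun y ↦ F y a) (deriv (fun y ↦ F y a) w) w := by
    filter_upwards [hdiff] with a ha w hw
    exact (ha.differentiableAt (hΩ.mem_nhds (hnear w hw).2)).hasDerivAt
  refine (hasDerivAt_integral_of_dominated_loc_of_deriv_le (bound := fun a ↦ g a / ρ)
    (F' := fun w a ↦ deriv (fun y ↦ F y a) w) (Metric.ball_mem_nhds z hρ0) ?_ hcont ?_ ?_
    (hg.div_const ρ) hderiv).2.differentiableAt.differentiableWithinAt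
  · filter_upwards [hΩ.mem_nhds hz] with w hw using hmeas w hw
  · -- the derivative is an a.e. limit of difference quotients
    have hseq : Filter.Tendsto (fun n : ℕ ↦ ((ρ / 2 / (n + 1) : ℝ) : ℂ)) Filter.atTop
        (nhdsWithin 0 {0}ᶜ) := by
      refine tendsto_nhdsWithin_iff.2 ⟨?_, Filter.Eventually.of_forall fun n ↦ ?_⟩
      · have h : Filter.Tendsto (fun n : ℕ ↦ (ρ / 2 / ((n : ℝ) + 1))) Filter.atTop (nhds 0) :=
          tendsto_const_div_atTop_nhds_zero_nat (ρ / 2) |>.comp (Filter.tendsto_add_atTop_nat 1)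
            |>.congr fun n ↦ by simp
        exact_mod_cast (Complex.continuous_ofReal.tendsto 0).comp h
      · simp only [Set.mem_compl_iff, Set.mem_singleton_iff, Complex.ofReal_eq_zero]
        positivity
    refine aestronglyMeasurable_of_tendsto_ae Filter.atTop
      (f := fun (n : ℕ) a ↦ ((ρ / 2 / (n + 1) : ℝ) : ℂ)⁻¹ •
        (F (z + ((ρ / 2 / (n + 1) : ℝ) : ℂ)) a - F z a)) (fun n ↦ ?_) ?_
    · refine ((hmeas _ (hnear _ ?_).2).sub (hmeas z hz)).const_smul
        (((ρ / 2 / (n + 1) : ℝ) : ℂ)⁻¹)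
      rw [Metric.mem_ball, dist_eq_norm, add_sub_cancel_left, Complex.norm_real, Real.norm_eq_abs,
        abs_of_pos (by positivity), div_lt_iff₀ (by positivity)]
      nlinarith [(Nat.cast_nonneg n : (0 : ℝ) ≤ n)]
    · filter_upwards [hderiv] with a ha
      exact (hasDerivAt_iff_tendsto_slope_zero.1 (ha z (Metric.mem_ball_self hρ0))).comp hseq
  · filter_upwards [hgb, hdiff] with a ha hda w hw
    refine Complex.norm_deriv_le_of_forall_mem_sphere_norm_le hρ0 ?_ fun y hy ↦
      ha y (hsub w hw (Metric.sphere_subset_closedBall hy))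
    refine DifferentiableOn.diffContOnCl (hda.mono ?_)
    rw [closure_ball _ hρ0.ne']
    exact fun y hy ↦ (hsub w hw hy).2

/-- The Fourier integral of a function in `L¹ ∩ L²` agrees with its `L²` Fourier transform. -/
theorem fourier_toLp_ae_eq {f : E d → ℂ} (hf : Integrable f) (hf2 : MemLp f 2) :
    (𝓕 (hf2.toLp f) : Lp ℂ 2 (volume : Measure (E d))) =ᵐ[volume] 𝓕 f := by
  refine ae_eq_of_integral_contDiff_smul_eq
    ((Lp.memLp _).locallyIntegrable (by norm_num)) ?_ fun g hg hgc ↦ ?_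
  · exact (VectorFourier.fourierIntegral_continuous Real.continuous_fourierChar
      (by exact continuous_inner) hf).locallyIntegrable
  · have hg₁ : HasCompactSupport (Complex.ofRealCLM ∘ g) := hgc.comp_left rfl
    have hg₂ : ContDiff ℝ ∞ (Complex.ofRealCLM ∘ g) := by fun_prop
    set G : 𝓢(E d, ℂ) := hg₁.toSchwartzMap hg₂
    have hG : ∀ x, G x = (g x : ℂ) := fun x ↦ rfl
    have h1 := congrArg (fun T : 𝓢'(E d, ℂ) ↦ T G)
      (Lp.fourier_toTemperedDistribution_eq (hf2.toLp f))
    simp only [TemperedDistribution.fourier_apply, Lp.toTemperedDistribution_apply] at h1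
    calc ∫ x, g x • (𝓕 (hf2.toLp f) : Lp ℂ 2 (volume : Measure (E d))) x
        = ∫ x, G x • (𝓕 (hf2.toLp f) : Lp ℂ 2 (volume : Measure (E d))) x := by
          simp only [hG, Complex.coe_smul]
      _ = ∫ x, (𝓕 G) x • (hf2.toLp f) x := h1.symm
      _ = ∫ x, (𝓕 (G : E d → ℂ)) x • f x := by
          refine integral_congr_ae ?_
          filter_upwards [hf2.coeFn_toLp] with x hx
          rw [hx, SchwartzMap.fourier_coe]
      _ = ∫ x, G x • 𝓕 f x := by
          have := VectorFourier.integral_fourierIntegral_smul_eq_flip (L := innerₗ (E d))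
            (μ := volume) (ν := volume) Real.continuous_fourierChar (by exact continuous_inner)
            G.integrable hf
          rw [flip_innerₗ] at this
          exact this
      _ = ∫ x, g x • 𝓕 f x := by simp only [hG, Complex.coe_smul]

/-- Plancherel's theorem for the Fourier integral on `L¹ ∩ L²`. -/
theorem memLp_fourier {f : E d → ℂ} (hf : Integrable f) (hf2 : MemLp f 2) :
    MemLp (𝓕 f) 2 ∧ eLpNorm (𝓕 f) 2 volume = eLpNorm f 2 volume := by
  have h := fourier_toLp_ae_eq hf hf2
  refine ⟨(memLp_congr_ae h).1 (Lp.memLp _), ?_⟩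
  rw [← eLpNorm_congr_ae h, ← eLpNorm_congr_ae hf2.coeFn_toLp, ← Lp.enorm_def, ← Lp.enorm_def,
    ← ofReal_norm, ← ofReal_norm, Lp.norm_fourier_eq]

theorem integral_norm_sq_eq_of_eLpNorm_eq {X Y : Type*} [MeasurableSpace X] [MeasurableSpace Y]
    {μ : Measure X} {ν : Measure Y} {f : X → ℂ} {g : Y → ℂ} (hf : MemLp f 2 μ) (hg : MemLp g 2 ν)
    (h : eLpNorm f 2 μ = eLpNorm g 2 ν) : ∫ x, ‖f x‖ ^ 2 ∂μ = ∫ x, ‖g x‖ ^ 2 ∂ν := by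
  have hF := hf.eLpNorm_eq_integral_rpow_norm (by norm_num) (by norm_num)
  have hG := hg.eLpNorm_eq_integral_rpow_norm (by norm_num) (by norm_num)
  rw [hF, hG, ENNReal.ofReal_eq_ofReal_iff (by positivity) (by positivity)] at h
  simp only [ENNReal.toReal_ofNat, Real.rpow_ofNat] at h
  rwa [Real.rpow_left_inj (by positivity) (by positivity) (by norm_num)] at h

/-- Plancherel's theorem for the inverse Fourier integral on `L¹ ∩ L²`. -/
theorem memLp_fourierInv {f : E d → ℂ} (hf : Integrable f) (hf2 : MemLp f 2) :
    MemLp (𝓕⁻ f) 2 ∧ ∫ x, ‖𝓕⁻ f x‖ ^ 2 = ∫ x, ‖f x‖ ^ 2 := by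
  have h := memLp_fourier hf hf2
  have hmp := Measure.measurePreserving_neg (volume : Measure (E d))
  have he : 𝓕⁻ f = fun x ↦ 𝓕 f (-x) := funext fun x ↦ Real.fourierInv_eq_fourier_neg f x
  rw [he]
  refine ⟨h.1.comp_measurePreserving hmp, ?_⟩
  rw [integral_neg_eq_self (fun x ↦ ‖𝓕 f x‖ ^ 2)]
  exact integral_norm_sq_eq_of_eLpNorm_eq h.1 hf2 h.2

/-! ### Heat kernel integrals -/

/-- The integral `∫_0^∞ s^{-p} e^{-R²/(4s) - sμ²} ds`: for `p = (d + 1) / 2` this is, up to a power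
of `4π`, the integral over time of the heat kernel of `Δ - μ²` on `ℝ^{d+1}` at distance `R`. -/
def heatIntegral (p R μ : ℝ) : ℝ :=
  ∫ s in Set.Ioi (0 : ℝ), s ^ (-p) * Real.exp (-(R ^ 2 / (4 * s)) - s * μ ^ 2)

theorem measurable_heatIntegrand (p R μ : ℝ) :
    Measurable fun s : ℝ ↦ s ^ (-p) * Real.exp (-(R ^ 2 / (4 * s)) - s * μ ^ 2) := by
  fun_prop

theorem integrableOn_heatIntegrand (p : ℝ) {R μ : ℝ} (hR : 0 < R) (hμ : 0 < μ) :
    IntegrableOn (fun s : ℝ ↦ s ^ (-p) * Real.exp (-(R ^ 2 / (4 * s)) - s * μ ^ 2))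
      (Set.Ioi 0) := by
  obtain ⟨n, hn⟩ := exists_nat_ge p
  -- the factor `e^{-R²/(4s)}` compensates any negative power of `s`
  have hint : IntegrableOn (fun s : ℝ ↦ (n.factorial * (4 / R ^ 2) ^ n) *
      (s ^ ((n : ℝ) - p) * Real.exp (-μ ^ 2 * s))) (Set.Ioi 0) := by
    refine Integrable.const_mul ?_ _
    have := integrableOn_rpow_mul_exp_neg_mul_rpow (s := (n : ℝ) - p) (p := 1) (b := μ ^ 2)
      (by linarith) one_pos (by positivity)
    simpa [IntegrableOn] using this
  refine Integrable.mono' hint (measurable_heatIntegrand p R μ).aestronglyMeasurable ?_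
  filter_upwards [ae_restrict_mem measurableSet_Ioi] with s hs
  have hs : 0 < s := hs
  rw [Real.norm_of_nonneg (by positivity), sub_eq_add_neg, Real.exp_add]
  have h1 : Real.exp (-(R ^ 2 / (4 * s))) ≤ n.factorial * (4 / R ^ 2) ^ n * s ^ n := by
    have h2 := Real.pow_div_factorial_le_exp (R ^ 2 / (4 * s)) (by positivity) n
    rw [Real.exp_neg, inv_le_comm₀ (by positivity) (by positivity)]
    refine le_trans (le_of_eq ?_) h2
    have h4 : (4 / R ^ 2) ^ n * s ^ n * (R ^ 2 / (4 * s)) ^ n = 1 := by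
      rw [← mul_pow, ← mul_pow, show 4 / R ^ 2 * s * (R ^ 2 / (4 * s)) = 1 by field_simp, one_pow]
    rw [mul_assoc, mul_inv, inv_eq_of_mul_eq_one_right h4]
    ring
  have h3 : s ^ ((n : ℝ) - p) = s ^ (-p) * s ^ n := by
    rw [sub_eq_neg_add, Real.rpow_add hs, Real.rpow_natCast]
  calc s ^ (-p) * (Real.exp (-(R ^ 2 / (4 * s))) * Real.exp (-(s * μ ^ 2)))
      ≤ s ^ (-p) * ((n.factorial * (4 / R ^ 2) ^ n * s ^ n) * Real.exp (-(s * μ ^ 2))) := by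
        gcongr
    _ = _ := by rw [h3]; ring_nf

theorem hasDerivAt_heatIntegral (p : ℝ) {R μ : ℝ} (hR : 0 < R) (hμ : 0 < μ) :
    HasDerivAt (fun r ↦ heatIntegral p r μ) (-(R / 2) * heatIntegral (p + 1) R μ) R := by
  have key := (hasDerivAt_integral_of_dominated_loc_of_deriv_le
    (μ := volume.restrict (Set.Ioi (0 : ℝ)))
    (F := fun r s : ℝ ↦ s ^ (-p) * Real.exp (-(r ^ 2 / (4 * s)) - s * μ ^ 2))
    (F' := fun r s : ℝ ↦ -(r / 2) *
      (s ^ (-(p + 1)) * Real.exp (-(r ^ 2 / (4 * s)) - s * μ ^ 2)))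
    (bound := fun s : ℝ ↦ R * (s ^ (-(p + 1)) * Real.exp (-((R / 2) ^ 2 / (4 * s)) - s * μ ^ 2)))
    (x₀ := R) (s := Set.Ioo (R / 2) (2 * R)) (Ioo_mem_nhds (by linarith) (by linarith))
    (Filter.Eventually.of_forall fun r ↦ (measurable_heatIntegrand p r μ).aestronglyMeasurable)
    (integrableOn_heatIntegrand p hR hμ)
    ((measurable_heatIntegrand (p + 1) R μ).const_mul _).aestronglyMeasurable ?_
    ((integrableOn_heatIntegrand (p + 1) (half_pos hR) hμ).const_mul R) ?_).2
  · rw [integral_const_mul] at key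
    exact key
  · filter_upwards [ae_restrict_mem measurableSet_Ioi] with s hs r hr
    have hs : 0 < s := hs
    have hr0 : 0 < r := lt_trans (half_pos hR) hr.1
    rw [norm_mul, norm_neg, Real.norm_of_nonneg (by positivity),
      Real.norm_of_nonneg (by positivity)]
    have h1 : r / 2 ≤ R := by linarith [hr.2]
    have h2 : R / 2 ≤ r := hr.1.le
    gcongr
  · filter_upwards [ae_restrict_mem measurableSet_Ioi] with s hs r hr
    have hs : 0 < s := hs
    have h1 : HasDerivAt (fun r : ℝ ↦ -(r ^ 2 / (4 * s)) - s * μ ^ 2) (-(2 * r / (4 * s))) r := by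
      simpa using (((hasDerivAt_pow 2 r).div_const (4 * s)).neg).sub_const (s * μ ^ 2)
    refine (h1.exp.const_mul (s ^ (-p))).congr_deriv ?_
    rw [neg_add, Real.rpow_add hs, Real.rpow_neg_one]
    field_simp
    ring

/-- The substitution `s = (R / (2μ)) (w + √(1 + w²))²`, under which
`R² / (4s) + sμ² = μR (1 + 2w²)`. -/
theorem heatIntegral_eq_integral_arsinh (p : ℝ) {R μ : ℝ} (hR : 0 < R) (hμ : 0 < μ) :
    heatIntegral p R μ = ∫ w : ℝ, 2 * (√(1 + w ^ 2))⁻¹ *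
      (R / (2 * μ) * Real.exp (2 * Real.arsinh w)) ^ (1 - p) *
        Real.exp (-(μ * R * (1 + 2 * w ^ 2))) := by
  set c := R / (2 * μ) with hc
  have hc0 : 0 < c := by positivity
  have himage : (fun w : ℝ ↦ c * Real.exp (2 * Real.arsinh w)) '' Set.univ = Set.Ioi 0 := by
    ext s
    simp only [Set.image_univ, Set.mem_range, Set.mem_Ioi]
    constructor
    · rintro ⟨w, rfl⟩; positivity
    · intro hs
      refine ⟨Real.sinh (Real.log (s / c) / 2), ?_⟩
      rw [Real.arsinh_sinh, mul_div_cancel₀ _ two_ne_zero, Real.exp_log (by positivity)]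
      field_simp
  have hder : ∀ w ∈ (Set.univ : Set ℝ), HasDerivWithinAt
      (fun w : ℝ ↦ c * Real.exp (2 * Real.arsinh w))
      (c * (Real.exp (2 * Real.arsinh w) * (2 * (√(1 + w ^ 2))⁻¹))) Set.univ w := fun w _ ↦
    (((Real.hasDerivAt_arsinh w).const_mul 2).exp.const_mul c).hasDerivWithinAt
  have hinj : Set.InjOn (fun w : ℝ ↦ c * Real.exp (2 * Real.arsinh w)) Set.univ := by
    intro a _ b _ hab
    have : Real.arsinh a = Real.arsinh b := by simpa [hc0.ne'] using hab
    exact Real.arsinh_injective this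
  unfold heatIntegral
  rw [← himage, integral_image_eq_integral_abs_deriv_smul MeasurableSet.univ hder hinj,
    Measure.restrict_univ]
  refine integral_congr_ae (Filter.Eventually.of_forall fun w ↦ ?_)
  simp only [smul_eq_mul]
  have hexp : 0 < Real.exp (2 * Real.arsinh w) := Real.exp_pos _
  have h1 : -(R ^ 2 / (4 * (c * Real.exp (2 * Real.arsinh w)))) -
      c * Real.exp (2 * Real.arsinh w) * μ ^ 2 = -(μ * R * (1 + 2 * w ^ 2)) := by
    have h2 : 1 + 2 * w ^ 2 = (Real.exp (2 * Real.arsinh w) +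
        (Real.exp (2 * Real.arsinh w))⁻¹) / 2 := by
      rw [← Real.exp_neg, ← Real.cosh_eq, Real.cosh_two_mul, Real.cosh_sq, Real.sinh_arsinh]
      ring
    rw [h2, hc]
    field_simp
    ring
  rw [h1, abs_of_pos (by positivity), sub_eq_add_neg, Real.rpow_add (by positivity),
    Real.rpow_one]
  ring

theorem integrable_bounded_mul_gaussian {g : ℝ → ℝ} (hg : Measurable g) {C : ℝ}
    (hC : ∀ w, |g w| ≤ C) {b : ℝ} (hb : 0 < b) (a : ℝ) :
    Integrable fun w : ℝ ↦ g w * Real.exp (-(b * (a + 2 * w ^ 2))) := by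
  have h := (integrable_exp_neg_mul_sq (b := 2 * b) (by positivity)).const_mul
    (C * Real.exp (-(b * a)))
  refine h.mono' (by fun_prop) (Filter.Eventually.of_forall fun w ↦ ?_)
  rw [norm_mul, Real.norm_eq_abs, Real.norm_of_nonneg (Real.exp_pos _).le, mul_assoc,
    ← Real.exp_add]
  have : -(b * a) + -(2 * b) * w ^ 2 = -(b * (a + 2 * w ^ 2)) := by ring
  rw [this]
  gcongr
  exact hC w

/-- The heat integral for `d = 2` in closed form: up to a constant, the Yukawa potential. -/
theorem heatIntegral_three_halves {R μ : ℝ} (hR : 0 < R) (hμ : 0 < μ) :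
    heatIntegral (3 / 2) R μ = 2 * √Real.pi / R * Real.exp (-(μ * R)) := by
  rw [heatIntegral_eq_integral_arsinh _ hR hμ]
  set c := R / (2 * μ) with hc
  have hc0 : 0 < c := by positivity
  have hx : 0 < μ * R := by positivity
  set g : ℝ → ℝ := fun w ↦ w * (√(1 + w ^ 2))⁻¹ with hgdef
  have hgb : ∀ w, |g w| ≤ 1 := by
    intro w
    have h0 : 0 < √(1 + w ^ 2) := by positivity
    rw [hgdef, abs_mul, abs_inv, abs_of_pos h0, ← div_eq_mul_inv, div_le_one h0]
    exact Real.abs_le_sqrt (by linarith)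
  have hpt : ∀ w : ℝ, 2 * (√(1 + w ^ 2))⁻¹ * (c * Real.exp (2 * Real.arsinh w)) ^ (1 - 3 / 2 : ℝ) *
      Real.exp (-(μ * R * (1 + 2 * w ^ 2))) = 2 * c ^ (-(1 / 2) : ℝ) *
      (1 * Real.exp (-(μ * R * (1 + 2 * w ^ 2))) -
        g w * Real.exp (-(μ * R * (1 + 2 * w ^ 2)))) := by
    intro w
    have h0 : 0 < √(1 + w ^ 2) := by positivity
    have h1 : (c * Real.exp (2 * Real.arsinh w)) ^ (1 - 3 / 2 : ℝ) =
        c ^ (-(1 / 2) : ℝ) * (√(1 + w ^ 2) - w) := by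
      rw [show (1 - 3 / 2 : ℝ) = -(1 / 2) by norm_num,
        Real.mul_rpow hc0.le (Real.exp_pos _).le, ← Real.exp_mul,
        show 2 * Real.arsinh w * (-(1 / 2)) = Real.arsinh (-w) by rw [Real.arsinh_neg]; ring,
        Real.exp_arsinh]
      ring_nf
    rw [h1, hgdef]
    field_simp
  simp_rw [hpt]
  rw [integral_const_mul, integral_sub (integrable_bounded_mul_gaussian (C := 1)
    measurable_const (by simp) hx 1) (integrable_bounded_mul_gaussian
      (by fun_prop) hgb hx 1)]
  have hodd : ∫ w, g w * Real.exp (-(μ * R * (1 + 2 * w ^ 2))) = 0 := by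
    have h1 := integral_neg_eq_self (fun w ↦ g w * Real.exp (-(μ * R * (1 + 2 * w ^ 2)))) volume
    have h2 : ∀ w, g (-w) * Real.exp (-(μ * R * (1 + 2 * (-w) ^ 2))) =
        -(g w * Real.exp (-(μ * R * (1 + 2 * w ^ 2)))) := by
      intro w; simp [hgdef]
    simp_rw [h2] at h1
    rw [integral_neg] at h1
    linarith
  have hgauss : ∫ w : ℝ, 1 * Real.exp (-(μ * R * (1 + 2 * w ^ 2))) =
      Real.exp (-(μ * R)) * √(Real.pi / (2 * (μ * R))) := by
    rw [← integral_gaussian, ← integral_const_mul]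
    refine integral_congr_ae (Filter.Eventually.of_forall fun w ↦ ?_)
    simp only [one_mul]
    rw [← Real.exp_add]
    ring_nf
  rw [hodd, hgauss, sub_zero]
  have h2 : c ^ (-(1 / 2) : ℝ) * √(Real.pi / (2 * (μ * R))) = √Real.pi / R := by
    rw [Real.rpow_neg hc0.le, ← Real.sqrt_eq_rpow, ← Real.sqrt_inv, ← Real.sqrt_mul (by positivity),
      show c⁻¹ * (Real.pi / (2 * (μ * R))) = Real.pi / R ^ 2 by rw [hc]; field_simp,
      Real.sqrt_div Real.pi_pos.le, Real.sqrt_sq hR.le]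
  calc _ = 2 * (c ^ (-(1 / 2) : ℝ) * √(Real.pi / (2 * (μ * R)))) * Real.exp (-(μ * R)) := by ring
    _ = _ := by rw [h2]; ring

/-- The Laplace integral in Hankel's formula, with `2w` in the place of `-2ix`. -/
def hankelIntegral (w : ℂ) : ℂ :=
  ∫ t in Set.Ioi (0 : ℝ), ((Real.exp (-t) * t ^ (-(1 / 2) : ℝ) : ℝ) : ℂ) *
    (1 + t / (2 * w)) ^ (-(1 / 2) : ℂ)

/-- The heat integral for `d = 1` is a Macdonald function, here in the form of Hankel's integral. -/
theorem heatIntegral_one {R μ : ℝ} (hR : 0 < R) (hμ : 0 < μ) :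
    (heatIntegral 1 R μ : ℂ) = 2 * (2 * (μ * R : ℝ) : ℂ) ^ (-(1 / 2) : ℂ) *
      Complex.exp (-(μ * R : ℝ)) * hankelIntegral (μ * R : ℝ) := by
  set x := μ * R with hx
  have hx0 : 0 < x := by positivity
  have h1 : heatIntegral 1 R μ = 4 * Real.exp (-x) *
      ∫ w in Set.Ioi (0 : ℝ), (√(1 + w ^ 2))⁻¹ * Real.exp (-(2 * x * w ^ 2)) := by
    rw [heatIntegral_eq_integral_arsinh _ hR hμ]
    have h2 : ∀ w : ℝ, 2 * (√(1 + w ^ 2))⁻¹ *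
        (R / (2 * μ) * Real.exp (2 * Real.arsinh w)) ^ (1 - 1 : ℝ) *
        Real.exp (-(μ * R * (1 + 2 * w ^ 2))) =
        (fun v : ℝ ↦ 2 * Real.exp (-x) * ((√(1 + v ^ 2))⁻¹ * Real.exp (-(2 * x * v ^ 2)))) |w| := by
      intro w
      simp only [sq_abs, sub_self, Real.rpow_zero]
      rw [← hx, show -(x * (1 + 2 * w ^ 2)) = -x + -(2 * x * w ^ 2) by ring, Real.exp_add]
      ring
    simp_rw [h2]
    rw [integral_comp_abs (f := fun v : ℝ ↦ 2 * Real.exp (-x) *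
      ((√(1 + v ^ 2))⁻¹ * Real.exp (-(2 * x * v ^ 2)))), integral_const_mul]
    ring
  -- the substitution `t = 2 x w²`
  have h3 : ∫ t in Set.Ioi (0 : ℝ), Real.exp (-t) * t ^ (-(1 / 2) : ℝ) *
      (1 + t / (2 * x)) ^ (-(1 / 2) : ℝ) = 2 * √(2 * x) *
      ∫ w in Set.Ioi (0 : ℝ), (√(1 + w ^ 2))⁻¹ * Real.exp (-(2 * x * w ^ 2)) := by
    rw [← integral_comp_rpow_Ioi (fun t : ℝ ↦ Real.exp (-t) * t ^ (-(1 / 2) : ℝ) *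
      (1 + t / (2 * x)) ^ (-(1 / 2) : ℝ)) (p := 2) two_ne_zero]
    have h4 := integral_comp_mul_left_Ioi (fun v : ℝ ↦ (|2| * v ^ ((2 : ℝ) - 1)) •
      (Real.exp (-(v ^ (2 : ℝ))) * (v ^ (2 : ℝ)) ^ (-(1 / 2) : ℝ) *
      (1 + (v ^ (2 : ℝ)) / (2 * x)) ^ (-(1 / 2) : ℝ))) 0 (b := √(2 * x)) (by positivity)
    rw [mul_zero, smul_eq_mul, eq_inv_mul_iff_mul_eq₀ (by positivity)] at h4
    rw [← h4, mul_comm 2 √(2 * x), mul_assoc]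
    refine congrArg (√(2 * x) * ·) ?_
    rw [← integral_const_mul]
    refine setIntegral_congr_fun measurableSet_Ioi fun w hw ↦ ?_
    have hw : 0 < w := hw
    have hb : 0 < √(2 * x) * w := by positivity
    simp only [smul_eq_mul, Real.rpow_two]
    have e1 : (√(2 * x) * w) ^ 2 = 2 * x * w ^ 2 := by
      rw [mul_pow, Real.sq_sqrt (by positivity)]
    have e2 : ((√(2 * x) * w) ^ 2) ^ (-(1 / 2) : ℝ) = (√(2 * x) * w)⁻¹ := by
      rw [← Real.rpow_natCast, ← Real.rpow_mul hb.le, Nat.cast_ofNat,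
        show (2 : ℝ) * -(1 / 2) = -1 by norm_num, Real.rpow_neg_one]
    have e3 : (1 + 2 * x * w ^ 2 / (2 * x)) ^ (-(1 / 2) : ℝ) = (√(1 + w ^ 2))⁻¹ := by
      rw [mul_div_cancel_left₀ _ (by positivity), Real.rpow_neg (by positivity), Real.sqrt_eq_rpow]
    rw [e2, e1, e3, abs_of_pos two_pos]
    norm_num
    field_simp
  have h5 : hankelIntegral (x : ℝ) = ((∫ t in Set.Ioi (0 : ℝ), Real.exp (-t) *
      t ^ (-(1 / 2) : ℝ) * (1 + t / (2 * x)) ^ (-(1 / 2) : ℝ) : ℝ) : ℂ) := by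
    unfold hankelIntegral
    rw [← integral_complex_ofReal]
    refine setIntegral_congr_fun measurableSet_Ioi fun t ht ↦ ?_
    have ht : 0 < t := ht
    rw [Complex.ofReal_mul _ ((1 + t / (2 * x)) ^ (-(1 / 2) : ℝ)),
      Complex.ofReal_cpow (by positivity)]
    push_cast
    rfl
  have h6 : (2 * (x : ℂ)) ^ (-(1 / 2) : ℂ) = (((√(2 * x))⁻¹ : ℝ) : ℂ) := by
    rw [Real.sqrt_eq_rpow, ← Real.rpow_neg (by positivity), Complex.ofReal_cpow (by positivity)]
    push_cast
    rfl
  rw [h5, h6, h1, h3, ← Complex.ofReal_neg, ← Complex.ofReal_exp]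
  norm_cast
  field_simp
  ring_nf

/-- The subordination formula `e^{-tλ} = t / (2√π) ∫_0^∞ s^{-3/2} e^{-t²/(4s) - sλ²} ds`. -/
theorem exp_neg_mul_eq_heatIntegral {t l : ℝ} (ht : 0 < t) (hl : 0 < l) :
    Real.exp (-(t * l)) = t / (2 * √Real.pi) * heatIntegral (3 / 2) t l := by
  rw [heatIntegral_three_halves ht hl, mul_comm l t]
  have : 0 < √Real.pi := Real.sqrt_pos.2 Real.pi_pos
  field_simp

theorem heatIntegrand_mul_gaussian_exponent (s t μ r : ℝ) :
    Real.exp (-(t ^ 2 / (4 * s)) - s * ((2 * Real.pi * r) ^ 2 + μ ^ 2)) =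
      Real.exp (-(t ^ 2 / (4 * s)) - s * μ ^ 2) * Real.exp (-(4 * Real.pi ^ 2 * s) * r ^ 2) := by
  rw [← Real.exp_add]
  ring_nf

theorem gaussian_prefactor {s : ℝ} (hs : 0 < s) :
    (Real.pi / (4 * Real.pi ^ 2 * s)) ^ ((d : ℝ) / 2) =
      (4 * Real.pi) ^ (-(d : ℝ) / 2) * s ^ (-(d : ℝ) / 2) := by
  have hp := Real.pi_pos
  rw [← Real.mul_rpow (by positivity) hs.le, neg_div, Real.rpow_neg (by positivity),
    ← Real.inv_rpow (by positivity)]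
  congr 1
  field_simp

/-- The joint integrand of the subordination formula and the inverse Fourier transform. -/
def subordinationIntegrand (t μ : ℝ) (z : E d) (η : E d) (s : ℝ) : ℂ :=
  ((s ^ (-(3 / 2) : ℝ) * Real.exp (-(t ^ 2 / (4 * s)) - s * ((2 * Real.pi * ‖η‖) ^ 2 + μ ^ 2)) :
    ℝ) : ℂ) * Complex.exp (2 * Real.pi * Complex.I * (inner ℝ z η : ℝ))

theorem norm_subordinationIntegrand (t μ : ℝ) (z η : E d) {s : ℝ} (hs : 0 < s) :
    ‖subordinationIntegrand t μ z η s‖ = s ^ (-(3 / 2) : ℝ) *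
      Real.exp (-(t ^ 2 / (4 * s)) - s * μ ^ 2) * Real.exp (-(4 * Real.pi ^ 2 * s) * ‖η‖ ^ 2) := by
  have h1 : ‖Complex.exp (2 * Real.pi * Complex.I * (inner ℝ z η : ℝ))‖ = 1 := by
    rw [Complex.norm_exp]; simp
  rw [subordinationIntegrand, norm_mul, h1, mul_one, Complex.norm_real,
    Real.norm_of_nonneg (by positivity), heatIntegrand_mul_gaussian_exponent]
  ring

theorem measurable_subordinationIntegrand (t μ : ℝ) (z : E d) :
    Measurable fun q : ℝ × E d ↦ subordinationIntegrand t μ z q.2 q.1 := by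
  unfold subordinationIntegrand
  fun_prop

theorem heatIntegrand_shift {s : ℝ} (hs : 0 < s) (R μ : ℝ) :
    s ^ (-(3 / 2) : ℝ) * Real.exp (-(R ^ 2 / (4 * s)) - s * μ ^ 2) *
      (Real.pi / (4 * Real.pi ^ 2 * s)) ^ ((d : ℝ) / 2) =
    (4 * Real.pi) ^ (-(d : ℝ) / 2) * (s ^ (-(((d : ℝ) + 3) / 2)) *
      Real.exp (-(R ^ 2 / (4 * s)) - s * μ ^ 2)) := by
  rw [gaussian_prefactor hs, show -(((d : ℝ) + 3) / 2) = -(3 / 2) + -(d : ℝ) / 2 by ring,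
    Real.rpow_add hs]
  ring

theorem integrable_subordinationIntegrand {t μ : ℝ} (ht : 0 < t) (hμ : 0 < μ) (z : E d) :
    Integrable (Function.uncurry fun (s : ℝ) (η : E d) ↦ subordinationIntegrand t μ z η s)
      ((volume.restrict (Set.Ioi (0 : ℝ))).prod volume) := by
  have hp := Real.pi_pos
  refine (integrable_prod_iff
    (measurable_subordinationIntegrand t μ z).aestronglyMeasurable).2 ⟨?_, ?_⟩
  · filter_upwards [ae_restrict_mem measurableSet_Ioi] with s hs
    have hs : 0 < s := hs
    have hb : 0 < ((4 * Real.pi ^ 2 * s : ℝ) : ℂ).re := by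
      rw [Complex.ofReal_re]; positivity
    have h := (GaussianFourier.integrable_cexp_neg_mul_sq_norm_add hb 0 (0 : E d)).norm
    refine ((h.const_mul (s ^ (-(3 / 2) : ℝ) *
      Real.exp (-(t ^ 2 / (4 * s)) - s * μ ^ 2))).mono' ?_ ?_)
    · exact ((measurable_subordinationIntegrand t μ z).comp
        (measurable_const.prodMk measurable_id)).aestronglyMeasurable
    · refine Filter.Eventually.of_forall fun η ↦ ?_
      rw [norm_subordinationIntegrand t μ z η hs, Complex.norm_exp]
      refine le_of_eq ?_
      congr 2
      norm_cast
      simp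
  · have h := (integrableOn_heatIntegrand (((d : ℝ) + 3) / 2) ht hμ).const_mul
      ((4 * Real.pi) ^ (-(d : ℝ) / 2))
    refine h.congr ?_
    filter_upwards [ae_restrict_mem measurableSet_Ioi] with s hs
    have hs : 0 < s := hs
    simp_rw [norm_subordinationIntegrand t μ z _ hs]
    rw [integral_const_mul, GaussianFourier.integral_rexp_neg_mul_sq_norm (by positivity),
      finrank_euclideanSpace_fin, heatIntegrand_shift hs]

/-- The inverse Fourier transform of `e^{-t√(|ξ|² + μ²)}`, for real `μ`: Fubini's theorem applied to
the subordination formula, and the Fourier transform of the Gaussian. -/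
theorem integral_exp_neg_mul_sqrt_mul_exp_inner {t μ : ℝ} (ht : 0 < t) (hμ : 0 < μ) (z : E d) :
    ∫ η : E d, (Real.exp (-(t * √((2 * Real.pi * ‖η‖) ^ 2 + μ ^ 2))) : ℂ) *
      Complex.exp (2 * Real.pi * Complex.I * (inner ℝ z η : ℝ)) =
    ((t / (2 * √Real.pi) * (4 * Real.pi) ^ (-(d : ℝ) / 2) *
      heatIntegral (((d : ℝ) + 3) / 2) √(‖z‖ ^ 2 + t ^ 2) μ : ℝ) : ℂ) := by
  have hp := Real.pi_pos
  have h1 : ∀ η : E d, (Real.exp (-(t * √((2 * Real.pi * ‖η‖) ^ 2 + μ ^ 2))) : ℂ) *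
      Complex.exp (2 * Real.pi * Complex.I * (inner ℝ z η : ℝ)) =
      (t / (2 * √Real.pi) : ℝ) * ∫ s in Set.Ioi (0 : ℝ), subordinationIntegrand t μ z η s := by
    intro η
    unfold subordinationIntegrand
    rw [integral_mul_const, integral_complex_ofReal, ← mul_assoc, ← Complex.ofReal_mul,
      exp_neg_mul_eq_heatIntegral ht (by positivity), heatIntegral,
      Real.sq_sqrt (by positivity)]
  simp_rw [h1]
  rw [integral_const_mul,
    ← integral_integral_swap (integrable_subordinationIntegrand ht hμ z), mul_assoc,
    Complex.ofReal_mul]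
  congr 1
  rw [heatIntegral, ← integral_const_mul, ← integral_complex_ofReal]
  refine setIntegral_congr_fun measurableSet_Ioi fun s hs ↦ ?_
  have hs : 0 < s := hs
  have hb : 0 < ((4 * Real.pi ^ 2 * s : ℝ) : ℂ).re := by
    rw [Complex.ofReal_re]; positivity
  have h2 : ∀ η : E d, subordinationIntegrand t μ z η s =
      ((s ^ (-(3 / 2) : ℝ) * Real.exp (-(t ^ 2 / (4 * s)) - s * μ ^ 2) : ℝ) : ℂ) *
      Complex.exp (-((4 * Real.pi ^ 2 * s : ℝ) : ℂ) * (‖η‖ : ℂ) ^ 2 +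
        2 * Real.pi * Complex.I * (inner ℝ z η : ℝ)) := by
    intro η
    rw [subordinationIntegrand, heatIntegrand_mul_gaussian_exponent, ← mul_assoc, Complex.exp_add,
      Complex.ofReal_mul _ (Real.exp (-(4 * Real.pi ^ 2 * s) * ‖η‖ ^ 2)), Complex.ofReal_exp,
      ← mul_assoc]
    push_cast
    rfl
  simp_rw [h2]
  rw [integral_const_mul, GaussianFourier.integral_cexp_neg_mul_sq_norm_add hb,
    finrank_euclideanSpace_fin]
  have h3 : (Real.pi / ((4 * Real.pi ^ 2 * s : ℝ) : ℂ)) ^ ((d : ℂ) / 2) =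
      (((Real.pi / (4 * Real.pi ^ 2 * s)) ^ ((d : ℝ) / 2) : ℝ) : ℂ) := by
    rw [Complex.ofReal_cpow (by positivity)]
    push_cast
    rfl
  have h4 : Complex.exp ((2 * Real.pi * Complex.I) ^ 2 * (‖z‖ : ℂ) ^ 2 /
      (4 * ((4 * Real.pi ^ 2 * s : ℝ) : ℂ))) = (Real.exp (-(‖z‖ ^ 2 / (4 * s))) : ℂ) := by
    rw [Complex.ofReal_exp]
    push_cast
    congr 1
    have h5 : (Real.pi : ℂ) ≠ 0 := by exact_mod_cast hp.ne'
    have h6 : (s : ℂ) ≠ 0 := by exact_mod_cast hs.ne'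
    field_simp
    rw [Complex.I_sq]
    ring
  rw [h3, h4, ← Complex.ofReal_mul, ← Complex.ofReal_mul]
  congr 1
  rw [← heatIntegrand_shift hs, Real.sq_sqrt (by positivity)]
  have h7 : Real.exp (-((‖z‖ ^ 2 + t ^ 2) / (4 * s)) - s * μ ^ 2) =
      Real.exp (-(t ^ 2 / (4 * s)) - s * μ ^ 2) * Real.exp (-(‖z‖ ^ 2 / (4 * s))) := by
    rw [← Real.exp_add]; ring_nf
  rw [h7]
  ring

/-! ### The fundamental solution as a holomorphic function of the wavenumber -/

theorem one_add_div_mem_slitPlane {w : ℂ} (hw : w ∈ Complex.slitPlane) {t : ℝ} (ht : 0 ≤ t) :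
    1 + t / (2 * w) ∈ Complex.slitPlane := by
  have hw0 : w ≠ 0 := Complex.slitPlane_ne_zero hw
  by_contra h
  rw [Complex.mem_slitPlane_iff, not_or, not_lt, not_not] at h
  set v : ℂ := 1 + t / (2 * w) with hv
  have hvre : v = (v.re : ℂ) := by
    apply Complex.ext <;> simp [h.2]
  have h1 : (v - 1) * (2 * w) = t := by
    rw [hv]; field_simp; ring
  have h2 : w = ((t / (2 * (v.re - 1)) : ℝ) : ℂ) := by
    rw [hvre] at h1
    have h3 : ((v.re : ℂ) - 1) ≠ 0 := by
      have : v.re - 1 ≠ 0 := by linarith [h.1]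
      exact_mod_cast this
    push_cast
    rw [eq_div_iff (by simpa using h3), ← h1]
    ring
  rw [h2, Complex.ofReal_mem_slitPlane] at hw
  exact absurd hw (not_lt.2 (div_nonpos_of_nonneg_of_nonpos ht (by linarith [h.1])))

theorem differentiableOn_hankelIntegral :
    DifferentiableOn ℂ hankelIntegral Complex.slitPlane := by
  refine differentiableOn_integral_of_locally_dominated Complex.isOpen_slitPlane
    (F := fun w (t : ℝ) ↦ ((Real.exp (-t) * t ^ (-(1 / 2) : ℝ) : ℝ) : ℂ) *
      (1 + t / (2 * w)) ^ (-(1 / 2) : ℂ)) (fun w _ ↦ ?_) ?_ fun z hz ↦ ?_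
  · exact (by fun_prop : Measurable _).aestronglyMeasurable
  · filter_upwards [ae_restrict_mem measurableSet_Ioi] with t ht w hw
    have ht : 0 < t := ht
    have hw0 : w ≠ 0 := Complex.slitPlane_ne_zero hw
    refine DifferentiableAt.differentiableWithinAt ?_
    have h1 : DifferentiableAt ℂ (fun w : ℂ ↦ 1 + (t : ℂ) / (2 * w)) w :=
      ((differentiableAt_const _).div (by fun_prop) (by simpa using hw0)).const_add _
    exact (h1.cpow (differentiableAt_const _) (one_add_div_mem_slitPlane hw ht.le)).const_mul _
  · obtain ⟨r, hr, hball⟩ := Metric.isOpen_iff.1 Complex.isOpen_slitPlane z hz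
    refine ⟨r / 2, by positivity, fun t ↦ (Real.exp (-t) * t ^ (-(1 / 2) : ℝ)) *
      ((‖z‖ + r) / (r / 2)) ^ (1 / 2 : ℝ), ?_, ?_⟩
    · have := Real.GammaIntegral_convergent (s := 1 / 2) (by norm_num)
      norm_num at this
      simpa [IntegrableOn] using this.mul_const _
    · filter_upwards [ae_restrict_mem measurableSet_Ioi] with t ht w hw
      have ht : 0 < t := ht
      have hw0 : w ≠ 0 := Complex.slitPlane_ne_zero hw.2
      have hwz : ‖w - z‖ < r / 2 := by simpa [dist_eq_norm] using hw.1
      have hne := Complex.slitPlane_ne_zero (one_add_div_mem_slitPlane hw.2 ht.le)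
      have hdist : r ≤ ‖z + t / 2‖ := by
        by_contra hlt
        have hmem : -((t / 2 : ℝ) : ℂ) ∈ Complex.slitPlane := by
          refine hball ?_
          rw [Metric.mem_ball, dist_comm, dist_eq_norm, sub_neg_eq_add]
          push_cast
          exact not_le.1 hlt
        rw [← Complex.ofReal_neg, Complex.ofReal_mem_slitPlane] at hmem
        linarith
      have hdist' : r / 2 ≤ ‖w + t / 2‖ := by
        have := norm_sub_norm_le (z + t / 2) (z - w)
        rw [show z + (t : ℂ) / 2 - (z - w) = w + t / 2 by ring, norm_sub_rev z w] at this
        linarith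
      have hwn : ‖w‖ ≤ ‖z‖ + r := by
        have := norm_add_le z (w - z)
        rw [add_sub_cancel] at this
        linarith
      have hwpos : 0 < ‖w‖ := norm_pos_iff.2 hw0
      rw [norm_mul, Complex.norm_real, Real.norm_of_nonneg (by positivity)]
      refine mul_le_mul_of_nonneg_left ?_ (by positivity)
      rw [Complex.norm_cpow_of_ne_zero hne]
      have him : (-(1 / 2) : ℂ).im = 0 := by norm_num
      have hre : (-(1 / 2) : ℂ).re = -(1 / 2) := by norm_num
      rw [him, hre, mul_zero, Real.exp_zero, div_one, Real.rpow_neg (norm_nonneg _),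
        ← Real.inv_rpow (norm_nonneg _)]
      refine Real.rpow_le_rpow (by positivity) ?_ (by norm_num)
      rw [show 1 + (t : ℂ) / (2 * w) = (w + t / 2) / w by field_simp, norm_div, inv_div]
      gcongr

/-- The radial profile of the fundamental solution of `Δ - μ²` in the plane, as a function of
`w = μR`: this is `K₀(w) / (2π)`, by Hankel's integral. -/
def planarProfile (w : ℂ) : ℂ :=
  1 / (2 * Real.pi) * (2 * w) ^ (-(1 / 2) : ℂ) * Complex.exp (-w) * hankelIntegral w

theorem differentiableOn_planarProfile :
    DifferentiableOn ℂ planarProfile Complex.slitPlane := by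
  intro w hw
  refine DifferentiableWithinAt.mul (DifferentiableAt.differentiableWithinAt ?_)
    (differentiableOn_hankelIntegral w hw)
  refine DifferentiableAt.mul (DifferentiableAt.const_mul (DifferentiableAt.cpow
    (by fun_prop) (by fun_prop) ?_) _) (by fun_prop)
  have := Complex.mem_slitPlane_iff.1 hw
  rw [Complex.mem_slitPlane_iff]
  simpa using this

/-- The value at distance `R` from the pole of the fundamental solution of `Δ - μ²` in `ℝ^{d+1}`,
`d = 1, 2`. The Helmholtz equation with outgoing radiation condition is the case `μ = -ik`. -/
def greenProfile (d : ℕ) (μ : ℂ) (R : ℝ) : ℂ :=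
  if d = 1 then planarProfile (μ * R) else Complex.exp (-(μ * R)) / (4 * Real.pi * R)

/-- The derivative of `greenProfile` with respect to the radius. -/
def greenProfileDeriv (d : ℕ) (μ : ℂ) (R : ℝ) : ℂ :=
  if d = 1 then μ * deriv planarProfile (μ * R)
  else -((μ * R + 1) * Complex.exp (-(μ * R))) / (4 * Real.pi * R ^ 2)

theorem mul_ofReal_mem_slitPlane {μ : ℂ} (hμ : μ ∈ Complex.slitPlane) {R : ℝ} (hR : 0 < R) :
    μ * R ∈ Complex.slitPlane := by
  rw [Complex.mem_slitPlane_iff] at hμ ⊢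
  rw [Complex.re_mul_ofReal, Complex.im_mul_ofReal]
  rcases hμ with h | h
  · exact Or.inl (by positivity)
  · exact Or.inr (mul_ne_zero h hR.ne')

theorem hasDerivAt_greenProfile (d : ℕ) {μ : ℂ} (hμ : μ ∈ Complex.slitPlane) {R : ℝ}
    (hR : 0 < R) : HasDerivAt (greenProfile d μ) (greenProfileDeriv d μ R) R := by
  unfold greenProfileDeriv greenProfile
  have hlin : HasDerivAt (fun r : ℝ ↦ μ * (r : ℂ)) μ R := by
    simpa using (Complex.ofRealCLM.hasDerivAt (x := R)).const_mul μ
  split_ifs with hd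
  · have h := (differentiableOn_planarProfile.differentiableAt
      (Complex.isOpen_slitPlane.mem_nhds (mul_ofReal_mem_slitPlane hμ hR))).hasDerivAt
    exact (h.comp R hlin).congr_deriv (mul_comm _ _)
  · have hR' : (R : ℂ) ≠ 0 := by exact_mod_cast hR.ne'
    have hp : (Real.pi : ℂ) ≠ 0 := by exact_mod_cast Real.pi_ne_zero
    have hden : HasDerivAt (fun r : ℝ ↦ (4 * Real.pi : ℂ) * (r : ℂ)) (4 * Real.pi) R := by
      simpa using (Complex.ofRealCLM.hasDerivAt (x := R)).const_mul (4 * Real.pi : ℂ)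
    have hneg : HasDerivAt (fun r : ℝ ↦ -(μ * (r : ℂ))) (-μ) R := hlin.neg
    refine (hneg.cexp.div hden (by simp [hR', hp])).congr_deriv ?_
    field_simp
    ring

theorem differentiableAt_greenProfileDeriv (d : ℕ) {μ : ℂ} (hμ : μ ∈ Complex.slitPlane) {R : ℝ}
    (hR : 0 < R) : DifferentiableAt ℂ (fun m ↦ greenProfileDeriv d m R) μ := by
  unfold greenProfileDeriv
  split_ifs with hd
  · have h := (differentiableOn_planarProfile.deriv Complex.isOpen_slitPlane).differentiableAt
      (Complex.isOpen_slitPlane.mem_nhds (mul_ofReal_mem_slitPlane hμ hR))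
    have h1 : DifferentiableAt ℂ (fun m : ℂ ↦ deriv planarProfile (m * R)) μ :=
      DifferentiableAt.comp (g := deriv planarProfile) (f := fun m : ℂ ↦ m * R) μ h (by fun_prop)
    exact differentiableAt_id.mul h1
  · fun_prop

/-- For real `μ`, the fundamental solution is the integral over time of the heat kernel. -/
theorem greenProfile_ofReal {d : ℕ} (hd : d = 1 ∨ d = 2) {R μ : ℝ} (hR : 0 < R) (hμ : 0 < μ) :
    greenProfile d μ R =
      (((4 * Real.pi) ^ (-((d : ℝ) + 1) / 2) * heatIntegral (((d : ℝ) + 1) / 2) R μ : ℝ) : ℂ) := by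
  have hp := Real.pi_pos
  rcases hd with rfl | rfl
  · rw [show (((1 : ℕ) : ℝ) + 1) / 2 = 1 by norm_num,
      show -(((1 : ℕ) : ℝ) + 1) / 2 = -1 by norm_num,
      Complex.ofReal_mul, heatIntegral_one hR hμ, greenProfile, if_pos rfl, planarProfile,
      Real.rpow_neg_one]
    push_cast
    have hp : (Real.pi : ℂ) ≠ 0 := by exact_mod_cast Real.pi_ne_zero
    field_simp
    ring
  · rw [show (((2 : ℕ) : ℝ) + 1) / 2 = 3 / 2 by norm_num, heatIntegral_three_halves hR hμ,
      greenProfile, if_neg (by norm_num), show -(((2 : ℕ) : ℝ) + 1) / 2 = -1 + -(1 / 2) by norm_num,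
      Real.rpow_add (by positivity), Real.rpow_neg_one, Real.rpow_neg (by positivity),
      ← Real.sqrt_eq_rpow, Real.sqrt_mul (by norm_num), show (4 : ℝ) = 2 ^ 2 by norm_num,
      Real.sqrt_sq (by norm_num)]
    have h1 : ((2 : ℝ) ^ 2 * Real.pi)⁻¹ * (2 * √Real.pi)⁻¹ * (2 * √Real.pi / R *
        Real.exp (-(μ * R))) = Real.exp (-(μ * R)) / (4 * Real.pi * R) := by
      have : 0 < √Real.pi := Real.sqrt_pos.2 hp
      field_simp
      norm_num
    rw [h1]
    push_cast
    rfl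

/-- Differentiation in `R` raises the exponent `p` of the heat integral by one. -/
theorem greenProfileDeriv_ofReal {d : ℕ} (hd : d = 1 ∨ d = 2) {R μ : ℝ} (hR : 0 < R)
    (hμ : 0 < μ) : greenProfileDeriv d μ R =
      (((4 * Real.pi) ^ (-((d : ℝ) + 1) / 2) *
        (-(R / 2) * heatIntegral (((d : ℝ) + 3) / 2) R μ) : ℝ) : ℂ) := by
  have h1 := hasDerivAt_greenProfile d (μ := (μ : ℂ)) (Complex.ofReal_mem_slitPlane.2 hμ) hR
  have h2 := ((hasDerivAt_heatIntegral (((d : ℝ) + 1) / 2) hR hμ).const_mul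
    ((4 * Real.pi) ^ (-((d : ℝ) + 1) / 2))).ofReal_comp
  rw [show ((d : ℝ) + 1) / 2 + 1 = ((d : ℝ) + 3) / 2 by ring] at h2
  refine h1.unique (h2.congr_of_eventuallyEq ?_)
  filter_upwards [lt_mem_nhds hR] with r hr
  exact greenProfile_ofReal hd hr hμ

/-- The Poisson kernel of the half-space for `Δ - μ²`, for real `μ`: it has the Fourier transform
`e^{-t√(|ξ|² + μ²)}`, and it is minus twice the normal derivative of the fundamental solution. -/
theorem integral_exp_neg_mul_sqrt_eq_greenProfileDeriv (hd : d = 1 ∨ d = 2) {t μ : ℝ} (ht : 0 < t)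
    (hμ : 0 < μ) (z : E d) :
    ∫ η : E d, (Real.exp (-(t * √((2 * Real.pi * ‖η‖) ^ 2 + μ ^ 2))) : ℂ) *
      Complex.exp (2 * Real.pi * Complex.I * (inner ℝ z η : ℝ)) =
    -(2 * t / √(‖z‖ ^ 2 + t ^ 2) : ℝ) * greenProfileDeriv d μ √(‖z‖ ^ 2 + t ^ 2) := by
  have hp := Real.pi_pos
  have hR : 0 < √(‖z‖ ^ 2 + t ^ 2) := by positivity
  rw [integral_exp_neg_mul_sqrt_mul_exp_inner ht hμ, greenProfileDeriv_ofReal hd hR hμ,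
    ← Complex.ofReal_neg, ← Complex.ofReal_mul]
  congr 1
  rw [show -((d : ℝ) + 1) / 2 = -(1 / 2) + -(d : ℝ) / 2 by ring, Real.rpow_add (by positivity),
    Real.rpow_neg (by positivity), ← Real.sqrt_eq_rpow, Real.sqrt_mul (by norm_num),
    show √(4 : ℝ) = 2 by rw [show (4 : ℝ) = 2 ^ 2 by norm_num, Real.sqrt_sq (by norm_num)]]
  have : 0 < √Real.pi := Real.sqrt_pos.2 hp
  field_simp

/-- The square root `√(r² + μ²)` with non-negative real part. -/
def decayRate (μ : ℂ) (r : ℝ) : ℂ := ((r : ℂ) ^ 2 + μ ^ 2) ^ (2 : ℂ)⁻¹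

theorem decayRate_sq (μ : ℂ) (r : ℝ) : decayRate μ r ^ 2 = (r : ℂ) ^ 2 + μ ^ 2 :=
  Complex.cpow_ofNat_inv_pow _ 2

theorem decayRate_re_nonneg (μ : ℂ) (r : ℝ) : 0 ≤ (decayRate μ r).re := by
  unfold decayRate
  set w := (r : ℂ) ^ 2 + μ ^ 2
  rcases eq_or_ne w 0 with hw | hw
  · rw [hw, Complex.zero_cpow (by norm_num)]; simp
  · rw [Complex.cpow_def_of_ne_zero hw, Complex.exp_re]
    refine mul_nonneg (Real.exp_pos _).le (Real.cos_nonneg_of_neg_pi_div_two_le_of_le ?_ ?_)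
    all_goals
      have h1 := Complex.neg_pi_lt_arg w
      have h2 := Complex.arg_le_pi w
      have h3 : (Complex.log w * (2 : ℂ)⁻¹).im = w.arg / 2 := by
        rw [show (2 : ℂ)⁻¹ = ((2⁻¹ : ℝ) : ℂ) by push_cast; rfl, Complex.im_mul_ofReal,
          Complex.log_im]
        ring
      rw [h3]
      linarith

theorem sub_abs_im_le_decayRate_re (μ : ℂ) (r : ℝ) :
    r - |μ.im| ≤ (decayRate μ r).re := by
  rcases le_or_gt r |μ.im| with h | h
  · linarith [decayRate_re_nonneg μ r]
  · refine abs_le_of_sq_le_sq' ?_ (decayRate_re_nonneg μ r) |>.2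
    have h1 := congrArg Complex.re (decayRate_sq μ r)
    rw [pow_two, Complex.mul_re, Complex.add_re, pow_two, pow_two, Complex.mul_re, Complex.mul_re,
      Complex.ofReal_re, Complex.ofReal_im] at h1
    nlinarith [sq_abs μ.im, abs_nonneg μ.im, sq_nonneg (decayRate μ r).im, sq_nonneg μ.re]

theorem norm_exp_neg_mul_decayRate_le (μ : ℂ) (r : ℝ) {t : ℝ} (ht : 0 ≤ t) :
    ‖Complex.exp (-(t * decayRate μ r))‖ ≤ Real.exp (t * |μ.im|) * Real.exp (-(t * r)) := by
  rw [Complex.norm_exp, Complex.neg_re, Complex.re_ofReal_mul, ← Real.exp_add]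
  refine Real.exp_le_exp.2 ?_
  nlinarith [mul_le_mul_of_nonneg_left (sub_abs_im_le_decayRate_re μ r) ht]

theorem integrable_exp_neg_mul_norm {c : ℝ} (hc : 0 < c) :
    Integrable fun η : E d ↦ Real.exp (-(c * ‖η‖)) := by
  have h := (integrable_one_add_norm (μ := (volume : Measure (E d))) (r := (d + 1 : ℕ))
    (by rw [finrank_euclideanSpace_fin]; push_cast; linarith)).const_mul
    (Real.exp c * ((d + 1).factorial / c ^ (d + 1)))
  refine h.mono' (by fun_prop) (Filter.Eventually.of_forall fun η ↦ ?_)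
  rw [Real.norm_of_nonneg (Real.exp_pos _).le, Real.rpow_neg (by positivity), Real.rpow_natCast]
  have h1 := Real.pow_div_factorial_le_exp (c * (1 + ‖η‖)) (by positivity) (d + 1)
  have h2 : Real.exp (-(c * ‖η‖)) = Real.exp c * (Real.exp (c * (1 + ‖η‖)))⁻¹ := by
    rw [← Real.exp_neg, ← Real.exp_add]; ring_nf
  rw [h2, mul_assoc]
  refine mul_le_mul_of_nonneg_left ?_ (Real.exp_pos _).le
  rw [inv_le_comm₀ (Real.exp_pos _) (by positivity)]
  refine le_trans (le_of_eq ?_) h1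
  rw [mul_pow]
  field_simp

theorem norm_exp_inner (z η : E d) :
    ‖Complex.exp (2 * Real.pi * Complex.I * (inner ℝ z η : ℝ))‖ = 1 := by
  rw [Complex.norm_exp]; simp

theorem measurable_exp_decayRate_mul (t : ℝ) (μ : ℂ) (z : E d) :
    Measurable fun η : E d ↦ Complex.exp (-(t * decayRate μ (2 * Real.pi * ‖η‖))) *
      Complex.exp (2 * Real.pi * Complex.I * (inner ℝ z η : ℝ)) := by
  unfold decayRate
  fun_prop

theorem norm_exp_decayRate_mul_le {t m : ℝ} (ht : 0 ≤ t) {μ : ℂ} (hμ : |μ.im| ≤ m) (z η : E d) :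
    ‖Complex.exp (-(t * decayRate μ (2 * Real.pi * ‖η‖))) *
      Complex.exp (2 * Real.pi * Complex.I * (inner ℝ z η : ℝ))‖ ≤
      Real.exp (t * m) * Real.exp (-(t * (2 * Real.pi) * ‖η‖)) := by
  have hp := Real.pi_pos
  rw [norm_mul, norm_exp_inner, mul_one, mul_assoc t]
  refine (norm_exp_neg_mul_decayRate_le μ _ ht).trans ?_
  gcongr

theorem sq_add_sq_mem_slitPlane {μ : ℂ} (hμ : 0 < μ.re) (r : ℝ) :
    (r : ℂ) ^ 2 + μ ^ 2 ∈ Complex.slitPlane := by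
  have hre : ((r : ℂ) ^ 2 + μ ^ 2).re = r ^ 2 + (μ.re ^ 2 - μ.im ^ 2) := by
    simp [pow_two]
  have him : ((r : ℂ) ^ 2 + μ ^ 2).im = 2 * (μ.re * μ.im) := by
    simp [pow_two]; ring
  rw [Complex.mem_slitPlane_iff, hre, him]
  rcases eq_or_ne μ.im 0 with h | h
  · left; rw [h, zero_pow two_ne_zero, sub_zero]; positivity
  · right; simp [h, hμ.ne']

/-- The Poisson kernel of the half-space for `Δ - μ²`, for `Re μ > 0`: both sides are holomorphic
in `μ`, so this follows from the case of real `μ`. -/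
theorem integral_exp_neg_mul_decayRate (hd : d = 1 ∨ d = 2) {t : ℝ} (ht : 0 < t) (z : E d)
    {μ : ℂ} (hμ : 0 < μ.re) :
    ∫ η : E d, Complex.exp (-(t * decayRate μ (2 * Real.pi * ‖η‖))) *
      Complex.exp (2 * Real.pi * Complex.I * (inner ℝ z η : ℝ)) =
    -(2 * t / √(‖z‖ ^ 2 + t ^ 2) : ℝ) * greenProfileDeriv d μ √(‖z‖ ^ 2 + t ^ 2) := by
  have hp := Real.pi_pos
  have hR : 0 < √(‖z‖ ^ 2 + t ^ 2) := by positivity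
  set Ω : Set ℂ := {m | 0 < m.re} with hΩ
  have hΩo : IsOpen Ω := isOpen_lt continuous_const Complex.continuous_re
  have hconv : Convex ℝ Ω := convex_halfSpace_re_gt 0
  have hslit : ∀ m ∈ Ω, m ∈ Complex.slitPlane := fun m hm ↦
    Complex.mem_slitPlane_iff.2 (Or.inl hm)
  have hL : DifferentiableOn ℂ (fun m : ℂ ↦ ∫ η : E d,
      Complex.exp (-(t * decayRate m (2 * Real.pi * ‖η‖))) *
        Complex.exp (2 * Real.pi * Complex.I * (inner ℝ z η : ℝ))) Ω := by
    refine differentiableOn_integral_of_locally_dominated hΩo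
      (fun m _ ↦ (measurable_exp_decayRate_mul t m z).aestronglyMeasurable)
      (Filter.Eventually.of_forall fun η m hm ↦ ?_) fun m hm ↦ ?_
    · have h1 : DifferentiableAt ℂ (fun m ↦ decayRate m (2 * Real.pi * ‖η‖)) m := by
        unfold decayRate
        have h2 : DifferentiableAt ℂ
            (fun m : ℂ ↦ (((2 * Real.pi * ‖η‖ : ℝ) : ℂ)) ^ 2 + m ^ 2) m := by
          fun_prop
        exact h2.cpow (differentiableAt_const _) (sq_add_sq_mem_slitPlane hm _)
      exact (((h1.const_mul (t : ℂ)).neg.cexp).mul_const _).differentiableWithinAt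
    · refine ⟨1, one_pos, fun η ↦ Real.exp (t * (|m.im| + 1)) *
        Real.exp (-(t * (2 * Real.pi) * ‖η‖)),
        (integrable_exp_neg_mul_norm (by positivity)).const_mul _,
        Filter.Eventually.of_forall fun η w hw ↦ ?_⟩
      refine norm_exp_decayRate_mul_le ht.le ?_ z η
      have h1 : ‖w - m‖ < 1 := by simpa [dist_eq_norm] using hw.1
      have h2 := Complex.abs_im_le_norm (w - m)
      rw [Complex.sub_im] at h2
      have h3 := abs_sub_abs_le_abs_sub w.im m.im
      linarith
  have hRd : DifferentiableOn ℂ (fun m : ℂ ↦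
      (-(2 * t / √(‖z‖ ^ 2 + t ^ 2) : ℝ) * greenProfileDeriv d m √(‖z‖ ^ 2 + t ^ 2) : ℂ)) Ω :=
    fun m hm ↦ ((differentiableAt_greenProfileDeriv d (hslit m hm) hR).const_mul
      _).differentiableWithinAt
  have heq := (hL.analyticOnNhd hΩo).eqOn_of_preconnected_of_frequently_eq
    (hRd.analyticOnNhd hΩo) hconv.isPreconnected (z₀ := 1) (by simp [hΩ]) ?_
  · exact heq hμ
  · -- the real points accumulate at `1`
    have hseq : Filter.Tendsto (fun n : ℕ ↦ ((1 + 1 / ((n : ℝ) + 1) : ℝ) : ℂ)) Filter.atTop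
        (nhdsWithin 1 {1}ᶜ) := by
      refine tendsto_nhdsWithin_iff.2 ⟨?_, Filter.Eventually.of_forall fun n ↦ ?_⟩
      · have h := (tendsto_one_div_add_atTop_nhds_zero_nat (𝕜 := ℝ)).const_add 1
        rw [add_zero] at h
        exact_mod_cast (Complex.continuous_ofReal.tendsto 1).comp h
      · have h : (1 : ℝ) / ((n : ℝ) + 1) ≠ 0 := by positivity
        simp only [Set.mem_compl_iff, Set.mem_singleton_iff]
        norm_cast
        simpa using h
    refine hseq.frequently (Filter.Frequently.of_forall fun n ↦ ?_)
    set m : ℝ := 1 + 1 / ((n : ℝ) + 1) with hm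
    have hm0 : 0 < m := by positivity
    rw [← integral_exp_neg_mul_sqrt_eq_greenProfileDeriv hd ht hm0 z]
    refine integral_congr_ae (Filter.Eventually.of_forall fun η ↦ ?_)
    simp only
    congr 1
    rw [Complex.ofReal_exp]
    congr 1
    have h1 : decayRate m (2 * Real.pi * ‖η‖) = (√((2 * Real.pi * ‖η‖) ^ 2 + m ^ 2) : ℝ) := by
      rw [decayRate, Real.sqrt_eq_rpow, Complex.ofReal_cpow (by positivity)]
      push_cast
      norm_num
    rw [h1]
    push_cast
    rfl

/-- The vertical wavenumber `Z = √(k² - |ξ|²)`, `ξ = 2πη`, of a plane wave with horizontal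
frequency `ξ`: real for propagating waves (`|ξ| ≤ k`), in `i[0, ∞)` for evanescent waves. One of the
two real square roots is zero. -/
def verticalWavenumber (k : ℝ) (η : E d) : ℂ :=
  √(k ^ 2 - (2 * Real.pi * ‖η‖) ^ 2) + Complex.I * √((2 * Real.pi * ‖η‖) ^ 2 - k ^ 2)

theorem ofReal_cpow_half (a : ℝ) : (a : ℂ) ^ (2 : ℂ)⁻¹ = √a + Complex.I * √(-a) := by
  rcases le_total 0 a with h | h
  · rw [Real.sqrt_eq_zero_of_nonpos (neg_nonpos.2 h), Real.sqrt_eq_rpow,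
      Complex.ofReal_cpow h]
    push_cast
    norm_num
  · rw [Complex.ofReal_cpow_of_nonpos h, Real.sqrt_eq_zero_of_nonpos h, Real.sqrt_eq_rpow,
      Complex.ofReal_cpow (neg_nonneg.2 h), show (Real.pi : ℂ) * Complex.I * (2 : ℂ)⁻¹ =
        Real.pi / 2 * Complex.I by ring, Complex.exp_pi_div_two_mul_I]
    push_cast
    norm_num
    ring

/-- Limiting absorption: `√(r² + μ²)` tends to `-iZ` as `μ → -ik` from the right half-plane. -/
theorem tendsto_decayRate {k r : ℝ} (hk : 0 < k) (hr : r ^ 2 ≠ k ^ 2) :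
    Filter.Tendsto (fun ε : ℝ ↦ decayRate (ε - Complex.I * k) r) (nhdsWithin 0 (Set.Ioi 0))
      (nhds (-Complex.I * (√(k ^ 2 - r ^ 2) + Complex.I * √(r ^ 2 - k ^ 2)))) := by
  -- pass to complex conjugates, to approach the cut of the square root from above
  have hlim : Filter.Tendsto (fun ε : ℝ ↦ (r : ℂ) ^ 2 + (ε + Complex.I * k) ^ 2)
      (nhdsWithin 0 (Set.Ioi 0)) (nhdsWithin ((r ^ 2 - k ^ 2 : ℝ) : ℂ) {w | 0 ≤ w.im}) := by
    refine tendsto_nhdsWithin_iff.2 ⟨?_, ?_⟩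
    · have h1 : Continuous fun ε : ℝ ↦ (r : ℂ) ^ 2 + (ε + Complex.I * k) ^ 2 := by fun_prop
      have h2 := h1.tendsto 0
      have h3 : (r : ℂ) ^ 2 + (((0 : ℝ) : ℂ) + Complex.I * k) ^ 2 = ((r ^ 2 - k ^ 2 : ℝ) : ℂ) := by
        push_cast
        rw [zero_add, mul_pow, Complex.I_sq]
        ring
      rw [h3] at h2
      exact h2.mono_left nhdsWithin_le_nhds
    · filter_upwards [self_mem_nhdsWithin] with ε hε
      have hε : 0 < ε := hε
      have : ((r : ℂ) ^ 2 + (ε + Complex.I * k) ^ 2).im = 2 * (ε * k) := by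
        simp [pow_two]; ring
      change 0 ≤ ((r : ℂ) ^ 2 + (ε + Complex.I * k) ^ 2).im
      rw [this]
      positivity
  have hcont : ContinuousWithinAt (fun w : ℂ ↦ w ^ (2 : ℂ)⁻¹) {w | 0 ≤ w.im}
      ((r ^ 2 - k ^ 2 : ℝ) : ℂ) := by
    rcases lt_or_gt_of_ne (sub_ne_zero.2 hr) with h | h
    · have hne : ((r ^ 2 - k ^ 2 : ℝ) : ℂ) ≠ 0 := by exact_mod_cast h.ne
      have h1 := ((Complex.continuousWithinAt_log_of_re_neg_of_im_zero
        (z := ((r ^ 2 - k ^ 2 : ℝ) : ℂ)) (by rwa [Complex.ofReal_re]) (Complex.ofReal_im _)).mul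
        (continuousWithinAt_const (b := (2 : ℂ)⁻¹))).cexp
      refine h1.congr_of_eventuallyEq ?_ ?_
      · filter_upwards [nhdsWithin_le_nhds (isOpen_ne.mem_nhds hne)] with w hw
        exact Complex.cpow_def_of_ne_zero hw _
      · exact Complex.cpow_def_of_ne_zero hne _
    · exact (continuousAt_cpow_const (Complex.ofReal_mem_slitPlane.2 h)).continuousWithinAt
  have h1 := (hcont.tendsto.comp hlim)
  have h2 := (Complex.continuous_conj.tendsto _).comp h1
  have hval : conj (((r ^ 2 - k ^ 2 : ℝ) : ℂ) ^ (2 : ℂ)⁻¹) =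
      -Complex.I * (√(k ^ 2 - r ^ 2) + Complex.I * √(r ^ 2 - k ^ 2)) := by
    rw [ofReal_cpow_half, map_add, map_mul, Complex.conj_ofReal, Complex.conj_ofReal,
      Complex.conj_I, neg_sub]
    linear_combination (√(r ^ 2 - k ^ 2) : ℂ) * Complex.I_mul_I
  rw [hval] at h2
  refine h2.congr' ?_
  filter_upwards [self_mem_nhdsWithin] with ε hε
  have hε : 0 < ε := hε
  have hre : 0 < ((ε : ℂ) - Complex.I * k).re := by simpa using hε
  have harg := (Complex.mem_slitPlane_iff_arg.1 (sq_add_sq_mem_slitPlane hre r)).1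
  have h3 := Complex.cpow_conj _ (2 : ℂ)⁻¹ harg
  have h4 : conj ((r : ℂ) ^ 2 + ((ε : ℂ) - Complex.I * k) ^ 2) =
      (r : ℂ) ^ 2 + (ε + Complex.I * k) ^ 2 := by
    simp
  have h5 : conj (2 : ℂ)⁻¹ = (2 : ℂ)⁻¹ := by rw [map_inv₀, Complex.conj_ofNat]
  rw [h4, h5] at h3
  exact h3.symm

/-- The set of frequencies with `|ξ| = k`, where the vertical wavenumber vanishes, is null. -/
theorem ae_sq_two_pi_norm_ne [NeZero d] {k : ℝ} (hk : 0 < k) :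
    ∀ᵐ η : E d, (2 * Real.pi * ‖η‖) ^ 2 ≠ k ^ 2 := by
  have hp := Real.pi_pos
  have : Nontrivial (E d) := by
    have : Nonempty (Fin d) := ⟨0⟩
    infer_instance
  have h : volume (Metric.sphere (0 : E d) (k / (2 * Real.pi))) = 0 :=
    Measure.addHaar_sphere_of_ne_zero _ _ (by positivity)
  refine measure_mono_null (fun η hη ↦ ?_) h
  rw [Set.mem_compl_iff, Set.mem_ofPred_eq, not_not] at hη
  rw [mem_sphere_zero_iff_norm, eq_div_iff (by positivity)]
  have := (sq_eq_sq₀ (by positivity) hk.le).1 hη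
  linarith

/-- The Poisson kernel of the half-space for the Helmholtz equation, as the limit `ε → 0⁺` of the
kernels for `μ = ε - ik`. -/
theorem integral_exp_verticalWavenumber (hd : d = 1 ∨ d = 2) {k t : ℝ} (hk : 0 < k) (ht : 0 < t)
    (z : E d) :
    ∫ η : E d, Complex.exp (Complex.I * t * verticalWavenumber k η) *
      Complex.exp (2 * Real.pi * Complex.I * (inner ℝ z η : ℝ)) =
    -(2 * t / √(‖z‖ ^ 2 + t ^ 2) : ℝ) *
      greenProfileDeriv d (-Complex.I * k) √(‖z‖ ^ 2 + t ^ 2) := by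
  have hp := Real.pi_pos
  have hR : 0 < √(‖z‖ ^ 2 + t ^ 2) := by positivity
  have : NeZero d := ⟨by rcases hd with rfl | rfl <;> norm_num⟩
  have hleft : Filter.Tendsto (fun ε : ℝ ↦ ∫ η : E d,
      Complex.exp (-(t * decayRate (ε - Complex.I * k) (2 * Real.pi * ‖η‖))) *
        Complex.exp (2 * Real.pi * Complex.I * (inner ℝ z η : ℝ))) (nhdsWithin 0 (Set.Ioi 0))
      (nhds (∫ η : E d, Complex.exp (Complex.I * t * verticalWavenumber k η) *
        Complex.exp (2 * Real.pi * Complex.I * (inner ℝ z η : ℝ)))) := by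
    refine tendsto_integral_filter_of_dominated_convergence
      (fun η ↦ Real.exp (t * k) * Real.exp (-(t * (2 * Real.pi) * ‖η‖)))
      (Filter.Eventually.of_forall fun ε ↦
        (measurable_exp_decayRate_mul t _ z).aestronglyMeasurable)
      (Filter.Eventually.of_forall fun ε ↦ Filter.Eventually.of_forall fun η ↦ ?_)
      ((integrable_exp_neg_mul_norm (by positivity)).const_mul _) ?_
    · refine norm_exp_decayRate_mul_le ht.le ?_ z η
      simp [abs_of_pos hk]
    · filter_upwards [ae_sq_two_pi_norm_ne hk] with η hη
      have h1 := tendsto_decayRate hk hη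
      have h2 : Complex.I * t * verticalWavenumber k η = -(t * (-Complex.I *
          (√(k ^ 2 - (2 * Real.pi * ‖η‖) ^ 2) +
            Complex.I * √((2 * Real.pi * ‖η‖) ^ 2 - k ^ 2)))) := by
        rw [verticalWavenumber]; ring
      rw [h2]
      exact (((h1.const_mul (t : ℂ)).neg).cexp).mul_const _
  have hright : Filter.Tendsto (fun ε : ℝ ↦ -((2 * t / √(‖z‖ ^ 2 + t ^ 2) : ℝ) : ℂ) *
      greenProfileDeriv d (ε - Complex.I * k) √(‖z‖ ^ 2 + t ^ 2)) (nhdsWithin 0 (Set.Ioi 0))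
      (nhds (-((2 * t / √(‖z‖ ^ 2 + t ^ 2) : ℝ) : ℂ) *
        greenProfileDeriv d (-Complex.I * k) √(‖z‖ ^ 2 + t ^ 2))) := by
    refine Filter.Tendsto.const_mul _ ?_
    have hmem : -Complex.I * k ∈ Complex.slitPlane := by
      rw [Complex.mem_slitPlane_iff]; right; simp [hk.ne']
    have h1 := (differentiableAt_greenProfileDeriv d hmem hR).continuousAt.tendsto
    have h2 : Filter.Tendsto (fun ε : ℝ ↦ (ε : ℂ) - Complex.I * k) (nhdsWithin 0 (Set.Ioi 0))
        (nhds (-Complex.I * k)) := by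
      have h3 : Continuous fun ε : ℝ ↦ (ε : ℂ) - Complex.I * k := by fun_prop
      have h4 := h3.tendsto 0
      simp only [Complex.ofReal_zero, zero_sub, ← neg_mul] at h4
      exact h4.mono_left nhdsWithin_le_nhds
    exact h1.comp h2
  refine tendsto_nhds_unique hleft (hright.congr' ?_)
  filter_upwards [self_mem_nhdsWithin] with ε hε
  have hε : 0 < ε := hε
  exact (integral_exp_neg_mul_decayRate hd ht z (by simpa using hε)).symm

/-! ### The kernel of the double layer potential -/

theorem norm_point_sub_point (x y : E d) (t s : ℝ) :
    ‖point x t - point y s‖ = √(‖x - y‖ ^ 2 + (t - s) ^ 2) := by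
  rw [EuclideanSpace.norm_eq, EuclideanSpace.norm_sq_eq, Fin.sum_univ_castSucc]
  simp [point]

theorem planarProfile_eq_hankelH0 {x : ℝ} (hx : 0 < x) :
    planarProfile (-Complex.I * x) = Complex.I / 4 * hankelH0 x := by
  have hp := Real.pi_pos
  have hI : (2 * (-Complex.I * x) : ℂ) ^ (-(1 / 2) : ℂ) =
      (((√(2 * x))⁻¹ : ℝ) : ℂ) * Complex.exp (Real.pi / 4 * Complex.I) := by
    have h1 : (2 * (-Complex.I * x) : ℂ) = ((2 * x : ℝ) : ℂ) * (-Complex.I) := by push_cast; ring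
    have h2 : (√(2 * x))⁻¹ = Real.exp (-(Real.log (2 * x) / 2)) := by
      rw [Real.exp_neg, Real.sqrt_eq_rpow, Real.rpow_def_of_pos (by positivity)]
      ring_nf
    rw [h1, Complex.cpow_def_of_ne_zero (mul_ne_zero (by exact_mod_cast (by positivity : 2 * x ≠ 0))
      (neg_ne_zero.2 Complex.I_ne_zero)), Complex.log_ofReal_mul (by positivity)
      (neg_ne_zero.2 Complex.I_ne_zero), Complex.log_neg_I, h2, Complex.ofReal_exp,
      ← Complex.exp_add]
    congr 1
    push_cast
    ring
  have hJ : hankelIntegral (-Complex.I * x) = ∫ t in Set.Ioi (0 : ℝ),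
      ((Real.exp (-t) * t ^ (-(1 / 2) : ℝ) : ℝ) : ℂ) *
      (1 + Complex.I * t / (2 * x)) ^ (-(1 / 2) : ℂ) := by
    unfold hankelIntegral
    congr 1
    funext t
    congr 3
    have hx' : (x : ℂ) ≠ 0 := by exact_mod_cast hx.ne'
    have := Complex.I_ne_zero
    field_simp
    rw [Complex.I_sq]
    ring
  have hconst : √(2 / (Real.pi * x)) * (1 / Real.Gamma (1 / 2)) =
      2 / Real.pi * (√(2 * x))⁻¹ := by
    rw [Real.Gamma_one_half_eq, Real.sqrt_div (by norm_num), Real.sqrt_mul hp.le,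
      Real.sqrt_mul (by norm_num)]
    have h1 : √Real.pi * √Real.pi = Real.pi := Real.mul_self_sqrt hp.le
    have h2 : √(2 : ℝ) * √2 = 2 := Real.mul_self_sqrt (by norm_num)
    have h3 : 0 < √Real.pi := Real.sqrt_pos.2 hp
    field_simp
    nlinarith
  have hexp : Complex.I * Complex.exp (Complex.I * (x - Real.pi / 4)) =
      Complex.exp (Real.pi / 4 * Complex.I) * Complex.exp (-(-Complex.I * x)) := by
    rw [← Complex.exp_pi_div_two_mul_I, ← Complex.exp_add, ← Complex.exp_add,
      Complex.exp_pi_div_two_mul_I]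
    congr 1
    ring
  have hconst' := congrArg (fun r : ℝ ↦ (r : ℂ)) hconst
  simp only [Complex.ofReal_mul] at hconst'
  rw [hankelH0, planarProfile, ← hJ, hI]
  set J := hankelIntegral (-Complex.I * x)
  calc _ = 1 / 4 * (((2 / Real.pi : ℝ) : ℂ) * (((√(2 * x))⁻¹ : ℝ) : ℂ)) *
        (Complex.exp (Real.pi / 4 * Complex.I) * Complex.exp (-(-Complex.I * x))) * J := by
        push_cast
        ring
    _ = _ := by
        rw [← hconst', ← hexp]
        ring

theorem fundamentalSolution_eq_greenProfile (hd : d = 1 ∨ d = 2) {k : ℝ} (hk : 0 < k)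
    {x y : E (d + 1)} (hxy : x ≠ y) :
    fundamentalSolution (d + 1) k x y = greenProfile d (-Complex.I * k) ‖x - y‖ := by
  have hR : 0 < ‖x - y‖ := norm_pos_iff.2 (sub_ne_zero.2 hxy)
  rcases hd with rfl | rfl
  · rw [fundamentalSolution, if_pos rfl, greenProfile, if_pos rfl,
      ← planarProfile_eq_hankelH0 (by positivity)]
    push_cast
    ring_nf
  · rw [fundamentalSolution, if_neg (by norm_num), if_pos rfl, greenProfile, if_neg (by norm_num)]
    ring_nf

/-- The kernel of the double layer potential as an inverse Fourier transform. -/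
theorem deriv_fundamentalSolution (hd : d = 1 ∨ d = 2) {k t : ℝ} (hk : 0 < k) (ht : 0 < t)
    (x y : E d) :
    deriv (fun s : ℝ ↦ fundamentalSolution (d + 1) k (point x t) (point y s)) 0 =
      ∫ η : E d, 1 / 2 * (Complex.exp (Complex.I * t * verticalWavenumber k η) *
        Complex.exp (2 * Real.pi * Complex.I * (inner ℝ (x - y) η : ℝ))) := by
  have hmem : -Complex.I * k ∈ Complex.slitPlane := by
    rw [Complex.mem_slitPlane_iff]; right; simp [hk.ne']
  rw [integral_const_mul, integral_exp_verticalWavenumber hd hk ht]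
  set R := √(‖x - y‖ ^ 2 + t ^ 2) with hRdef
  have hR : 0 < R := by positivity
  have h1 : HasDerivAt (fun s : ℝ ↦ √(‖x - y‖ ^ 2 + (t - s) ^ 2)) (-(t / R)) 0 := by
    have h2 : HasDerivAt (fun s : ℝ ↦ ‖x - y‖ ^ 2 + (t - s) ^ 2) (-(2 * t)) 0 := by
      have := ((((hasDerivAt_id (0 : ℝ)).const_sub t).pow 2).const_add (‖x - y‖ ^ 2))
      simpa using this
    have h3 := h2.sqrt (by rw [sub_zero]; positivity)
    rw [sub_zero, ← hRdef] at h3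
    refine h3.congr_deriv ?_
    field_simp
  have h4 : HasDerivAt (greenProfile d (-Complex.I * k)) (greenProfileDeriv d (-Complex.I * k) R)
      (√(‖x - y‖ ^ 2 + (t - 0) ^ 2)) := by
    rw [sub_zero]
    exact hasDerivAt_greenProfile d hmem hR
  have h5 := h4.scomp (0 : ℝ) h1
  have h6 : (fun s : ℝ ↦ fundamentalSolution (d + 1) k (point x t) (point y s)) =ᶠ[nhds 0]
      (greenProfile d (-Complex.I * k)) ∘ fun s : ℝ ↦ √(‖x - y‖ ^ 2 + (t - s) ^ 2) := by
    filter_upwards [gt_mem_nhds ht] with s hs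
    have hpos : 0 < ‖point x t - point y s‖ := by
      rw [norm_point_sub_point]
      have : 0 < (t - s) ^ 2 := by
        have : 0 < t - s := by linarith
        positivity
      positivity
    rw [fundamentalSolution_eq_greenProfile hd hk (sub_ne_zero.1 (norm_pos_iff.1 hpos)),
      norm_point_sub_point]
    rfl
  rw [(h5.congr_of_eventuallyEq h6).deriv, Complex.real_smul]
  push_cast
  ring

/-! ### Sobolev spaces on the Fourier side -/

/-- The symbol `(k² + |ξ|²)^{s/2}`, `ξ = 2πη`, of the Bessel potential operator. -/
def besselSymbol (k s : ℝ) (η : E d) : ℝ := (k ^ 2 + (2 * Real.pi * ‖η‖) ^ 2) ^ (s / 2)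

/-- The Fourier transform of `u` is the function `g`, with `(1 + |η|²)^{s/2} g` in `L²`. -/
def HasFourierSobolev (s : ℝ) (u : 𝓢'(E d, ℂ)) (g : E d → ℂ) : Prop :=
  MemLp (fun η : E d ↦ (((1 + ‖η‖ ^ 2) ^ (s / 2) : ℝ) : ℂ) * g η) 2 ∧
    ∀ ψ : 𝓢(E d, ℂ), 𝓕 u ψ = ∫ η, ψ η * g η

theorem besselSymbol_pos {k : ℝ} (hk : 0 < k) (s : ℝ) (η : E d) : 0 < besselSymbol k s η := by
  unfold besselSymbol; positivity

theorem besselSymbol_sq {k : ℝ} (hk : 0 < k) (s : ℝ) (η : E d) :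
    besselSymbol k s η ^ 2 = (k ^ 2 + (2 * Real.pi * ‖η‖) ^ 2) ^ s := by
  rw [besselSymbol, ← Real.rpow_natCast, ← Real.rpow_mul (by positivity)]
  norm_num

theorem hasTemperateGrowth_besselSymbol {k : ℝ} (hk : 0 < k) (s : ℝ) :
    Function.HasTemperateGrowth (fun η : E d ↦ ((besselSymbol k s η : ℝ) : ℂ)) := by
  have h1 : (fun η : E d ↦ ((besselSymbol k s η : ℝ) : ℂ)) = fun η : E d ↦
      (((k ^ 2) ^ (s / 2) : ℝ) : ℂ) *
      (((1 + ‖((2 * Real.pi / k) • ContinuousLinearMap.id ℝ (E d)) η‖ ^ 2) ^ (s / 2) : ℝ) : ℂ) := by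
    funext η
    rw [← Complex.ofReal_mul, ← Real.mul_rpow (by positivity) (by positivity), besselSymbol]
    congr 3
    rw [smul_apply, ContinuousLinearMap.id_apply, norm_smul, Real.norm_eq_abs,
      abs_of_pos (by have := Real.pi_pos; positivity)]
    field_simp
  rw [h1]
  have h2 : Function.HasTemperateGrowth fun η : E d ↦ (((1 + ‖η‖ ^ 2) ^ (s / 2) : ℝ) : ℂ) := by
    fun_prop
  have h3 := h2.comp ((2 * Real.pi / k) • ContinuousLinearMap.id ℝ (E d)).hasTemperateGrowth
  exact (Function.HasTemperateGrowth.const _).mul h3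

theorem rpow_le_add_rpow {m M q : ℝ} (hm : 0 < m) (hmq : m ≤ q) (hqM : q ≤ M) (a : ℝ) :
    q ^ a ≤ m ^ a + M ^ a := by
  have hq : 0 < q := hm.trans_le hmq
  have hM : 0 < M := hq.trans_le hqM
  rcases le_total 0 a with h | h
  · have := Real.rpow_le_rpow hq.le hqM h
    have := Real.rpow_pos_of_pos hm a
    linarith
  · have := Real.rpow_le_rpow_of_nonpos hm hmq h
    have := Real.rpow_pos_of_pos hM a
    linarith

theorem memLp_besselSymbol_mul {k : ℝ} (hk : 0 < k) {s : ℝ} {g : E d → ℂ}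
    (hg : MemLp (fun η : E d ↦ (((1 + ‖η‖ ^ 2) ^ (s / 2) : ℝ) : ℂ) * g η) 2) :
    MemLp (fun η : E d ↦ ((besselSymbol k s η : ℝ) : ℂ) * g η) 2 := by
  have hp := Real.pi_pos
  set m := min (k ^ 2) ((2 * Real.pi) ^ 2)
  set M := max (k ^ 2) ((2 * Real.pi) ^ 2)
  have hm : 0 < m := lt_min (by positivity) (by positivity)
  have hratio : ∀ η : E d, besselSymbol k s η =
      ((k ^ 2 + (2 * Real.pi * ‖η‖) ^ 2) / (1 + ‖η‖ ^ 2)) ^ (s / 2) * (1 + ‖η‖ ^ 2) ^ (s / 2) := by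
    intro η
    rw [← Real.mul_rpow (by positivity) (by positivity), besselSymbol]
    congr 1
    field_simp
  have hle : ∀ η : E d, besselSymbol k s η ≤
      (m ^ (s / 2) + M ^ (s / 2)) * (1 + ‖η‖ ^ 2) ^ (s / 2) := by
    intro η
    rw [hratio]
    refine mul_le_mul_of_nonneg_right (rpow_le_add_rpow hm ?_ ?_ _) (by positivity)
    · rw [le_div_iff₀ (by positivity)]
      nlinarith [min_le_left (k ^ 2) ((2 * Real.pi) ^ 2), min_le_right (k ^ 2) ((2 * Real.pi) ^ 2),
        mul_le_mul_of_nonneg_right (min_le_right (k ^ 2) ((2 * Real.pi) ^ 2)) (sq_nonneg ‖η‖)]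
    · rw [div_le_iff₀ (by positivity)]
      nlinarith [le_max_left (k ^ 2) ((2 * Real.pi) ^ 2), le_max_right (k ^ 2) ((2 * Real.pi) ^ 2),
        mul_le_mul_of_nonneg_right (le_max_right (k ^ 2) ((2 * Real.pi) ^ 2)) (sq_nonneg ‖η‖)]
  refine hg.of_le_mul (c := m ^ (s / 2) + M ^ (s / 2)) ?_ (Filter.Eventually.of_forall fun η ↦ ?_)
  · have h1 : (fun η : E d ↦ ((besselSymbol k s η : ℝ) : ℂ) * g η) = fun η : E d ↦
        ((((k ^ 2 + (2 * Real.pi * ‖η‖) ^ 2) / (1 + ‖η‖ ^ 2)) ^ (s / 2) : ℝ) : ℂ) *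
          ((((1 + ‖η‖ ^ 2) ^ (s / 2) : ℝ) : ℂ) * g η) := by
      funext η
      rw [hratio, Complex.ofReal_mul, mul_assoc]
    rw [h1]
    exact (by fun_prop : Measurable _).aestronglyMeasurable.mul hg.1
  · rw [norm_mul, norm_mul, Complex.norm_real, Complex.norm_real,
      Real.norm_of_nonneg (besselSymbol_pos hk s η).le, Real.norm_of_nonneg (by positivity),
      ← mul_assoc]
    exact mul_le_mul_of_nonneg_right (hle η) (norm_nonneg _)

theorem toTemperedDistribution_injective {f g : Lp ℂ 2 (volume : Measure (E d))}
    (h : (f : 𝓢'(E d, ℂ)) = (g : 𝓢'(E d, ℂ))) : f = g := by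
  have hker := Lp.ker_toTemperedDistributionCLM_eq_bot (F := ℂ) (μ := (volume : Measure (E d)))
    (p := 2)
  exact LinearMap.ker_eq_bot.1 hker h

theorem besselRep_eq {k s : ℝ} {u : 𝓢'(E d, ℂ)} {f : Lp ℂ 2 (volume : Measure (E d))}
    (h : besselPotentialK k s u = (f : 𝓢'(E d, ℂ))) : besselRep k s u = f := by
  have hex : ∃ f : Lp ℂ 2 (volume : Measure (E d)), besselPotentialK k s u = (f : 𝓢'(E d, ℂ)) :=
    ⟨f, h⟩
  rw [besselRep, dif_pos hex]
  exact toTemperedDistribution_injective (hex.choose_spec.symm.trans h)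

theorem fourier_fourierMultiplierCLM (m : E d → ℂ) (u : 𝓢'(E d, ℂ)) :
    𝓕 (TemperedDistribution.fourierMultiplierCLM ℂ m u) =
      TemperedDistribution.smulLeftCLM ℂ m (𝓕 u) := by
  rw [TemperedDistribution.fourierMultiplierCLM_apply, fourier_fourierInv_eq]

/-- A Fourier multiplier maps a distribution with transform `g` to an `L²` function as soon as
`m g ∈ L²`; the transform `g` itself need not be in `L²`. -/
theorem fourierMultiplierCLM_eq_fourierInv_toLp {m : E d → ℂ} (hm : m.HasTemperateGrowth)
    {u : 𝓢'(E d, ℂ)} {g : E d → ℂ} (hu : ∀ ψ : 𝓢(E d, ℂ), 𝓕 u ψ = ∫ η, ψ η * g η)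
    (hmg : MemLp (fun η ↦ m η * g η) 2) :
    TemperedDistribution.fourierMultiplierCLM ℂ m u =
      ((𝓕⁻ (hmg.toLp _) : Lp ℂ 2 (volume : Measure (E d))) : 𝓢'(E d, ℂ)) := by
  have h1 : 𝓕 (TemperedDistribution.fourierMultiplierCLM ℂ m u) =
      ((hmg.toLp _ : Lp ℂ 2 (volume : Measure (E d))) : 𝓢'(E d, ℂ)) := by
    rw [fourier_fourierMultiplierCLM]
    ext ψ
    rw [TemperedDistribution.smulLeftCLM_apply_apply, hu, Lp.toTemperedDistribution_apply]
    refine integral_congr_ae ?_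
    filter_upwards [hmg.coeFn_toLp] with η hη
    rw [hη, SchwartzMap.smulLeftCLM_apply_apply hm, smul_eq_mul, smul_eq_mul]
    ring
  rw [← Lp.fourierInv_toTemperedDistribution_eq, ← h1, fourierInv_fourier_eq]

theorem HasFourierSobolev.besselRep_eq {k s : ℝ} (hk : 0 < k) {u : 𝓢'(E d, ℂ)} {g : E d → ℂ}
    (hu : HasFourierSobolev s u g) :
    besselRep k s u = 𝓕⁻ ((memLp_besselSymbol_mul hk hu.1).toLp _) :=
  ScreenScattering.besselRep_eq (fourierMultiplierCLM_eq_fourierInv_toLp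
    (hasTemperateGrowth_besselSymbol hk s) hu.2 (memLp_besselSymbol_mul hk hu.1))

theorem HasFourierSobolev.memSobolev {s : ℝ} {u : 𝓢'(E d, ℂ)} {g : E d → ℂ}
    (hu : HasFourierSobolev s u g) : TemperedDistribution.MemSobolev s 2 u :=
  ⟨_, fourierMultiplierCLM_eq_fourierInv_toLp (by fun_prop) hu.2 hu.1⟩

theorem norm_fourierInv_Lp (f : Lp ℂ 2 (volume : Measure (E d))) : ‖𝓕⁻ f‖ = ‖f‖ := by
  rw [← Lp.norm_fourier_eq, fourier_fourierInv_eq]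

theorem inner_fourierInv_Lp (f g : Lp ℂ 2 (volume : Measure (E d))) :
    inner ℂ (𝓕⁻ f) (𝓕⁻ g) = inner ℂ f g := by
  rw [← Lp.inner_fourier_eq, fourier_fourierInv_eq, fourier_fourierInv_eq]

theorem norm_sq_eq_integral (f : Lp ℂ 2 (volume : Measure (E d))) :
    ‖f‖ ^ 2 = ∫ x, ‖f x‖ ^ 2 := by
  have h : ((‖f‖ ^ 2 : ℝ) : ℂ) = ((∫ x, ‖f x‖ ^ 2 : ℝ) : ℂ) := by
    have h1 := inner_self_eq_norm_sq_to_K (𝕜 := ℂ) f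
    rw [L2.inner_def] at h1
    rw [← integral_complex_ofReal]
    refine (Complex.ofReal_pow _ _).trans (h1.symm.trans ?_)
    refine integral_congr_ae (Filter.Eventually.of_forall fun x ↦ ?_)
    simp [inner_self_eq_norm_sq_to_K]
  exact_mod_cast h

theorem HasFourierSobolev.sobolevNorm_sq {k s : ℝ} (hk : 0 < k) {u : 𝓢'(E d, ℂ)} {g : E d → ℂ}
    (hu : HasFourierSobolev s u g) :
    sobolevNorm k s u ^ 2 = ∫ η, (k ^ 2 + (2 * Real.pi * ‖η‖) ^ 2) ^ s * ‖g η‖ ^ 2 := by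
  rw [sobolevNorm, hu.besselRep_eq hk, norm_fourierInv_Lp, norm_sq_eq_integral]
  refine integral_congr_ae ?_
  filter_upwards [(memLp_besselSymbol_mul hk hu.1).coeFn_toLp] with η hη
  rw [hη, norm_mul, mul_pow, Complex.norm_real, Real.norm_eq_abs, sq_abs, besselSymbol_sq hk]

theorem HasFourierSobolev.dualPairing_eq {s : ℝ} {u v : 𝓢'(E d, ℂ)} {g h : E d → ℂ}
    (hu : HasFourierSobolev (-s) u g) (hv : HasFourierSobolev s v h) :
    dualPairing s u v = ∫ η, g η * conj (h η) := by
  rw [dualPairing, hu.besselRep_eq one_pos, hv.besselRep_eq one_pos, inner_fourierInv_Lp,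
    L2.inner_def]
  refine integral_congr_ae ?_
  filter_upwards [(memLp_besselSymbol_mul one_pos hu.1).coeFn_toLp,
    (memLp_besselSymbol_mul one_pos hv.1).coeFn_toLp] with η h1 h2
  rw [h1, h2, RCLike.inner_apply, map_mul, Complex.conj_ofReal]
  have h3 : ((besselSymbol 1 (-s) η : ℝ) : ℂ) * ((besselSymbol 1 s η : ℝ) : ℂ) = 1 := by
    rw [← Complex.ofReal_mul, besselSymbol, besselSymbol, ← Real.rpow_add (by positivity),
      neg_div, neg_add_cancel, Real.rpow_zero, Complex.ofReal_one]
  calc _ = (((besselSymbol 1 (-s) η : ℝ) : ℂ) * ((besselSymbol 1 s η : ℝ) : ℂ)) *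
        (g η * conj (h η)) := by ring
    _ = _ := by rw [h3, one_mul]

theorem coe_rpow_neg_mul_rpow (s : ℝ) (η : E d) :
    (((1 + ‖η‖ ^ 2) ^ (-s) : ℝ) : ℂ) * (((1 + ‖η‖ ^ 2) ^ s : ℝ) : ℂ) = 1 := by
  rw [← Complex.ofReal_mul, ← Real.rpow_add (by positivity)]
  norm_num

theorem exists_hasFourierSobolev_of_memSobolev {s : ℝ} {u : 𝓢'(E d, ℂ)}
    (hu : TemperedDistribution.MemSobolev s 2 u) : ∃ g, HasFourierSobolev s u g := by
  obtain ⟨f, hf⟩ := TemperedDistribution.memSobolev_iff_exists_smulLeftCLM_fourier.1 hu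
  refine ⟨fun η ↦ (((1 + ‖η‖ ^ 2) ^ (-(s / 2)) : ℝ) : ℂ) * f η, ?_, fun ψ ↦ ?_⟩
  · refine (memLp_congr_ae (Filter.Eventually.of_forall fun η ↦ ?_)).1 (Lp.memLp f)
    rw [← mul_assoc, mul_comm (Complex.ofReal _), coe_rpow_neg_mul_rpow, one_mul]
  · have hm : Function.HasTemperateGrowth
        (fun η : E d ↦ (((1 + ‖η‖ ^ 2) ^ (-(s / 2)) : ℝ) : ℂ)) := by
      fun_prop
    have hm' : Function.HasTemperateGrowth
        (fun η : E d ↦ (((1 + ‖η‖ ^ 2) ^ (s / 2) : ℝ) : ℂ)) := by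
      fun_prop
    have h1 := congrArg (fun T : 𝓢'(E d, ℂ) ↦ T (SchwartzMap.smulLeftCLM ℂ
      (fun η : E d ↦ (((1 + ‖η‖ ^ 2) ^ (-(s / 2)) : ℝ) : ℂ)) ψ)) hf
    simp only [TemperedDistribution.smulLeftCLM_apply_apply, Lp.toTemperedDistribution_apply] at h1
    have h2 : SchwartzMap.smulLeftCLM ℂ (fun η : E d ↦ (((1 + ‖η‖ ^ 2) ^ (s / 2) : ℝ) : ℂ))
        (SchwartzMap.smulLeftCLM ℂ
          (fun η : E d ↦ (((1 + ‖η‖ ^ 2) ^ (-(s / 2)) : ℝ) : ℂ)) ψ) = ψ := by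
      ext η
      rw [SchwartzMap.smulLeftCLM_apply_apply hm', SchwartzMap.smulLeftCLM_apply_apply hm,
        smul_eq_mul, smul_eq_mul, ← mul_assoc, mul_comm (Complex.ofReal _), coe_rpow_neg_mul_rpow,
        one_mul]
    rw [h2] at h1
    rw [h1]
    refine integral_congr_ae (Filter.Eventually.of_forall fun η ↦ ?_)
    simp only
    rw [SchwartzMap.smulLeftCLM_apply_apply hm, smul_eq_mul, smul_eq_mul]
    ring

theorem exists_distribution_hasFourierSobolev {s : ℝ} {g : E d → ℂ}
    (hg : MemLp (fun η : E d ↦ (((1 + ‖η‖ ^ 2) ^ (s / 2) : ℝ) : ℂ) * g η) 2) :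
    ∃ u : 𝓢'(E d, ℂ), HasFourierSobolev s u g := by
  have hm : Function.HasTemperateGrowth
      (fun η : E d ↦ (((1 + ‖η‖ ^ 2) ^ (-(s / 2)) : ℝ) : ℂ)) := by
    fun_prop
  refine ⟨𝓕⁻ (TemperedDistribution.smulLeftCLM ℂ
    (fun η : E d ↦ (((1 + ‖η‖ ^ 2) ^ (-(s / 2)) : ℝ) : ℂ)) (hg.toLp _ : 𝓢'(E d, ℂ))), hg,
    fun ψ ↦ ?_⟩
  rw [fourier_fourierInv_eq, TemperedDistribution.smulLeftCLM_apply_apply,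
    Lp.toTemperedDistribution_apply]
  refine integral_congr_ae ?_
  filter_upwards [hg.coeFn_toLp] with η hη
  rw [hη, SchwartzMap.smulLeftCLM_apply_apply hm, smul_eq_mul, smul_eq_mul]
  linear_combination (ψ η * g η) * coe_rpow_neg_mul_rpow (s / 2) η

theorem hasFourierSobolev_schwartz (s : ℝ) (ψ : 𝓢(E d, ℂ)) :
    HasFourierSobolev s (ψ : 𝓢'(E d, ℂ)) (𝓕 ψ : 𝓢(E d, ℂ)) := by
  have hm : Function.HasTemperateGrowth
      (fun η : E d ↦ (((1 + ‖η‖ ^ 2) ^ (s / 2) : ℝ) : ℂ)) := by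
    fun_prop
  refine ⟨?_, fun χ ↦ ?_⟩
  · refine (memLp_congr_ae (Filter.Eventually.of_forall fun η ↦ ?_)).1
      ((SchwartzMap.smulLeftCLM ℂ (fun η : E d ↦ (((1 + ‖η‖ ^ 2) ^ (s / 2) : ℝ) : ℂ))
        (𝓕 ψ)).memLp 2 volume)
    rw [SchwartzMap.smulLeftCLM_apply_apply hm, smul_eq_mul]
  · rw [TemperedDistribution.fourier_toTemperedDistributionCLM_eq]
    exact SchwartzMap.toTemperedDistributionCLM_apply_apply volume (𝓕 ψ) χ

theorem HasFourierSobolev.memLp {s : ℝ} {u : 𝓢'(E d, ℂ)} {g : E d → ℂ} (hs : 0 ≤ s)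
    (hu : HasFourierSobolev s u g) : MemLp g 2 := by
  have h1 : g = fun η ↦ (((1 + ‖η‖ ^ 2) ^ (-(s / 2)) : ℝ) : ℂ) *
      ((((1 + ‖η‖ ^ 2) ^ (s / 2) : ℝ) : ℂ) * g η) := by
    funext η
    rw [← mul_assoc, coe_rpow_neg_mul_rpow, one_mul]
  refine hu.1.of_le ?_ (Filter.Eventually.of_forall fun η ↦ ?_)
  · rw [h1]
    exact (by fun_prop : Measurable _).aestronglyMeasurable.mul hu.1.1
  · rw [norm_mul, Complex.norm_real, Real.norm_of_nonneg (by positivity)]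
    exact le_mul_of_one_le_left (norm_nonneg _)
      (Real.one_le_rpow (by linarith [sq_nonneg ‖η‖]) (by linarith))

/-- On `L²` the Fourier representative in the sense of distributions is the `L²` Fourier
transform. -/
theorem HasFourierSobolev.ae_eq_fourier {s : ℝ} (hs : 0 ≤ s)
    {f : Lp ℂ 2 (volume : Measure (E d))} {g : E d → ℂ}
    (hf : HasFourierSobolev s (f : 𝓢'(E d, ℂ)) g) :
    g =ᵐ[volume] (𝓕 f : Lp ℂ 2 (volume : Measure (E d))) := by
  have hg := hf.memLp hs
  have h1 : hg.toLp g = 𝓕 f := by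
    refine toTemperedDistribution_injective ?_
    rw [← Lp.fourier_toTemperedDistribution_eq]
    ext ψ
    rw [hf.2, Lp.toTemperedDistribution_apply]
    refine integral_congr_ae ?_
    filter_upwards [hg.coeFn_toLp] with η hη
    rw [hη, smul_eq_mul]
  rw [← h1]
  exact hg.coeFn_toLp.symm

theorem norm_le_sobolevNorm {f : Lp ℂ 2 (volume : Measure (E d))}
    (hf : TemperedDistribution.MemSobolev (1 / 2) 2 (f : 𝓢'(E d, ℂ))) :
    ‖f‖ ≤ sobolevNorm 1 (1 / 2) (f : 𝓢'(E d, ℂ)) := by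
  obtain ⟨g, hg⟩ := exists_hasFourierSobolev_of_memSobolev hf
  have hae := hg.ae_eq_fourier (by norm_num)
  have h1 := hg.besselRep_eq one_pos
  rw [sobolevNorm, h1, norm_fourierInv_Lp, ← Lp.norm_fourier_eq]
  refine Lp.norm_le_norm_of_ae_le ?_
  filter_upwards [hae, (memLp_besselSymbol_mul one_pos hg.1).coeFn_toLp] with η h2 h3
  rw [h3, ← h2, norm_mul, Complex.norm_real, Real.norm_of_nonneg (besselSymbol_pos one_pos _ η).le]
  refine le_mul_of_one_le_left (norm_nonneg _) (Real.one_le_rpow ?_ (by norm_num))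
  nlinarith [sq_nonneg (2 * Real.pi * ‖η‖)]

/-- Elements of `H̃^{1/2}(Γ)` are limits in `L²` of functions supported in `Γ`. -/
theorem MemTildeH.ae_eq_zero {Γ : Set (E d)} (hΓ : MeasurableSet Γ)
    {f : Lp ℂ 2 (volume : Measure (E d))} (hf : MemTildeH (1 / 2) Γ (f : 𝓢'(E d, ℂ))) :
    ∀ᵐ x, x ∉ Γ → f x = 0 := by
  have hint : Integrable (fun x ↦ ‖f x‖ ^ 2) := (Lp.memLp f).integrable_norm_pow (by norm_num)
  have hle : ∀ ε > 0, ∫ x in Γᶜ, ‖f x‖ ^ 2 ≤ ε ^ 2 := by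
    intro ε hε
    obtain ⟨ψ, hψ, hlt⟩ := hf.2 ε hε
    have hcoe : (f : 𝓢'(E d, ℂ)) - (ψ : 𝓢'(E d, ℂ)) =
        ((f - ψ.toLp 2 volume : Lp ℂ 2 (volume : Measure (E d))) : 𝓢'(E d, ℂ)) := by
      rw [← Lp.toTemperedDistribution_toLp_eq (p := 2), ← Lp.toTemperedDistributionCLM_apply,
        ← Lp.toTemperedDistributionCLM_apply, ← Lp.toTemperedDistributionCLM_apply, map_sub]
    have hmem := hf.1.sub (ψ.memSobolev (s := 1 / 2) (p := 2))
    rw [hcoe] at hlt hmem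
    have h1 := (norm_le_sobolevNorm hmem).trans hlt.le
    have h2 : ‖f - ψ.toLp 2 volume‖ ^ 2 ≤ ε ^ 2 := by gcongr
    rw [norm_sq_eq_integral] at h2
    refine le_trans ?_ h2
    have hint' : Integrable
        (fun x ↦ ‖(f - ψ.toLp 2 volume : Lp ℂ 2 (volume : Measure (E d))) x‖ ^ 2) :=
      (Lp.memLp _).integrable_norm_pow (by norm_num)
    refine le_trans ?_ (setIntegral_le_integral (s := Γᶜ) hint'
      (Filter.Eventually.of_forall fun x ↦ by positivity))
    refine le_of_eq (setIntegral_congr_ae hΓ.compl ?_)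
    filter_upwards [Lp.coeFn_sub f (ψ.toLp 2 volume), ψ.coeFn_toLp 2 volume] with x hx hx' hxΓ
    rw [hx, Pi.sub_apply, hx', image_eq_zero_of_notMem_tsupport fun h ↦ hxΓ (hψ.2 h), sub_zero]
  have hzero : ∫ x in Γᶜ, ‖f x‖ ^ 2 = 0 := by
    refine le_antisymm (le_of_forall_pos_le_add fun ε hε ↦ ?_)
      (integral_nonneg fun x ↦ by positivity)
    have := hle (√ε) (Real.sqrt_pos.2 hε)
    rw [Real.sq_sqrt hε.le] at this
    linarith
  rw [setIntegral_eq_zero_iff_of_nonneg_ae (Filter.Eventually.of_forall fun x ↦ by positivity)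
    hint.integrableOn] at hzero
  rw [Filter.EventuallyEq, ae_restrict_iff' hΓ.compl] at hzero
  filter_upwards [hzero] with x hx hxΓ
  simpa using hx hxΓ

theorem MemTildeH.integrable {Γ : Set (E d)} (hΓ : MeasurableSet Γ) (hb : Bornology.IsBounded Γ)
    {f : Lp ℂ 2 (volume : Measure (E d))} (hf : MemTildeH (1 / 2) Γ (f : 𝓢'(E d, ℂ))) :
    Integrable f := by
  have hfin : IsFiniteMeasure (volume.restrict Γ) :=
    ⟨by rw [Measure.restrict_apply_univ]; exact hb.measure_lt_top⟩
  have h1 : IntegrableOn f Γ := ((Lp.memLp f).restrict Γ).integrable (by norm_num)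
  refine ((integrable_indicator_iff hΓ).2 h1).congr ?_
  filter_upwards [hf.ae_eq_zero hΓ] with x hx
  by_cases hxΓ : x ∈ Γ
  · rw [Set.indicator_of_mem hxΓ]
  · rw [Set.indicator_of_notMem hxΓ, hx hxΓ]

/-- The Fourier transform of an element of `H̃^{1/2}(Γ)` is its Fourier integral. -/
theorem MemTildeH.hasFourierSobolev {Γ : Set (E d)} (hΓ : MeasurableSet Γ)
    (hb : Bornology.IsBounded Γ) {f : Lp ℂ 2 (volume : Measure (E d))}
    (hf : MemTildeH (1 / 2) Γ (f : 𝓢'(E d, ℂ))) :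
    HasFourierSobolev (1 / 2) (f : 𝓢'(E d, ℂ)) (𝓕 (f : E d → ℂ)) := by
  obtain ⟨g, hg⟩ := exists_hasFourierSobolev_of_memSobolev hf.1
  have hae : g =ᵐ[volume] 𝓕 (f : E d → ℂ) := by
    have h1 := fourier_toLp_ae_eq (hf.integrable hΓ hb) (Lp.memLp f)
    rw [Lp.toLp_coeFn] at h1
    exact (hg.ae_eq_fourier (by norm_num)).trans h1
  refine ⟨(memLp_congr_ae ?_).1 hg.1, fun ψ ↦ ?_⟩
  · filter_upwards [hae] with η hη
    rw [hη]
  · rw [hg.2]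
    refine integral_congr_ae ?_
    filter_upwards [hae] with η hη
    rw [hη]

/-! ### The duality pairing -/

theorem exists_besselPotentialK_eq {k s : ℝ} (hk : 0 < k) {u : 𝓢'(E d, ℂ)}
    (hu : TemperedDistribution.MemSobolev s 2 u) :
    besselPotentialK k s u = (besselRep k s u : 𝓢'(E d, ℂ)) := by
  obtain ⟨g, hg⟩ := exists_hasFourierSobolev_of_memSobolev hu
  rw [hg.besselRep_eq hk]
  exact fourierMultiplierCLM_eq_fourierInv_toLp (hasTemperateGrowth_besselSymbol hk s) hg.2 _

theorem besselRep_sub {k s : ℝ} (hk : 0 < k) {u v : 𝓢'(E d, ℂ)}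
    (hu : TemperedDistribution.MemSobolev s 2 u) (hv : TemperedDistribution.MemSobolev s 2 v) :
    besselRep k s (u - v) = besselRep k s u - besselRep k s v := by
  refine besselRep_eq ?_
  rw [map_sub, exists_besselPotentialK_eq hk hu, exists_besselPotentialK_eq hk hv,
    ← Lp.toTemperedDistributionCLM_apply, ← Lp.toTemperedDistributionCLM_apply,
    ← Lp.toTemperedDistributionCLM_apply, map_sub]

theorem norm_dualPairing_le (s : ℝ) (u v : 𝓢'(E d, ℂ)) :
    ‖dualPairing s u v‖ ≤ sobolevNorm 1 s v * sobolevNorm 1 (-s) u :=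
  norm_inner_le_norm _ _

theorem IsTestFunctionOn.exists_conj {Γ : Set (E d)} {ψ : 𝓢(E d, ℂ)} (hψ : IsTestFunctionOn Γ ψ) :
    ∃ χ : 𝓢(E d, ℂ), IsTestFunctionOn Γ χ ∧ ∀ x, χ x = conj (ψ x) := by
  have h1 : HasCompactSupport fun x ↦ conj (ψ x) := hψ.1.comp_left (map_zero _)
  have h2 : ContDiff ℝ ∞ fun x ↦ conj (ψ x) :=
    Complex.conjCLE.contDiff.comp ψ.smooth'
  refine ⟨h1.toSchwartzMap h2, ⟨h1, ?_⟩, fun x ↦ rfl⟩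
  refine (closure_mono fun x hx ↦ ?_ : tsupport (fun x ↦ conj (ψ x)) ⊆ tsupport ψ).trans hψ.2
  intro h
  exact hx (by simp [h])

/-- The duality pairing with a test function is evaluation at its complex conjugate. -/
theorem dualPairing_schwartz {s : ℝ} {u : 𝓢'(E d, ℂ)}
    (hu : TemperedDistribution.MemSobolev (-s) 2 u) {ψ χ : 𝓢(E d, ℂ)}
    (hχ : ∀ x, χ x = conj (ψ x)) : dualPairing s u (ψ : 𝓢'(E d, ℂ)) = u χ := by
  obtain ⟨g, hg⟩ := exists_hasFourierSobolev_of_memSobolev hu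
  rw [hg.dualPairing_eq (hasFourierSobolev_schwartz s ψ)]
  have h1 : u χ = 𝓕 u (𝓕⁻ χ) := by
    rw [TemperedDistribution.fourier_apply, fourier_fourierInv_eq]
  rw [h1, hg.2]
  refine integral_congr_ae (Filter.Eventually.of_forall fun η ↦ ?_)
  simp only
  rw [mul_comm, SchwartzMap.fourier_coe, SchwartzMap.fourierInv_coe, Real.fourier_eq',
    Real.fourierInv_eq', ← integral_conj]
  congr 1
  refine integral_congr_ae (Filter.Eventually.of_forall fun x ↦ ?_)
  simp only [smul_eq_mul, map_mul, hχ]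
  rw [← Complex.exp_conj]
  congr 2
  rw [map_mul, Complex.conj_ofReal, Complex.conj_I]
  push_cast
  ring

/-- Two elements of `H^{-s}` with the same restriction to `Γ` have the same pairing with
`H̃^s(Γ)`, in which the test functions are dense. -/
theorem dualPairing_eq_of_eq_on_testFunctions {s : ℝ} {Γ : Set (E d)} {u v w : 𝓢'(E d, ℂ)}
    (hu : TemperedDistribution.MemSobolev (-s) 2 u)
    (hv : TemperedDistribution.MemSobolev (-s) 2 v)
    (huv : ∀ ψ : 𝓢(E d, ℂ), IsTestFunctionOn Γ ψ → u ψ = v ψ) (hw : MemTildeH s Γ w) :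
    dualPairing s u w = dualPairing s v w := by
  have key : ∀ ε > 0, ‖dualPairing s u w - dualPairing s v w‖ ≤
      ε * (sobolevNorm 1 (-s) u + sobolevNorm 1 (-s) v) := by
    intro ε hε
    obtain ⟨ψ, hψ, hlt⟩ := hw.2 ε hε
    obtain ⟨χ, hχ, hχψ⟩ := hψ.exists_conj
    have hsub : ∀ T : 𝓢'(E d, ℂ), dualPairing s T (w - (ψ : 𝓢'(E d, ℂ))) =
        dualPairing s T w - dualPairing s T (ψ : 𝓢'(E d, ℂ)) := by
      intro T
      rw [dualPairing, besselRep_sub one_pos hw.1 ψ.memSobolev, inner_sub_left]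
      rfl
    have h1 : dualPairing s u w - dualPairing s v w =
        dualPairing s u (w - (ψ : 𝓢'(E d, ℂ))) - dualPairing s v (w - (ψ : 𝓢'(E d, ℂ))) := by
      rw [hsub, hsub, dualPairing_schwartz hu hχψ, dualPairing_schwartz hv hχψ, huv χ hχ]
      ring
    have hn : ∀ T : 𝓢'(E d, ℂ), 0 ≤ sobolevNorm 1 (-s) T := fun T ↦ norm_nonneg _
    calc ‖dualPairing s u w - dualPairing s v w‖
        ≤ ‖dualPairing s u (w - (ψ : 𝓢'(E d, ℂ)))‖ + ‖dualPairing s v (w - (ψ : 𝓢'(E d, ℂ)))‖ := by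
          rw [h1]; exact norm_sub_le _ _
      _ ≤ ε * sobolevNorm 1 (-s) u + ε * sobolevNorm 1 (-s) v := by
          gcongr
          · exact (norm_dualPairing_le _ _ _).trans
              (mul_le_mul_of_nonneg_right hlt.le (hn u))
          · exact (norm_dualPairing_le _ _ _).trans
              (mul_le_mul_of_nonneg_right hlt.le (hn v))
      _ = _ := by ring
  have hlim : Filter.Tendsto (fun ε : ℝ ↦ ε * (sobolevNorm 1 (-s) u + sobolevNorm 1 (-s) v))
      (nhdsWithin 0 (Set.Ioi 0)) (nhds 0) := by
    have h1 : Continuous fun ε : ℝ ↦ ε * (sobolevNorm 1 (-s) u + sobolevNorm 1 (-s) v) := by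
      fun_prop
    have h2 := h1.tendsto 0
    rw [zero_mul] at h2
    exact h2.mono_left nhdsWithin_le_nhds
  have h0 := ge_of_tendsto hlim (by filter_upwards [self_mem_nhdsWithin] with ε hε using key ε hε)
  exact sub_eq_zero.1 (norm_le_zero_iff.1 h0)

/-! ### Coercivity: frequencies near `|ξ| = k` -/

/-- The Fourier transform of a function supported in a set of diameter `L` is, up to a unimodular
factor, slowly varying on the scale `1 / L`, in the sense of `L²`. -/
theorem exists_unimodular_fourier_shift {Γ : Set (E d)} (hb : Bornology.IsBounded Γ)
    {x₀ : E d} (hx₀ : x₀ ∈ Γ) {f : E d → ℂ} (hf : Integrable f) (hf2 : MemLp f 2)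
    (hsupp : ∀ᵐ x, x ∉ Γ → f x = 0) (h : E d) :
    ∃ c : ℂ, ‖c‖ = 1 ∧ MemLp (fun η ↦ c * 𝓕 f (η + h) - 𝓕 f η) 2 ∧
      ∫ η, ‖c * 𝓕 f (η + h) - 𝓕 f η‖ ^ 2 ≤
        (2 * Real.pi * ‖h‖ * Metric.diam Γ) ^ 2 * ∫ x, ‖f x‖ ^ 2 := by
  have hp := Real.pi_pos
  -- The shift by `h` is a modulation of `f`. Centred at `x₀ ∈ Γ`, its phase is at most `2π ‖h‖ L`
  -- on `Γ`, and `|e^{is} - 1| ≤ |s|`.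
  set e : E d → ℂ := fun x ↦ Complex.exp ((-2 * Real.pi * inner ℝ (x - x₀) h : ℝ) * Complex.I)
    with he
  have hen : ∀ x, ‖e x‖ = 1 := fun x ↦ Complex.norm_exp_ofReal_mul_I _
  have hem : Measurable e := by fun_prop
  set F : E d → ℂ := fun x ↦ (e x - 1) * f x with hF
  have hbound : ∀ x, ‖F x‖ ≤ 2 * ‖f x‖ := by
    intro x
    rw [hF, norm_mul]
    refine mul_le_mul_of_nonneg_right ((norm_sub_le _ _).trans ?_) (norm_nonneg _)
    rw [hen, norm_one]; norm_num
  have hFm : AEStronglyMeasurable F volume :=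
    ((hem.sub_const 1).aestronglyMeasurable).mul hf.1
  have hFi : Integrable F := (hf.norm.const_mul 2).mono' hFm (Filter.Eventually.of_forall hbound)
  have hF2 : MemLp F 2 := hf2.of_le_mul hFm (Filter.Eventually.of_forall hbound)
  have hefi : Integrable fun x ↦ e x * f x :=
    hf.norm.mono' (hem.aestronglyMeasurable.mul hf.1) (Filter.Eventually.of_forall fun x ↦ by
      rw [norm_mul, hen, one_mul])
  set c : ℂ := Complex.exp ((2 * Real.pi * inner ℝ x₀ h : ℝ) * Complex.I) with hc
  have hFou : ∀ η, 𝓕 F η = c * 𝓕 f (η + h) - 𝓕 f η := by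
    intro η
    simp only [Real.fourier_eq']
    have hexp : ∀ x, c * Complex.exp ((-2 * Real.pi * inner ℝ x (η + h) : ℝ) * Complex.I) =
        Complex.exp ((-2 * Real.pi * inner ℝ x η : ℝ) * Complex.I) * e x := by
      intro x
      rw [hc, he, ← Complex.exp_add, ← Complex.exp_add, inner_add_right, inner_sub_left]
      congr 1
      push_cast
      ring
    have hi1 : Integrable fun x ↦ Complex.exp ((-2 * Real.pi * inner ℝ x η : ℝ) * Complex.I) •
        (e x * f x) := by
      refine hefi.norm.mono' ?_ (Filter.Eventually.of_forall fun x ↦ ?_)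
      · exact ((by fun_prop : Measurable fun x : E d ↦ Complex.exp
          ((-2 * Real.pi * inner ℝ x η : ℝ) * Complex.I)).aestronglyMeasurable).smul hefi.1
      · rw [norm_smul, Complex.norm_exp_ofReal_mul_I, one_mul]
    have hi2 : Integrable fun x ↦ Complex.exp ((-2 * Real.pi * inner ℝ x η : ℝ) * Complex.I) •
        f x := by
      refine hf.norm.mono' ?_ (Filter.Eventually.of_forall fun x ↦ ?_)
      · exact ((by fun_prop : Measurable fun x : E d ↦ Complex.exp
          ((-2 * Real.pi * inner ℝ x η : ℝ) * Complex.I)).aestronglyMeasurable).smul hf.1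
      · rw [norm_smul, Complex.norm_exp_ofReal_mul_I, one_mul]
    rw [← integral_const_mul, ← integral_sub ?_ hi2]
    · refine integral_congr_ae (Filter.Eventually.of_forall fun x ↦ ?_)
      simp only [hF, smul_eq_mul]
      linear_combination -f x * hexp x
    · refine hi1.congr (Filter.Eventually.of_forall fun x ↦ ?_)
      simp only [smul_eq_mul]
      linear_combination -f x * hexp x
  have hPl := memLp_fourier hFi hF2
  have hfun : (fun η ↦ c * 𝓕 f (η + h) - 𝓕 f η) = 𝓕 F := funext fun η ↦ (hFou η).symm
  refine ⟨c, Complex.norm_exp_ofReal_mul_I _, hfun ▸ hPl.1, ?_⟩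
  simp_rw [← hFou]
  rw [integral_norm_sq_eq_of_eLpNorm_eq hPl.1 hF2 hPl.2, ← integral_const_mul]
  refine integral_mono_ae (hF2.integrable_norm_pow (by norm_num))
    ((hf2.integrable_norm_pow (by norm_num)).const_mul _) ?_
  filter_upwards [hsupp] with x hx
  by_cases hxΓ : x ∈ Γ
  · simp only [hF]
    rw [norm_mul, mul_pow]
    refine mul_le_mul_of_nonneg_right ?_ (by positivity)
    refine pow_le_pow_left₀ (norm_nonneg _) ?_ 2
    have h1 : ‖e x - 1‖ ≤ ‖(-2 * Real.pi * inner ℝ (x - x₀) h : ℝ)‖ := by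
      rw [he]
      simp only
      rw [mul_comm _ Complex.I]
      exact Real.norm_exp_I_mul_ofReal_sub_one_le
    refine h1.trans ?_
    rw [norm_mul, norm_mul, norm_neg, Real.norm_of_nonneg (by norm_num : (0 : ℝ) ≤ 2),
      Real.norm_of_nonneg hp.le]
    have h2 := norm_inner_le_norm (𝕜 := ℝ) (x - x₀) h
    have h3 : ‖x - x₀‖ ≤ Metric.diam Γ := by
      rw [← dist_eq_norm]; exact Metric.dist_le_diam_of_mem hb hxΓ hx₀
    calc 2 * Real.pi * ‖inner ℝ (x - x₀) h‖ ≤ 2 * Real.pi * (‖x - x₀‖ * ‖h‖) := by gcongr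
      _ ≤ 2 * Real.pi * (Metric.diam Γ * ‖h‖) := by gcongr
      _ = _ := by ring
  · simp only [hF]
    rw [hx hxΓ]
    simp

/-- If finitely many translations move every point of `A` out of `A`, then the energy of the
Fourier transform in `A` is controlled by its energy outside `A`. -/
theorem setIntegral_fourier_le_of_shift {Γ : Set (E d)} (hb : Bornology.IsBounded Γ)
    {x₀ : E d} (hx₀ : x₀ ∈ Γ) {f : E d → ℂ} (hf : Integrable f) (hf2 : MemLp f 2)
    (hsupp : ∀ᵐ x, x ∉ Γ → f x = 0) {A : Set (E d)} (hA : MeasurableSet A) {ι : Type*} [Fintype ι]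
    (h : ι → E d) {H : ℝ} (hH : ∀ j, ‖h j‖ ≤ H) (hout : ∀ η ∈ A, ∃ j, η + h j ∉ A) :
    ∫ η in A, ‖𝓕 f η‖ ^ 2 ≤ Fintype.card ι * (2 * (∫ η in Aᶜ, ‖𝓕 f η‖ ^ 2) +
      2 * ((2 * Real.pi * H * Metric.diam Γ) ^ 2 * ∫ x, ‖f x‖ ^ 2)) := by
  have hp := Real.pi_pos
  set g := 𝓕 f with hg
  have hg2 : Integrable fun η ↦ ‖g η‖ ^ 2 :=
    (memLp_fourier hf hf2).1.integrable_norm_pow (by norm_num)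
  choose c hc1 hcm hcle using
    fun j ↦ exists_unimodular_fourier_shift hb hx₀ hf hf2 hsupp (h j)
  have hI1 : ∀ j, Integrable fun η ↦ Aᶜ.indicator (fun η ↦ ‖g η‖ ^ 2) (η + h j) := fun j ↦
    (hg2.indicator hA.compl).comp_add_right (h j)
  have hI2 : ∀ j, Integrable fun η ↦ ‖c j * g (η + h j) - g η‖ ^ 2 := fun j ↦
    (hcm j).integrable_norm_pow (by norm_num)
  have hpt : ∀ η, A.indicator (fun η ↦ ‖g η‖ ^ 2) η ≤
      ∑ j, (2 * Aᶜ.indicator (fun η ↦ ‖g η‖ ^ 2) (η + h j) +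
        2 * ‖c j * g (η + h j) - g η‖ ^ 2) := by
    intro η
    have hnn : ∀ j ∈ Finset.univ, 0 ≤ 2 * Aᶜ.indicator (fun η ↦ ‖g η‖ ^ 2) (η + h j) +
        2 * ‖c j * g (η + h j) - g η‖ ^ 2 := fun j _ ↦ by
      have : 0 ≤ Aᶜ.indicator (fun η ↦ ‖g η‖ ^ 2) (η + h j) :=
        Set.indicator_nonneg (fun _ _ ↦ by positivity) _
      positivity
    by_cases hη : η ∈ A
    · obtain ⟨j, hj⟩ := hout η hη
      refine le_trans ?_ (Finset.single_le_sum hnn (Finset.mem_univ j))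
      rw [Set.indicator_of_mem hη, Set.indicator_of_mem (Set.mem_compl hj)]
      have h1 : ‖g η‖ ≤ ‖g (η + h j)‖ + ‖c j * g (η + h j) - g η‖ := by
        have := norm_sub_le (c j * g (η + h j)) (c j * g (η + h j) - g η)
        rwa [sub_sub_cancel, norm_mul, hc1, one_mul] at this
      nlinarith [norm_nonneg (g η), sq_nonneg (‖g (η + h j)‖ - ‖c j * g (η + h j) - g η‖),
        pow_le_pow_left₀ (norm_nonneg (g η)) h1 2]
    · rw [Set.indicator_of_notMem hη]
      exact Finset.sum_nonneg hnn
  rw [← integral_indicator hA]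
  refine (integral_mono (hg2.indicator hA) (integrable_finsetSum _ fun j _ ↦
    ((hI1 j).const_mul 2).add ((hI2 j).const_mul 2)) hpt).trans ?_
  rw [integral_finsetSum _ fun j _ ↦ ((hI1 j).const_mul 2).add ((hI2 j).const_mul 2)]
  refine (Finset.sum_le_card_nsmul _ _ _ fun j _ ↦ ?_).trans (le_of_eq (nsmul_eq_mul _ _))
  rw [integral_add' ((hI1 j).const_mul 2) ((hI2 j).const_mul 2), integral_const_mul,
    integral_const_mul, integral_add_right_eq_self (Aᶜ.indicator fun η ↦ ‖g η‖ ^ 2) (h j),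
    integral_indicator hA.compl]
  have h1 : (2 * Real.pi * ‖h j‖ * Metric.diam Γ) ^ 2 ≤
      (2 * Real.pi * H * Metric.diam Γ) ^ 2 := by
    have := hH j
    have := Metric.diam_nonneg (s := Γ)
    gcongr
  have h2 : 0 ≤ ∫ x, ‖f x‖ ^ 2 := integral_nonneg fun x ↦ by positivity
  have h3 := (hcle j).trans (mul_le_mul_of_nonneg_right h1 h2)
  linarith

/-- In dimension at most two, moving a point along one of the coordinate axes, away from the origin,
increases its norm by at least half the length of the step. -/
theorem exists_norm_add_single_ge (hd : d = 1 ∨ d = 2) (η : E d) {c : ℝ} (hc : 0 ≤ c) :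
    ∃ j : Fin d × Bool, ‖η‖ + c / 2 ≤
      ‖η + EuclideanSpace.single j.1 (if j.2 then c else -c)‖ := by
  obtain ⟨i, hi⟩ : ∃ i, ‖η‖ ^ 2 ≤ 2 * η i ^ 2 := by
    rw [EuclideanSpace.norm_sq_eq]
    rcases hd with rfl | rfl
    · refine ⟨0, ?_⟩
      simp only [Fin.sum_univ_one, Real.norm_eq_abs, sq_abs]
      nlinarith [sq_nonneg (η 0)]
    · simp only [Fin.sum_univ_two, Real.norm_eq_abs, sq_abs]
      rcases le_total (η 0 ^ 2) (η 1 ^ 2) with h | h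
      · exact ⟨1, by linarith⟩
      · exact ⟨0, by linarith⟩
  have hi' : ‖η‖ ≤ 2 * |η i| := by
    refine abs_le_of_sq_le_sq' ?_ (by positivity) |>.2
    rw [mul_pow, sq_abs]
    nlinarith [sq_nonneg (η i)]
  refine ⟨(i, decide (0 ≤ η i)), ?_⟩
  set a : ℝ := if decide (0 ≤ η i) = true then c else -c with ha
  have haη : η i * a = c * |η i| := by
    rcases le_or_gt 0 (η i) with h | h
    · rw [ha, if_pos (by simpa using h), abs_of_nonneg h, mul_comm]
    · rw [ha, if_neg (by simpa using h), abs_of_neg h]; ring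
  have ha2 : a ^ 2 = c ^ 2 := by
    rw [ha]; split_ifs <;> ring
  refine abs_le_of_sq_le_sq' ?_ (norm_nonneg _) |>.2
  have h1 : ‖η + EuclideanSpace.single i a‖ ^ 2 = ‖η‖ ^ 2 + 2 * (c * |η i|) + c ^ 2 := by
    rw [norm_add_sq_real, EuclideanSpace.inner_single_right, PiLp.norm_single,
      Real.norm_eq_abs, sq_abs, ha2]
    simp only [conj_trivial]
    rw [← haη, mul_comm a]
  rw [h1]
  nlinarith [mul_le_mul_of_nonneg_left hi' hc]

/-- The weight `√|k² - |ξ|²|`, the sum of the real and imaginary parts of the vertical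
wavenumber. -/
def verticalWeight (k : ℝ) (η : E d) : ℝ :=
  √(k ^ 2 - (2 * Real.pi * ‖η‖) ^ 2) + √((2 * Real.pi * ‖η‖) ^ 2 - k ^ 2)

theorem verticalWeight_eq (k : ℝ) (η : E d) :
    verticalWeight k η = √|k ^ 2 - (2 * Real.pi * ‖η‖) ^ 2| := by
  rw [verticalWeight]
  rcases le_total (k ^ 2) ((2 * Real.pi * ‖η‖) ^ 2) with h | h
  · rw [Real.sqrt_eq_zero_of_nonpos (sub_nonpos.2 h), abs_of_nonpos (sub_nonpos.2 h), neg_sub,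
      zero_add]
  · rw [Real.sqrt_eq_zero_of_nonpos (sub_nonpos.2 h), abs_of_nonneg (sub_nonneg.2 h), add_zero]

theorem verticalWeight_le (k : ℝ) (η : E d) :
    verticalWeight k η ≤ (k ^ 2 + (2 * Real.pi * ‖η‖) ^ 2) ^ (1 / 2 : ℝ) := by
  rw [verticalWeight_eq, ← Real.sqrt_eq_rpow]
  refine Real.sqrt_le_sqrt (abs_le.2 ⟨?_, ?_⟩) <;>
    nlinarith [sq_nonneg k, sq_nonneg (2 * Real.pi * ‖η‖)]

/-- A fixed proportion of the energy of the Fourier transform of a function supported in `Γ` is at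
frequencies with `||ξ| - k| ≥ 1 / (16 L)`, where `L` is the diameter of `Γ`: shifts of length
`1 / (4 L)` move every point of the annulus out of it, and change the transform little. -/
theorem integral_norm_sq_le_setIntegral_compl_annulus (hd : d = 1 ∨ d = 2) {Γ : Set (E d)}
    (hb : Bornology.IsBounded Γ) {x₀ : E d} (hx₀ : x₀ ∈ Γ) (hL : 0 < Metric.diam Γ) {f : E d → ℂ}
    (hf : Integrable f) (hf2 : MemLp f 2) (hsupp : ∀ᵐ x, x ∉ Γ → f x = 0) (k : ℝ) :
    ∫ η, ‖𝓕 f η‖ ^ 2 ≤ 18 * ∫ η in {η : E d | |2 * Real.pi * ‖η‖ - k| <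
      1 / (16 * Metric.diam Γ)}ᶜ, ‖𝓕 f η‖ ^ 2 := by
  have hp := Real.pi_pos
  set L := Metric.diam Γ
  set A : Set (E d) := {η : E d | |2 * Real.pi * ‖η‖ - k| < 1 / (16 * L)} with hAdef
  have hA : MeasurableSet A := measurableSet_lt (by fun_prop) measurable_const
  -- A shift of length `1 / (4 L)` in `ξ` along a suitable coordinate direction raises `|ξ|` by
  -- at least `1 / (8 L)`, the width of the annulus.
  set H : ℝ := 1 / (4 * L) / (2 * Real.pi) with hH
  have hH0 : 0 ≤ H := by positivity
  have h1 := setIntegral_fourier_le_of_shift hb hx₀ hf hf2 hsupp hA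
    (fun j : Fin d × Bool ↦ EuclideanSpace.single j.1 (if j.2 then H else -H)) (H := H)
    (fun j ↦ ?_) fun η hη ↦ ?_
  · have hg2 : Integrable fun η ↦ ‖𝓕 f η‖ ^ 2 :=
      (memLp_fourier hf hf2).1.integrable_norm_pow (by norm_num)
    have h2 := integral_add_compl hA hg2
    have h3 := integral_norm_sq_eq_of_eLpNorm_eq (memLp_fourier hf hf2).1 hf2
      (memLp_fourier hf hf2).2
    have h4 : 2 * Real.pi * H * L = 1 / 4 := by
      rw [hH]; field_simp
    have hcard : (Fintype.card (Fin d × Bool) : ℝ) ≤ 4 := by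
      rcases hd with rfl | rfl <;> norm_num [Fintype.card_prod]
    rw [h4, ← h3] at h1
    have h5 : 0 ≤ ∫ η in Aᶜ, ‖𝓕 f η‖ ^ 2 := integral_nonneg fun η ↦ by positivity
    have h6 : 0 ≤ ∫ η, ‖𝓕 f η‖ ^ 2 := integral_nonneg fun η ↦ by positivity
    have h7 := h1.trans (mul_le_mul_of_nonneg_right hcard (by positivity))
    -- With total energy `e` and energy `x` outside the annulus, `e ≤ 9 x + e / 2`.
    linarith
  · rw [PiLp.norm_single]
    split_ifs
    · rw [Real.norm_of_nonneg hH0]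
    · rw [norm_neg, Real.norm_of_nonneg hH0]
  · obtain ⟨j, hj⟩ := exists_norm_add_single_ge hd η hH0
    refine ⟨j, fun hmem ↦ ?_⟩
    have hη' : |2 * Real.pi * ‖η‖ - k| < 1 / (16 * L) := hη
    have hmem' : |2 * Real.pi * ‖η + EuclideanSpace.single j.1 (if j.2 then H else -H)‖ - k| <
        1 / (16 * L) := hmem
    have h2 := (abs_lt.1 hη').1
    have h3 := (abs_lt.1 hmem').2
    have h4 : 2 * Real.pi * ‖η‖ + 1 / (8 * L) ≤
        2 * Real.pi * ‖η + EuclideanSpace.single j.1 (if j.2 then H else -H)‖ := by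
      have := mul_le_mul_of_nonneg_left hj (by positivity : 0 ≤ 2 * Real.pi)
      refine le_trans (le_of_eq ?_) this
      rw [hH]
      field_simp
      ring
    have h5 : 1 / (8 * L) = 2 * (1 / (16 * L)) := by field_simp; norm_num
    linarith

/-- The weight `√|k² - |ξ|²|` degenerates only at `|ξ| = k`, where `φ̂` cannot concentrate: so the
weighted energy controls the norm of `H^{1/2}_k`, with a loss `(kL)^{1/2}`. -/
theorem sobolev_energy_le_verticalWeight_energy (hd : d = 1 ∨ d = 2) {Γ : Set (E d)}
    (hb : Bornology.IsBounded Γ) {x₀ : E d} (hx₀ : x₀ ∈ Γ) {f : E d → ℂ}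
    (hf : Integrable f) (hf2 : MemLp f 2) (hsupp : ∀ᵐ x, x ∉ Γ → f x = 0) {k k₀ : ℝ} (hk : 0 < k)
    (hk₀ : 0 < k₀) (hkL : k₀ ≤ k * Metric.diam Γ)
    (hint : Integrable fun η ↦ (k ^ 2 + (2 * Real.pi * ‖η‖) ^ 2) ^ (1 / 2 : ℝ) * ‖𝓕 f η‖ ^ 2) :
    ∫ η, (k ^ 2 + (2 * Real.pi * ‖η‖) ^ 2) ^ (1 / 2 : ℝ) * ‖𝓕 f η‖ ^ 2 ≤
      (216 + 2 / √k₀) * √(k * Metric.diam Γ) * ∫ η, verticalWeight k η * ‖𝓕 f η‖ ^ 2 := by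
  have hp := Real.pi_pos
  set L := Metric.diam Γ with hLdef
  have hL : 0 < L := by
    by_contra h
    nlinarith [not_lt.1 h]
  set δ : ℝ := 1 / (16 * L) with hδ
  have hδ0 : 0 < δ := by positivity
  have hg2 : Integrable fun η ↦ ‖𝓕 f η‖ ^ 2 :=
    (memLp_fourier hf hf2).1.integrable_norm_pow (by norm_num)
  have hW : Integrable fun η ↦ verticalWeight k η * ‖𝓕 f η‖ ^ 2 := by
    refine hint.mono' ?_ (Filter.Eventually.of_forall fun η ↦ ?_)
    · exact ((by unfold verticalWeight; fun_prop :
        Measurable (verticalWeight k)).aestronglyMeasurable).mul hg2.1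
    · have h0 : 0 ≤ verticalWeight k η := by unfold verticalWeight; positivity
      rw [Real.norm_of_nonneg (by positivity)]
      exact mul_le_mul_of_nonneg_right (verticalWeight_le k η) (by positivity)
  set A : Set (E d) := {η : E d | |2 * Real.pi * ‖η‖ - k| < δ}
  have hA : MeasurableSet A := measurableSet_lt (by fun_prop) measurable_const
  set W := ∫ η, verticalWeight k η * ‖𝓕 f η‖ ^ 2 with hWdef
  have hW0 : 0 ≤ W := integral_nonneg fun η ↦ by unfold verticalWeight; positivity
  -- Outside the annulus the weight is at least `√(δ k)`.
  have hcompl : √(δ * k) * ∫ η in Aᶜ, ‖𝓕 f η‖ ^ 2 ≤ W := by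
    rw [← integral_const_mul]
    refine (setIntegral_mono_on (hg2.integrableOn.const_mul _) hW.integrableOn hA.compl
      fun η hη ↦ ?_).trans (setIntegral_le_integral hW (Filter.Eventually.of_forall fun η ↦ ?_))
    · refine mul_le_mul_of_nonneg_right ?_ (by positivity)
      rw [verticalWeight_eq]
      refine Real.sqrt_le_sqrt ?_
      have h1 : δ ≤ |2 * Real.pi * ‖η‖ - k| := not_lt.1 hη
      have h2 : k ≤ |2 * Real.pi * ‖η‖ + k| := by
        rw [abs_of_nonneg (by positivity)]
        have : 0 ≤ 2 * Real.pi * ‖η‖ := by positivity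
        linarith
      calc δ * k ≤ |2 * Real.pi * ‖η‖ - k| * |2 * Real.pi * ‖η‖ + k| := by gcongr
        _ = |k ^ 2 - (2 * Real.pi * ‖η‖) ^ 2| := by
          rw [← abs_mul, abs_sub_comm (k ^ 2)]
          congr 1
          ring
    · simp only [Pi.zero_apply]
      unfold verticalWeight
      positivity
  -- For `|ξ| ≤ 2k` the left weight is at most `3k`, otherwise at most twice the right weight.
  have hpt : ∀ η : E d, (k ^ 2 + (2 * Real.pi * ‖η‖) ^ 2) ^ (1 / 2 : ℝ) * ‖𝓕 f η‖ ^ 2 ≤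
      2 * (verticalWeight k η * ‖𝓕 f η‖ ^ 2) + 3 * k * ‖𝓕 f η‖ ^ 2 := by
    intro η
    rw [← mul_assoc, ← add_mul]
    refine mul_le_mul_of_nonneg_right ?_ (by positivity)
    rw [← Real.sqrt_eq_rpow, verticalWeight_eq]
    set r := 2 * Real.pi * ‖η‖
    have hr : 0 ≤ r := by positivity
    rcases le_total r (2 * k) with h | h
    · have h1 : √(k ^ 2 + r ^ 2) ≤ 3 * k := by
        rw [Real.sqrt_le_left (by positivity)]
        nlinarith
      have := Real.sqrt_nonneg |k ^ 2 - r ^ 2|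
      linarith
    · have h1 : √(k ^ 2 + r ^ 2) ≤ √(2 ^ 2 * |k ^ 2 - r ^ 2|) := by
        refine Real.sqrt_le_sqrt ?_
        have h2 := neg_abs_le (k ^ 2 - r ^ 2)
        nlinarith
      rw [Real.sqrt_mul (by norm_num), Real.sqrt_sq (by norm_num)] at h1
      linarith [mul_pos three_pos hk]
  have h1 := integral_mono hint ((hW.const_mul 2).add (hg2.const_mul (3 * k))) hpt
  rw [integral_add' (hW.const_mul 2) (hg2.const_mul _), integral_const_mul, integral_const_mul,
    ← hWdef] at h1
  have h2 := integral_norm_sq_le_setIntegral_compl_annulus hd hb hx₀ hL hf hf2 hsupp k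
  set X := ∫ η in Aᶜ, ‖𝓕 f η‖ ^ 2
  have h3 : k * X ≤ 4 * √(k * L) * W := by
    have h4 : 4 * √(k * L) * √(δ * k) = k := by
      rw [mul_assoc, ← Real.sqrt_mul (by positivity), show k * L * (δ * k) = (k / 4) ^ 2 by
        rw [hδ]; field_simp; norm_num, Real.sqrt_sq (by positivity)]
      ring
    calc k * X = 4 * √(k * L) * (√(δ * k) * X) := by rw [← mul_assoc, h4]
      _ ≤ _ := mul_le_mul_of_nonneg_left hcompl (by positivity)
  have h5 : 1 ≤ √(k * L) / √k₀ := by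
    rw [le_div_iff₀ (Real.sqrt_pos.2 hk₀), one_mul]
    exact Real.sqrt_le_sqrt hkL
  calc _ ≤ 2 * W + 3 * k * (18 * X) := by
        refine h1.trans ?_
        gcongr
    _ = 2 * 1 * W + 54 * (k * X) := by ring
    _ ≤ 2 * (√(k * L) / √k₀) * W + 54 * (4 * √(k * L) * W) := by gcongr
    _ = _ := by ring

/-- The real and imaginary parts of `Z` are non-negative, so there is no cancellation in the
integral: `|x + iy| ≥ (x + y) / 2` for `x, y ≥ 0`. -/
theorem norm_integral_verticalWavenumber_ge {k : ℝ} {g : E d → ℂ}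
    (hW : Integrable fun η ↦ verticalWeight k η * ‖g η‖ ^ 2) (hg : AEStronglyMeasurable g volume) :
    ∫ η, verticalWeight k η * ‖g η‖ ^ 2 ≤
      4 * ‖∫ η, Complex.I / 2 * verticalWavenumber k η * g η * conj (g η)‖ := by
  set a : E d → ℝ := fun η ↦ √(k ^ 2 - (2 * Real.pi * ‖η‖) ^ 2) with ha
  set b : E d → ℝ := fun η ↦ √((2 * Real.pi * ‖η‖) ^ 2 - k ^ 2) with hb
  have ham : Measurable a := by fun_prop
  have hbm : Measurable b := by fun_prop
  have hai : Integrable fun η ↦ a η * ‖g η‖ ^ 2 := by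
    refine hW.mono' (ham.aestronglyMeasurable.mul (hg.norm.pow 2))
      (Filter.Eventually.of_forall fun η ↦ ?_)
    have h1 : 0 ≤ a η := Real.sqrt_nonneg _
    have h2 : 0 ≤ b η := Real.sqrt_nonneg _
    rw [Real.norm_of_nonneg (by positivity)]
    exact mul_le_mul_of_nonneg_right (le_add_of_nonneg_right h2) (by positivity)
  have hbi : Integrable fun η ↦ b η * ‖g η‖ ^ 2 := by
    refine hW.mono' (hbm.aestronglyMeasurable.mul (hg.norm.pow 2))
      (Filter.Eventually.of_forall fun η ↦ ?_)
    have h1 : 0 ≤ a η := Real.sqrt_nonneg _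
    have h2 : 0 ≤ b η := Real.sqrt_nonneg _
    rw [Real.norm_of_nonneg (by positivity)]
    exact mul_le_mul_of_nonneg_right (le_add_of_nonneg_left h1) (by positivity)
  have h1 : ∫ η, Complex.I / 2 * verticalWavenumber k η * g η * conj (g η) =
      Complex.I / 2 * (((∫ η, a η * ‖g η‖ ^ 2 : ℝ) : ℂ) +
        Complex.I * ((∫ η, b η * ‖g η‖ ^ 2 : ℝ) : ℂ)) := by
    rw [← integral_complex_ofReal, ← integral_complex_ofReal, ← integral_const_mul,
      ← integral_add hai.ofReal (hbi.ofReal.const_mul _), ← integral_const_mul]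
    refine integral_congr_ae (Filter.Eventually.of_forall fun η ↦ ?_)
    simp only
    rw [mul_assoc _ (g η), Complex.mul_conj, Complex.normSq_eq_norm_sq, verticalWavenumber]
    push_cast
    ring
  have h2 : ∫ η, verticalWeight k η * ‖g η‖ ^ 2 =
      (∫ η, a η * ‖g η‖ ^ 2) + ∫ η, b η * ‖g η‖ ^ 2 := by
    rw [← integral_add hai hbi]
    refine integral_congr_ae (Filter.Eventually.of_forall fun η ↦ ?_)
    simp only [verticalWeight]
    ring
  rw [h1, h2, norm_mul]
  set x := ∫ η, a η * ‖g η‖ ^ 2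
  set y := ∫ η, b η * ‖g η‖ ^ 2
  have h3 := Complex.abs_re_le_norm ((x : ℂ) + Complex.I * y)
  have h4 := Complex.abs_im_le_norm ((x : ℂ) + Complex.I * y)
  simp only [Complex.add_re, Complex.ofReal_re, Complex.mul_re, Complex.I_re, zero_mul,
    Complex.I_im, Complex.ofReal_im, mul_zero, sub_zero, add_zero, Complex.add_im, Complex.mul_im,
    one_mul, zero_add] at h3 h4
  have h5 : ‖Complex.I / 2‖ = 1 / 2 := by
    rw [norm_div, Complex.norm_I, Complex.norm_ofNat]
  rw [h5]
  linarith [le_abs_self x, le_abs_self y]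

/-! ### The double layer potential as a superposition of plane waves -/

/-- The complex wave vector `(2πiη, iZ(η))` of the plane wave with horizontal frequency `η` that
solves the Helmholtz equation and is outgoing in the direction of the last coordinate. -/
def waveVector (k : ℝ) (η : E d) : Fin (d + 1) → ℂ :=
  Fin.snoc (α := fun _ ↦ ℂ) (fun i ↦ 2 * Real.pi * Complex.I * η i)
    (Complex.I * verticalWavenumber k η)

@[simp] theorem waveVector_castSucc (k : ℝ) (η : E d) (i : Fin d) :
    waveVector k η i.castSucc = 2 * Real.pi * Complex.I * η i := by
  simp [waveVector]

@[simp] theorem waveVector_last (k : ℝ) (η : E d) :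
    waveVector k η (Fin.last d) = Complex.I * verticalWavenumber k η := by
  simp [waveVector]

/-- The plane wave `X ↦ exp (waveVector k η · X)`. -/
def planeWave (k : ℝ) (η : E d) (X : E (d + 1)) : ℂ :=
  Complex.exp (∑ i, waveVector k η i * (X i : ℂ))

theorem measurable_verticalWavenumber (k : ℝ) :
    Measurable fun η : E d ↦ verticalWavenumber k η := by
  unfold verticalWavenumber; fun_prop

theorem verticalWavenumber_sq (k : ℝ) (η : E d) :
    verticalWavenumber k η ^ 2 = (k ^ 2 - (2 * Real.pi * ‖η‖) ^ 2 : ℝ) := by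
  rw [verticalWavenumber]
  set a := k ^ 2 - (2 * Real.pi * ‖η‖) ^ 2
  have hb : (2 * Real.pi * ‖η‖) ^ 2 - k ^ 2 = -a := by simp [a]
  rw [hb]
  rcases le_total 0 a with h | h
  · rw [Real.sqrt_eq_zero_of_nonpos (neg_nonpos.2 h)]
    simp [← Complex.ofReal_pow, Real.sq_sqrt h]
  · rw [Real.sqrt_eq_zero_of_nonpos h]
    simp [mul_pow, ← Complex.ofReal_pow, Real.sq_sqrt (neg_nonneg.2 h)]

theorem norm_verticalWavenumber_sq (k : ℝ) (η : E d) :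
    ‖verticalWavenumber k η‖ ^ 2 ≤ k ^ 2 + (2 * Real.pi * ‖η‖) ^ 2 := by
  rw [← norm_pow, verticalWavenumber_sq, Complex.norm_real, Real.norm_eq_abs, abs_le]
  constructor <;> nlinarith [sq_nonneg k, sq_nonneg (2 * Real.pi * ‖η‖)]

theorem norm_verticalWavenumber_le {k : ℝ} (hk : 0 ≤ k) (η : E d) :
    ‖verticalWavenumber k η‖ ≤ (k + 2 * Real.pi) * (1 + ‖η‖) := by
  have hp := Real.pi_pos
  have hn := norm_nonneg η
  have h1 : ‖verticalWavenumber k η‖ ≤ k + 2 * Real.pi * ‖η‖ := by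
    refine abs_le_of_sq_le_sq' ?_ (by positivity) |>.2
    refine (norm_verticalWavenumber_sq k η).trans ?_
    nlinarith [mul_nonneg hk (mul_nonneg hp.le hn)]
  nlinarith [mul_nonneg hk hn]

theorem norm_waveVector_le {k : ℝ} (hk : 0 ≤ k) (η : E d) (i : Fin (d + 1)) :
    ‖waveVector k η i‖ ≤ (k + 2 * Real.pi) * (1 + ‖η‖) := by
  have hp := Real.pi_pos
  have hn := norm_nonneg η
  induction i using Fin.lastCases with
  | last => simpa using norm_verticalWavenumber_le hk η
  | cast i =>
    have h := PiLp.norm_apply_le η i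
    have h2 : ‖waveVector k η i.castSucc‖ = 2 * Real.pi * ‖η i‖ := by
      simp [abs_of_pos hp]
    rw [h2]
    nlinarith [mul_nonneg hk hn, mul_le_mul_of_nonneg_left h hp.le]

theorem measurable_waveVector (k : ℝ) (i : Fin (d + 1)) :
    Measurable fun η : E d ↦ waveVector k η i := by
  induction i using Fin.lastCases with
  | last => simpa using (measurable_verticalWavenumber k).const_mul _
  | cast i => simp only [waveVector_castSucc]; fun_prop

theorem sum_waveVector_sq (k : ℝ) (η : E d) :
    ∑ i, waveVector k η i * waveVector k η i = -(k : ℂ) ^ 2 := by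
  rw [Fin.sum_univ_castSucc]
  simp only [waveVector_castSucc, waveVector_last]
  have h1 : Complex.I * verticalWavenumber k η * (Complex.I * verticalWavenumber k η) =
      -(verticalWavenumber k η ^ 2) := by
    linear_combination (verticalWavenumber k η ^ 2) * Complex.I_sq
  have h2 : ∀ i, 2 * Real.pi * Complex.I * (η i : ℂ) * (2 * Real.pi * Complex.I * (η i : ℂ)) =
      -(((2 * Real.pi) ^ 2 * ‖η i‖ ^ 2 : ℝ) : ℂ) := by
    intro i
    rw [Real.norm_eq_abs, sq_abs]
    push_cast
    linear_combination (4 * (Real.pi : ℂ) ^ 2 * (η i : ℂ) ^ 2) * Complex.I_sq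
  rw [h1, verticalWavenumber_sq, mul_pow, EuclideanSpace.norm_sq_eq η, Finset.mul_sum]
  simp only [h2]
  push_cast
  rw [Finset.sum_neg_distrib]
  ring

theorem planeWave_point (k : ℝ) (η x : E d) (t : ℝ) :
    planeWave k η (point x t) = Complex.exp (Complex.I * t * verticalWavenumber k η) *
      Complex.exp (2 * Real.pi * Complex.I * (inner ℝ x η : ℝ)) := by
  rw [planeWave, ← Complex.exp_add, Fin.sum_univ_castSucc, add_comm]
  congr 1
  congr 1
  · simp [point]; ring
  · rw [PiLp.inner_apply]
    push_cast
    rw [Finset.mul_sum]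
    refine Finset.sum_congr rfl fun i _ ↦ ?_
    simp [point]; ring

theorem norm_exp_verticalWavenumber_le {k t : ℝ} (hk : 0 ≤ k) (ht : 0 ≤ t) (η : E d) :
    ‖Complex.exp (Complex.I * t * verticalWavenumber k η)‖ ≤
      Real.exp (t * (k - 2 * Real.pi * ‖η‖)) := by
  have hp := Real.pi_pos
  rw [Complex.norm_exp]
  refine Real.exp_le_exp.2 ?_
  have h1 : (Complex.I * t * verticalWavenumber k η).re =
      -(t * √((2 * Real.pi * ‖η‖) ^ 2 - k ^ 2)) := by
    simp [verticalWavenumber]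
  have h2 : 2 * Real.pi * ‖η‖ - k ≤ √((2 * Real.pi * ‖η‖) ^ 2 - k ^ 2) := by
    rcases le_total (2 * Real.pi * ‖η‖) k with h | h
    · exact (sub_nonpos.2 h).trans (Real.sqrt_nonneg _)
    · refine Real.le_sqrt_of_sq_le ?_
      nlinarith [mul_nonneg hk (sub_nonneg.2 h)]
  rw [h1]
  nlinarith [mul_le_mul_of_nonneg_left h2 ht]

/-- The decomposition of a point into horizontal and vertical coordinates. -/
theorem exists_eq_point (X : E (d + 1)) :
    ∃ x : E d, X = point x (X (Fin.last d)) := by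
  refine ⟨WithLp.toLp 2 fun i ↦ X i.castSucc, ?_⟩
  ext i
  induction i using Fin.lastCases with
  | last => simp [point]
  | cast i => simp [point]

theorem norm_planeWave_le {k : ℝ} (hk : 0 ≤ k) (η : E d) {X : E (d + 1)} (hX : 0 ≤ X (Fin.last d)) :
    ‖planeWave k η X‖ ≤ Real.exp (X (Fin.last d) * (k - 2 * Real.pi * ‖η‖)) := by
  obtain ⟨x, hx⟩ := exists_eq_point X
  rw [hx, planeWave_point, norm_mul, norm_exp_inner, mul_one, ← hx]
  exact norm_exp_verticalWavenumber_le hk hX η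

theorem measurable_planeWave (k : ℝ) :
    Measurable fun p : E (d + 1) × E d ↦ planeWave k p.2 p.1 := by
  unfold planeWave
  refine Complex.measurable_exp.comp (Finset.measurable_sum _ fun i _ ↦ ?_)
  exact ((measurable_waveVector k i).comp measurable_snd).mul (by fun_prop)

/-- The amplitudes `a` for which the superposition `∫ planeWave k η X * a η dη` of plane waves
converges absolutely in the open half-space, together with all its derivatives. -/
def IsAmplitude (a : E d → ℂ) : Prop :=
  AEStronglyMeasurable a ∧ ∀ τ > 0, Integrable fun η ↦ Real.exp (-(τ * ‖η‖)) * ‖a η‖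

theorem IsAmplitude.mul_of_norm_le {a b : E d → ℂ} (ha : IsAmplitude a)
    (hb : AEStronglyMeasurable b) {C : ℝ} (hC : ∀ η, ‖b η‖ ≤ C * (1 + ‖η‖)) :
    IsAmplitude fun η ↦ b η * a η := by
  refine ⟨hb.mul ha.1, fun τ hτ ↦ ?_⟩
  have hC0 : 0 ≤ C := by simpa using (norm_nonneg _).trans (hC 0)
  refine ((ha.2 (τ / 2) (by positivity)).const_mul (C * (1 + 2 / τ))).mono'
    ((by fun_prop : Continuous fun η : E d ↦ Real.exp (-(τ * ‖η‖))).aestronglyMeasurable.mul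
      (hb.mul ha.1).norm) (Filter.Eventually.of_forall fun η ↦ ?_)
  have hn := norm_nonneg η
  rw [norm_mul, Real.norm_eq_abs, abs_of_pos (Real.exp_pos _), norm_norm, norm_mul]
  have h1 : 1 + ‖η‖ ≤ (1 + 2 / τ) * Real.exp (τ / 2 * ‖η‖) := by
    have h2 := Real.add_one_le_exp (τ / 2 * ‖η‖)
    have h3 : ‖η‖ = 2 / τ * (τ / 2 * ‖η‖) := by field_simp
    have h4 : 0 ≤ 2 / τ := by positivity
    have h5 : 1 ≤ Real.exp (τ / 2 * ‖η‖) := Real.one_le_exp (by positivity)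
    nlinarith [mul_le_mul_of_nonneg_left h2 h4]
  have h6 : Real.exp (-(τ * ‖η‖)) * Real.exp (τ / 2 * ‖η‖) = Real.exp (-(τ / 2 * ‖η‖)) := by
    rw [← Real.exp_add]; ring_nf
  calc Real.exp (-(τ * ‖η‖)) * (‖b η‖ * ‖a η‖)
      ≤ Real.exp (-(τ * ‖η‖)) * (C * ((1 + 2 / τ) * Real.exp (τ / 2 * ‖η‖)) * ‖a η‖) := by
        gcongr
        exact (hC η).trans (mul_le_mul_of_nonneg_left h1 hC0)
    _ = _ := by rw [← h6]; ring

theorem IsAmplitude.waveVector_mul {a : E d → ℂ} (ha : IsAmplitude a) {k : ℝ} (hk : 0 ≤ k)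
    (i : Fin (d + 1)) : IsAmplitude fun η ↦ waveVector k η i * a η :=
  ha.mul_of_norm_le (measurable_waveVector k i).aestronglyMeasurable
    fun η ↦ norm_waveVector_le hk η i

/-- The superposition of the plane waves with amplitude `a`. -/
def waveIntegral (k : ℝ) (a : E d → ℂ) (X : E (d + 1)) : ℂ := ∫ η, planeWave k η X * a η

theorem IsAmplitude.integrable {a : E d → ℂ} (ha : IsAmplitude a) {k : ℝ} (hk : 0 ≤ k)
    {X : E (d + 1)} (hX : 0 < X (Fin.last d)) : Integrable fun η ↦ planeWave k η X * a η := by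
  have hp := Real.pi_pos
  refine ((ha.2 (X (Fin.last d) * (2 * Real.pi)) (by positivity)).const_mul
    (Real.exp (X (Fin.last d) * k))).mono'
    (((measurable_planeWave k).comp measurable_prodMk_left).aestronglyMeasurable.mul ha.1)
    (Filter.Eventually.of_forall fun η ↦ ?_)
  rw [norm_mul, ← mul_assoc, ← Real.exp_add]
  refine mul_le_mul_of_nonneg_right ((norm_planeWave_le hk η hX.le).trans_eq ?_) (norm_nonneg _)
  congr 1; ring

theorem hasFDerivAt_planeWave (k : ℝ) (η : E d) (X : E (d + 1)) :
    HasFDerivAt (planeWave k η) (∑ i, (planeWave k η X * waveVector k η i) •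
      (Complex.ofRealCLM ∘L (EuclideanSpace.proj i : E (d + 1) →L[ℝ] ℝ))) X := by
  have h1 : ∀ i, HasFDerivAt (fun Y : E (d + 1) ↦ waveVector k η i * (Y i : ℂ))
      (waveVector k η i • (Complex.ofRealCLM ∘L (EuclideanSpace.proj i : E (d + 1) →L[ℝ] ℝ))) X :=
    fun i ↦ (Complex.ofRealCLM ∘L
      (EuclideanSpace.proj i : E (d + 1) →L[ℝ] ℝ)).hasFDerivAt.const_mul _
  have h2 := (HasFDerivAt.fun_sum (u := Finset.univ) fun i _ ↦ h1 i).cexp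
  refine h2.congr_fderiv ?_
  rw [Finset.smul_sum]
  refine Finset.sum_congr rfl fun i _ ↦ ?_
  rw [smul_smul]; rfl

theorem norm_smul_ofReal_proj_le (z : ℂ) (i : Fin (d + 1)) :
    ‖z • (Complex.ofRealCLM ∘L (EuclideanSpace.proj i : E (d + 1) →L[ℝ] ℝ))‖ ≤ ‖z‖ := by
  refine ContinuousLinearMap.opNorm_le_bound _ (norm_nonneg _) fun Y ↦ ?_
  simp only [smul_apply, ContinuousLinearMap.comp_apply, Complex.ofRealCLM_apply, smul_eq_mul,
    norm_mul, Complex.norm_real]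
  exact mul_le_mul_of_nonneg_left (PiLp.norm_apply_le Y i) (norm_nonneg _)

theorem IsAmplitude.hasFDerivAt {a : E d → ℂ} (ha : IsAmplitude a) {k : ℝ} (hk : 0 ≤ k)
    {X : E (d + 1)} (hX : 0 < X (Fin.last d)) :
    HasFDerivAt (waveIntegral k a) (∑ i, waveIntegral k (fun η ↦ waveVector k η i * a η) X •
      (Complex.ofRealCLM ∘L (EuclideanSpace.proj i : E (d + 1) →L[ℝ] ℝ))) X := by
  have hp := Real.pi_pos
  set t := X (Fin.last d) with ht
  set P : Fin (d + 1) → (E (d + 1) →L[ℝ] ℂ) := fun i ↦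
    Complex.ofRealCLM ∘L (EuclideanSpace.proj i : E (d + 1) →L[ℝ] ℝ) with hP
  have hball : ∀ Y ∈ Metric.ball X (t / 2), t / 2 ≤ Y (Fin.last d) ∧ Y (Fin.last d) ≤ 2 * t := by
    intro Y hY
    have h1 : |Y (Fin.last d) - t| ≤ ‖Y - X‖ := PiLp.norm_apply_le (Y - X) (Fin.last d)
    rw [Metric.mem_ball, dist_eq_norm] at hY
    have h2 := abs_le.1 (h1.trans hY.le)
    constructor <;> linarith [h2.1, h2.2]
  have hint : ∀ i, Integrable fun η ↦ Real.exp (2 * t * k) *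
      (Real.exp (-(t / 2 * (2 * Real.pi) * ‖η‖)) * ‖waveVector k η i * a η‖) := fun i ↦
    ((ha.waveVector_mul hk i).2 _ (by positivity)).const_mul _
  have hmeas : ∀ Y : E (d + 1), AEStronglyMeasurable fun η ↦ planeWave k η Y * a η := fun Y ↦
    ((measurable_planeWave k).comp measurable_prodMk_left).aestronglyMeasurable.mul ha.1
  have key := hasFDerivAt_integral_of_dominated_of_fderiv_le (𝕜 := ℝ)
    (μ := (volume : Measure (E d))) (F := fun Y η ↦ planeWave k η Y * a η)
    (F' := fun Y η ↦ ∑ i, (planeWave k η Y * (waveVector k η i * a η)) • P i) (x₀ := X)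
    (s := Metric.ball X (t / 2))
    (bound := fun η ↦ ∑ i, Real.exp (2 * t * k) *
      (Real.exp (-(t / 2 * (2 * Real.pi) * ‖η‖)) * ‖waveVector k η i * a η‖))
    (Metric.ball_mem_nhds X (by positivity))
    (Filter.Eventually.of_forall hmeas)
    (ha.integrable hk hX) ?_ (Filter.Eventually.of_forall fun η Y hY ↦ ?_)
    (integrable_finsetSum _ fun i _ ↦ hint i)
    (Filter.Eventually.of_forall fun η Y hY ↦ ?_)
  · refine key.congr_fderiv ?_
    rw [integral_finsetSum]
    · refine Finset.sum_congr rfl fun i _ ↦ ?_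
      exact integral_smul_const (𝕜 := ℂ) (fun η ↦ planeWave k η X * (waveVector k η i * a η)) (P i)
    · exact fun i _ ↦ ((ha.waveVector_mul hk i).integrable hk hX).smul_const _
  · exact Finset.aestronglyMeasurable_fun_sum _ fun i _ ↦
      ((ha.waveVector_mul hk i).integrable hk hX).1.smul_const _
  · refine (norm_sum_le _ _).trans (Finset.sum_le_sum fun i _ ↦ ?_)
    refine (norm_smul_ofReal_proj_le _ i).trans ?_
    rw [norm_mul, ← mul_assoc]
    refine mul_le_mul_of_nonneg_right ?_ (norm_nonneg _)
    obtain ⟨h1, h2⟩ := hball Y hY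
    refine (norm_planeWave_le hk η (by linarith)).trans ?_
    rw [← Real.exp_add]
    refine Real.exp_le_exp.2 ?_
    have := norm_nonneg η
    nlinarith [mul_le_mul_of_nonneg_right h2 hk,
      mul_le_mul_of_nonneg_right h1 (mul_nonneg hp.le this)]
  · have h := (hasFDerivAt_planeWave k η Y).mul_const (a η)
    refine h.congr_fderiv ?_
    rw [Finset.smul_sum]
    refine Finset.sum_congr rfl fun i _ ↦ ?_
    rw [smul_smul]
    congr 1; ring

theorem isOpen_upperHalfSpace : IsOpen (upperHalfSpace d) :=
  isOpen_lt continuous_const (by fun_prop)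

theorem sum_smul_ofReal_proj_apply (c : Fin (d + 1) → ℂ) (j : Fin (d + 1)) :
    (∑ i, c i • (Complex.ofRealCLM ∘L (EuclideanSpace.proj i : E (d + 1) →L[ℝ] ℝ)))
      (EuclideanSpace.single j (1 : ℝ)) = c j := by
  rw [sum_apply, Finset.sum_eq_single j]
  · simp
  · intro i _ hij
    simp [hij]
  · simp

theorem IsAmplitude.fderiv_apply {a : E d → ℂ} (ha : IsAmplitude a) {k : ℝ} (hk : 0 ≤ k)
    {u : E (d + 1) → ℂ} (hu : Set.EqOn u (waveIntegral k a) (upperHalfSpace d))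
    {X : E (d + 1)} (hX : X ∈ upperHalfSpace d) (j : Fin (d + 1)) :
    fderiv ℝ u X (EuclideanSpace.single j (1 : ℝ)) =
      waveIntegral k (fun η ↦ waveVector k η j * a η) X := by
  rw [Filter.EventuallyEq.fderiv_eq (hu.eventuallyEq_of_mem (isOpen_upperHalfSpace.mem_nhds hX)),
    (ha.hasFDerivAt hk hX).fderiv, sum_smul_ofReal_proj_apply]

/-- Superpositions of plane waves solve the Helmholtz equation. -/
theorem IsAmplitude.laplacian_eq {a : E d → ℂ} (ha : IsAmplitude a) {k : ℝ} (hk : 0 ≤ k)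
    {u : E (d + 1) → ℂ} (hu : Set.EqOn u (waveIntegral k a) (upperHalfSpace d))
    {X : E (d + 1)} (hX : X ∈ upperHalfSpace d) :
    Laplacian.laplacian u X = -(k : ℂ) ^ 2 * u X := by
  have hU := isOpen_upperHalfSpace.mem_nhds hX
  have hfd : fderiv ℝ u =ᶠ[nhds X] fun Y ↦
      ∑ i, waveIntegral k (fun η ↦ waveVector k η i * a η) Y •
      (Complex.ofRealCLM ∘L (EuclideanSpace.proj i : E (d + 1) →L[ℝ] ℝ)) := by
    filter_upwards [hU] with Y hY
    rw [Filter.EventuallyEq.fderiv_eq (hu.eventuallyEq_of_mem (isOpen_upperHalfSpace.mem_nhds hY)),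
      (ha.hasFDerivAt hk hY).fderiv]
  have hdiff : DifferentiableAt ℝ (fderiv ℝ u) X := by
    refine DifferentiableAt.congr_of_eventuallyEq (DifferentiableAt.fun_sum fun i _ ↦ ?_) hfd
    exact ((ha.waveVector_mul hk i).hasFDerivAt hk hX).differentiableAt.smul_const _
  rw [InnerProductSpace.laplacian_eq_iteratedFDeriv_orthonormalBasis u
    (EuclideanSpace.basisFun (Fin (d + 1)) ℝ)]
  have h1 : ∀ j, iteratedFDeriv ℝ 2 u X
      ![EuclideanSpace.basisFun (Fin (d + 1)) ℝ j, EuclideanSpace.basisFun (Fin (d + 1)) ℝ j] =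
      waveIntegral k (fun η ↦ waveVector k η j * (waveVector k η j * a η)) X := by
    intro j
    rw [iteratedFDeriv_two_apply]
    simp only [Matrix.cons_val_zero, Matrix.cons_val_one, EuclideanSpace.basisFun_apply]
    rw [← (ha.waveVector_mul hk j).fderiv_apply hk (Set.eqOn_refl _ _) hX j]
    have h2 : (fun Y ↦ fderiv ℝ u Y (EuclideanSpace.single j (1 : ℝ))) =ᶠ[nhds X]
        waveIntegral k (fun η ↦ waveVector k η j * a η) := by
      filter_upwards [hU] with Y hY
      exact ha.fderiv_apply hk hu hY j
    rw [← h2.fderiv_eq, fderiv_clm_apply hdiff (differentiableAt_const _)]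
    simp
  simp only [h1]
  rw [hu hX]
  unfold waveIntegral
  rw [← integral_finsetSum _ fun j _ ↦
    ((ha.waveVector_mul hk j).waveVector_mul hk j).integrable hk hX, ← integral_const_mul]
  refine integral_congr_ae (Filter.Eventually.of_forall fun η ↦ ?_)
  simp only
  rw [← sum_waveVector_sq k η, Finset.sum_mul]
  exact Finset.sum_congr rfl fun i _ ↦ by ring

theorem isAmplitude_of_bounded {g : E d → ℂ} (hg : AEStronglyMeasurable g) {M : ℝ}
    (hM : ∀ η, ‖g η‖ ≤ M) : IsAmplitude g := by
  refine ⟨hg, fun τ hτ ↦ ?_⟩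
  exact (integrable_exp_neg_mul_norm hτ).mul_bdd (c := M) hg.norm
    (Filter.Eventually.of_forall fun η ↦ by simpa using hM η)

/-- In the upper half-space, the double layer potential is the superposition of plane waves whose
amplitude is half the Fourier transform of the density. -/
theorem doubleLayer_eq_waveIntegral (hd : d = 1 ∨ d = 2) {k : ℝ} (hk : 0 < k)
    {φ : Lp ℂ 2 (volume : Measure (E d))} (hφ : Integrable φ) :
    Set.EqOn (doubleLayer k φ) (waveIntegral k fun η ↦ 1 / 2 * 𝓕 (φ : E d → ℂ) η)
      (upperHalfSpace d) := by
  intro X hX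
  obtain ⟨x, hx⟩ := exists_eq_point X
  have ht : 0 < X (Fin.last d) := hX
  set t := X (Fin.last d) with htdef
  have hp := Real.pi_pos
  rw [hx, doubleLayer, waveIntegral]
  have h1 : ∀ y : E d, deriv (fun s : ℝ ↦ fundamentalSolution (d + 1) k (point x t) (point y s)) 0 *
      φ y = ∫ η, 1 / 2 * Complex.exp (Complex.I * t * verticalWavenumber k η) *
        Complex.exp (2 * Real.pi * Complex.I * (inner ℝ (x - y) η : ℝ)) * φ y := by
    intro y
    rw [deriv_fundamentalSolution hd hk ht, ← integral_mul_const]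
    refine integral_congr_ae (Filter.Eventually.of_forall fun η ↦ ?_)
    simp only; ring
  simp only [h1]
  have hexp : Integrable fun η : E d ↦
      Complex.exp (Complex.I * t * verticalWavenumber k η) := by
    refine ((integrable_exp_neg_mul_norm (c := t * (2 * Real.pi)) (by positivity)).const_mul
      (Real.exp (t * k))).mono' ?_ (Filter.Eventually.of_forall fun η ↦ ?_)
    · exact (((measurable_verticalWavenumber k).const_mul _).cexp).aestronglyMeasurable
    · refine (norm_exp_verticalWavenumber_le hk.le ht.le η).trans_eq ?_
      rw [← Real.exp_add]; congr 1; ring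
  rw [integral_integral_swap]
  · refine integral_congr_ae (Filter.Eventually.of_forall fun η ↦ ?_)
    simp only
    rw [planeWave_point, Real.fourier_eq', ← integral_const_mul, ← integral_const_mul]
    refine integral_congr_ae (Filter.Eventually.of_forall fun y ↦ ?_)
    simp only [smul_eq_mul]
    have : Complex.exp (2 * Real.pi * Complex.I * (inner ℝ (x - y) η : ℝ)) =
        Complex.exp (2 * Real.pi * Complex.I * (inner ℝ x η : ℝ)) *
        Complex.exp (((-2 * Real.pi * inner ℝ y η : ℝ) : ℂ) * Complex.I) := by
      rw [← Complex.exp_add, inner_sub_left]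
      congr 1; push_cast; ring
    rw [this]
    ring
  · have h2 : Integrable (fun p : E d × E d ↦ φ p.1 *
        Complex.exp (Complex.I * t * verticalWavenumber k p.2)) (volume.prod volume) :=
      hφ.mul_prod hexp
    have h3 := h2.bdd_mul (c := 1 / 2) (f := fun p : E d × E d ↦ 1 / 2 *
      Complex.exp (2 * Real.pi * Complex.I * (inner ℝ (x - p.1) p.2 : ℝ)))
      (by fun_prop) (Filter.Eventually.of_forall fun p ↦ by
        rw [norm_mul, norm_exp_inner]; simp)
    refine h3.congr (Filter.Eventually.of_forall fun p ↦ ?_)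
    simp only [Function.uncurry]
    ring

/-! ### Slicing the half-space -/

/-- The measurable equivalence `(x, t) ↦ point x t`. -/
def pointEquiv (d : ℕ) : E d × ℝ ≃ᵐ E (d + 1) :=
  (((MeasurableEquiv.toLp 2 (Fin d → ℝ)).symm.prodCongr (MeasurableEquiv.refl ℝ)).trans
    (MeasurableEquiv.prodComm.trans
      (MeasurableEquiv.piFinSuccAbove (fun _ ↦ ℝ) (Fin.last d)).symm)).trans
        (MeasurableEquiv.toLp 2 (Fin (d + 1) → ℝ))

theorem pointEquiv_apply (p : E d × ℝ) : pointEquiv d p = point p.1 p.2 := by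
  ext i
  induction i using Fin.lastCases with
  | last => simp [pointEquiv, point, MeasurableEquiv.piFinSuccAbove]; rfl
  | cast i => simp [pointEquiv, point, MeasurableEquiv.piFinSuccAbove]; rfl

theorem measurePreserving_pointEquiv (d : ℕ) :
    MeasurePreserving (pointEquiv d) (volume.prod volume) volume := by
  refine MeasurePreserving.trans (μb := volume)
    (MeasurePreserving.trans (μb := (volume : Measure (Fin d → ℝ)).prod volume) ?_
      (MeasurePreserving.trans (μb := (volume : Measure ℝ).prod volume) ?_ ?_)) ?_
  · exact (EuclideanSpace.volume_preserving_symm_measurableEquiv_toLp (Fin d)).prod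
      (MeasurePreserving.id _)
  · exact Measure.measurePreserving_swap
  · exact (volume_preserving_piFinSuccAbove (fun _ ↦ ℝ) (Fin.last d)).symm
  · exact (EuclideanSpace.volume_preserving_symm_measurableEquiv_toLp (Fin (d + 1))).symm

theorem point_last (x : E d) (t : ℝ) : point x t (Fin.last d) = t := by simp [point]

theorem norm_le_norm_point (x : E d) (t : ℝ) : ‖x‖ ≤ ‖point x t‖ := by
  have h := norm_point_sub_point x 0 t 0
  have h0 : (point (0 : E d) 0) = 0 := by
    ext i
    induction i using Fin.lastCases with
    | last => simp [point]
    | cast i => simp [point]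
  rw [h0, sub_zero, sub_zero, sub_zero] at h
  rw [h]
  exact Real.le_sqrt_of_sq_le (by nlinarith [sq_nonneg t])

theorem setIntegral_last_gt {F : Type*} [NormedAddCommGroup F] [NormedSpace ℝ F]
    (f : E (d + 1) → F) (ε : ℝ) :
    ∫ X in {X : E (d + 1) | ε < X (Fin.last d)}, f X =
      ∫ p, f (point p.1 p.2) ∂((volume : Measure (E d)).prod (volume.restrict (Set.Ioi ε))) := by
  rw [← (measurePreserving_pointEquiv d).setIntegral_preimage_emb
    (pointEquiv d).measurableEmbedding]
  have h1 : pointEquiv d ⁻¹' {X : E (d + 1) | ε < X (Fin.last d)} = Set.univ ×ˢ Set.Ioi ε := by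
    ext p
    simp [pointEquiv_apply, point_last]
  rw [h1, ← Measure.prod_restrict, Measure.restrict_univ]
  simp only [pointEquiv_apply]

theorem integrableOn_last_gt_iff {F : Type*} [NormedAddCommGroup F]
    (f : E (d + 1) → F) (ε : ℝ) :
    IntegrableOn f {X : E (d + 1) | ε < X (Fin.last d)} ↔
      Integrable (fun p : E d × ℝ ↦ f (point p.1 p.2))
        ((volume : Measure (E d)).prod (volume.restrict (Set.Ioi ε))) := by
  rw [← (measurePreserving_pointEquiv d).integrableOn_comp_preimage
    (pointEquiv d).measurableEmbedding]
  have h1 : pointEquiv d ⁻¹' {X : E (d + 1) | ε < X (Fin.last d)} = Set.univ ×ˢ Set.Ioi ε := by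
    ext p
    simp [pointEquiv_apply, point_last]
  rw [h1, IntegrableOn, ← Measure.prod_restrict, Measure.restrict_univ]
  simp only [Function.comp_def, pointEquiv_apply]

theorem continuous_point : Continuous fun p : E d × ℝ ↦ point p.1 p.2 := by
  refine (PiLp.continuous_toLp 2 _).comp (continuous_pi fun i ↦ ?_)
  induction i using Fin.lastCases with
  | last => simpa using continuous_snd
  | cast i => simp; fun_prop

theorem hasFDerivAt_point_left (x : E d) (t : ℝ) :
    ∃ A : E d →L[ℝ] E (d + 1), HasFDerivAt (fun x ↦ point x t) A x ∧
      ∀ i, A (EuclideanSpace.single i 1) = EuclideanSpace.single i.castSucc 1 := by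
  set A : E d →L[ℝ] E (d + 1) := LinearMap.toContinuousLinearMap
    { toFun := fun x ↦ point x 0
      map_add' := fun x y ↦ by
        ext i
        induction i using Fin.lastCases <;> simp [point]
      map_smul' := fun c y ↦ by
        ext i
        induction i using Fin.lastCases <;> simp [point] } with hA
  refine ⟨A, ?_, fun i ↦ ?_⟩
  · have h : (fun x ↦ point x t) = fun x ↦ A x + point (0 : E d) t := by
      funext x
      ext i
      induction i using Fin.lastCases <;> simp [point, A]
    rw [h]
    exact A.hasFDerivAt.add_const _
  · ext j
    induction j using Fin.lastCases with
    | last => simp [A, point, (Fin.castSucc_lt_last i).ne']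
    | cast j => simp [A, point, PiLp.single_apply]

theorem hasDerivAt_point_right (x : E d) (t : ℝ) :
    HasDerivAt (fun t ↦ point x t) (EuclideanSpace.single (Fin.last d) (1 : ℝ)) t := by
  have h : (fun t ↦ point x t) =
      fun t ↦ t • EuclideanSpace.single (Fin.last d) (1 : ℝ) + point x 0 := by
    funext s
    ext i
    induction i using Fin.lastCases with
    | last => simp [point]
    | cast i => simp [point, (Fin.castSucc_lt_last i).ne]
  rw [h]
  simpa using ((hasDerivAt_id t).smul_const (EuclideanSpace.single (Fin.last d) (1 : ℝ))).add_const
    (point x 0)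

theorem hasCompactSupport_slice {F : E (d + 1) → ℂ} (hF : HasCompactSupport F) (t : ℝ) :
    HasCompactSupport fun x : E d ↦ F (point x t) := by
  obtain ⟨R, hR⟩ := hF.isCompact.isBounded.subset_closedBall 0
  refine HasCompactSupport.intro (isCompact_closedBall (0 : E d) R) fun x hx ↦ ?_
  refine image_eq_zero_of_notMem_tsupport fun hmem ↦ hx ?_
  have := hR hmem
  rw [mem_closedBall_zero_iff] at this ⊢
  exact (norm_le_norm_point x t).trans this

theorem hasCompactSupport_vertical {F : E (d + 1) → ℂ} (hF : HasCompactSupport F) (x : E d) :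
    HasCompactSupport fun t : ℝ ↦ F (point x t) := by
  obtain ⟨R, hR⟩ := hF.isCompact.isBounded.subset_closedBall 0
  refine HasCompactSupport.intro (isCompact_closedBall (0 : ℝ) R) fun t ht ↦ ?_
  refine image_eq_zero_of_notMem_tsupport fun hmem ↦ ht ?_
  have := hR hmem
  rw [mem_closedBall_zero_iff] at this ⊢
  refine le_trans ?_ this
  have h := PiLp.norm_apply_le (point x t) (Fin.last d)
  rwa [point_last] at h

/-- The partial derivative in the direction of the `i`-th coordinate. -/
def partialDeriv (i : Fin (d + 1)) (F : E (d + 1) → ℂ) (X : E (d + 1)) : ℂ :=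
  fderiv ℝ F X (EuclideanSpace.single i (1 : ℝ))

theorem continuous_partialDeriv {F : E (d + 1) → ℂ} (hF : ContDiff ℝ 1 F) (i : Fin (d + 1)) :
    Continuous (partialDeriv i F) :=
  (hF.continuous_fderiv one_ne_zero).clm_apply continuous_const

theorem contDiff_partialDeriv {F : E (d + 1) → ℂ} (hF : ContDiff ℝ ∞ F) (i : Fin (d + 1)) :
    ContDiff ℝ ∞ (partialDeriv i F) :=
  (hF.fderiv_right (m := ∞) (by simp)).clm_apply contDiff_const

theorem hasCompactSupport_partialDeriv {F : E (d + 1) → ℂ} (hF : HasCompactSupport F)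
    (i : Fin (d + 1)) : HasCompactSupport (partialDeriv i F) :=
  hF.fderiv_apply ℝ _

theorem integral_slice_partialDeriv {F : E (d + 1) → ℂ} (hF : ContDiff ℝ 1 F)
    (hc : HasCompactSupport F) (i : Fin d) (t : ℝ) :
    ∫ x : E d, partialDeriv i.castSucc F (point x t) = 0 := by
  have hd : ∀ x : E d, HasFDerivAt (fun x ↦ F (point x t))
      ((fderiv ℝ F (point x t)).comp (hasFDerivAt_point_left x t).choose) x := fun x ↦
    ((hF.differentiable one_ne_zero).differentiableAt.hasFDerivAt).comp x
      (hasFDerivAt_point_left x t).choose_spec.1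
  have hcont : Continuous fun x : E d ↦ point x t :=
    continuous_point.comp (by fun_prop : Continuous fun x : E d ↦ (x, t))
  have h1 : ∀ x : E d, partialDeriv i.castSucc F (point x t) =
      fderiv ℝ (fun x ↦ F (point x t)) x (EuclideanSpace.single i 1) := by
    intro x
    rw [(hd x).fderiv, ContinuousLinearMap.comp_apply,
      (hasFDerivAt_point_left x t).choose_spec.2, partialDeriv]
  have hint : Integrable fun x : E d ↦ fderiv ℝ (fun x ↦ F (point x t)) x
      (EuclideanSpace.single i 1) := by
    simp only [← h1]
    exact ((continuous_partialDeriv hF _).comp hcont).integrable_of_hasCompactSupport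
      (hasCompactSupport_slice (hasCompactSupport_partialDeriv hc _) t)
  have hFi : Integrable fun x : E d ↦ F (point x t) :=
    (hF.continuous.comp hcont).integrable_of_hasCompactSupport (hasCompactSupport_slice hc t)
  have h2 := integral_mul_fderiv_eq_neg_fderiv_mul_of_integrable (𝕜 := ℂ)
    (μ := (volume : Measure (E d))) (f := fun _ ↦ (1 : ℂ)) (g := fun x ↦ F (point x t))
    (v := EuclideanSpace.single i 1)
    (by simp) (by simpa only [one_mul] using hint)
    (by simpa only [one_mul] using hFi)
    (fun x _ ↦ by fun_prop) (fun x _ ↦ (hd x).differentiableAt)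
  simp only [h1]
  simpa using h2

theorem integrable_point {F : E (d + 1) → ℂ} (hF : Continuous F) (hc : HasCompactSupport F)
    (ε : ℝ) : Integrable (fun p : E d × ℝ ↦ F (point p.1 p.2))
      ((volume : Measure (E d)).prod (volume.restrict (Set.Ioi ε))) :=
  (integrableOn_last_gt_iff F ε).1 (hF.integrable_of_hasCompactSupport hc).integrableOn

theorem setIntegral_partialDeriv_castSucc {F : E (d + 1) → ℂ} (hF : ContDiff ℝ 1 F)
    (hc : HasCompactSupport F) (i : Fin d) (ε : ℝ) :
    ∫ X in {X : E (d + 1) | ε < X (Fin.last d)}, partialDeriv i.castSucc F X = 0 := by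
  rw [setIntegral_last_gt, integral_prod_symm _ (integrable_point (continuous_partialDeriv hF _)
    (hasCompactSupport_partialDeriv hc _) ε)]
  simp [integral_slice_partialDeriv hF hc]

/-- The fundamental theorem of calculus on vertical lines. -/
theorem setIntegral_partialDeriv_last {F : E (d + 1) → ℂ} (hF : ContDiff ℝ 1 F)
    (hc : HasCompactSupport F) (ε : ℝ) :
    ∫ X in {X : E (d + 1) | ε < X (Fin.last d)}, partialDeriv (Fin.last d) F X =
      -∫ x : E d, F (point x ε) := by
  rw [setIntegral_last_gt, integral_prod _ (integrable_point (continuous_partialDeriv hF _)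
    (hasCompactSupport_partialDeriv hc _) ε), ← integral_neg]
  refine integral_congr_ae (Filter.Eventually.of_forall fun x ↦ ?_)
  have hcont : Continuous fun t : ℝ ↦ point x t :=
    continuous_point.comp (by fun_prop : Continuous fun t : ℝ ↦ (x, t))
  have hd : ∀ t, HasDerivAt (fun t ↦ F (point x t)) (partialDeriv (Fin.last d) F (point x t)) t :=
    fun t ↦ ((hF.differentiable one_ne_zero).differentiableAt.hasFDerivAt).comp_hasDerivAt t
      (hasDerivAt_point_right x t)
  have h := integral_Ioi_of_hasDerivAt_of_tendsto (a := ε) (m := 0)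
    (hd ε).continuousAt.continuousWithinAt (fun t _ ↦ hd t)
    (((continuous_partialDeriv hF _).comp hcont).integrable_of_hasCompactSupport
      (hasCompactSupport_vertical (hasCompactSupport_partialDeriv hc _) x)).integrableOn
    ((hasCompactSupport_vertical hc x).is_zero_at_infty.mono_left atTop_le_cocompact)
  simpa using h

/-! ### Square integrability of superpositions of plane waves near the boundary -/

theorem integrable_norm_exp_verticalWavenumber_sq {a : E d → ℂ} (ha : AEStronglyMeasurable a)
    {k : ℝ} (hk : 0 ≤ k) (h2 : Integrable fun η ↦ (1 + ‖η‖)⁻¹ * ‖a η‖ ^ 2) (T : ℝ) :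
    Integrable (fun p : E d × ℝ ↦
        ‖Complex.exp (Complex.I * p.2 * verticalWavenumber k p.1) * a p.1‖ ^ 2)
      (volume.prod (volume.restrict (Set.Ioc 0 T))) := by
  have hp := Real.pi_gt_three
  have hneg : ∀ η : E d, -(1 + ‖η‖) < 0 := fun η ↦ by have := norm_nonneg η; linarith
  have hB : Integrable (fun p : E d × ℝ ↦ Real.exp (-(1 + ‖p.1‖) * p.2) * ‖a p.1‖ ^ 2)
      (volume.prod (volume.restrict (Set.Ioi 0))) := by
    rw [integrable_prod_iff]
    · constructor
      · refine Filter.Eventually.of_forall fun η ↦ ?_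
        exact Integrable.mul_const (integrableOn_exp_mul_Ioi (hneg η) 0) (‖a η‖ ^ 2)
      · refine h2.congr (Filter.Eventually.of_forall fun η ↦ ?_)
        simp only [norm_mul, norm_pow, norm_norm, Real.norm_eq_abs (Real.exp _), Real.abs_exp]
        rw [integral_mul_const, integral_exp_mul_Ioi (hneg η), mul_zero, Real.exp_zero,
          neg_div_neg_eq, one_div]
    · exact (by fun_prop : Continuous fun p : E d × ℝ ↦
        Real.exp (-(1 + ‖p.1‖) * p.2)).aestronglyMeasurable.mul ((ha.comp_fst).norm.pow 2)
  have hB' : Integrable (fun p : E d × ℝ ↦ Real.exp (-(1 + ‖p.1‖) * p.2) * ‖a p.1‖ ^ 2)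
      (volume.prod (volume.restrict (Set.Ioc 0 T))) :=
    hB.mono_measure (Measure.prod_mono le_rfl
      (Measure.restrict_mono Set.Ioc_subset_Ioi_self le_rfl))
  refine (hB'.const_mul (Real.exp (2 * T * k + T))).mono' ?_ ?_
  · refine (AEStronglyMeasurable.mul (Measurable.aestronglyMeasurable ?_) ha.comp_fst).norm.pow 2
    have := (measurable_verticalWavenumber (d := d) k).comp
      (measurable_fst : Measurable (Prod.fst : E d × ℝ → E d))
    exact Complex.measurable_exp.comp (Measurable.mul (by fun_prop) this)
  · have hmem : ∀ᵐ p : E d × ℝ ∂(volume.prod (volume.restrict (Set.Ioc 0 T))),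
        p.2 ∈ Set.Ioc 0 T :=
      Measure.quasiMeasurePreserving_snd.ae (ae_restrict_mem measurableSet_Ioc)
    filter_upwards [hmem] with p hp2
    have hn := norm_nonneg p.1
    rw [Real.norm_eq_abs, abs_of_nonneg (by positivity), norm_mul, mul_pow, ← mul_assoc]
    refine mul_le_mul_of_nonneg_right ?_ (by positivity)
    refine (pow_le_pow_left₀ (norm_nonneg _) (norm_exp_verticalWavenumber_le hk hp2.1.le p.1)
      2).trans ?_
    rw [← Real.exp_nat_mul, ← Real.exp_add]
    refine Real.exp_le_exp.2 ?_
    push_cast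
    nlinarith [mul_le_mul_of_nonneg_right hp2.2 hk, hp2.2,
      mul_nonneg (mul_nonneg hp2.1.le hn) (by linarith : 0 ≤ 4 * Real.pi - 1)]

theorem waveIntegral_point (k : ℝ) (a : E d → ℂ) (x : E d) (t : ℝ) :
    waveIntegral k a (point x t) =
      𝓕⁻ (fun η ↦ Complex.exp (Complex.I * t * verticalWavenumber k η) * a η) x := by
  rw [waveIntegral, Real.fourierInv_eq']
  refine integral_congr_ae (Filter.Eventually.of_forall fun η ↦ ?_)
  simp only [smul_eq_mul]
  rw [planeWave_point, real_inner_comm]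
  have : (((2 * Real.pi * inner ℝ η x : ℝ) : ℂ) * Complex.I) =
      2 * Real.pi * Complex.I * (inner ℝ η x : ℝ) := by push_cast; ring
  rw [this]
  ring

theorem measurable_planeWave_point (k : ℝ) :
    Measurable fun q : (E d × ℝ) × E d ↦ planeWave k q.2 (point q.1.1 q.1.2) := by
  have h0 : Measurable fun p : E d × ℝ ↦ point p.1 p.2 := continuous_point.measurable
  have h1 : Measurable fun q : (E d × ℝ) × E d ↦ point q.1.1 q.1.2 := h0.comp measurable_fst
  have h2 : Measurable fun q : (E d × ℝ) × E d ↦ (point q.1.1 q.1.2, q.2) :=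
    h1.prodMk measurable_snd
  have h3 : Measurable ((fun p : E (d + 1) × E d ↦ planeWave k p.2 p.1) ∘
      fun q : (E d × ℝ) × E d ↦ (point q.1.1 q.1.2, q.2)) :=
    Measurable.comp (measurable_planeWave k) h2
  exact h3

/-- A superposition of plane waves is square integrable on bounded strips above the boundary,
by Plancherel's theorem on horizontal slices. -/
theorem IsAmplitude.memLp_waveIntegral {a : E d → ℂ} (ha : IsAmplitude a) {k : ℝ} (hk : 0 ≤ k)
    (h2 : Integrable fun η ↦ (1 + ‖η‖)⁻¹ * ‖a η‖ ^ 2) (T : ℝ) :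
    MemLp (fun p : E d × ℝ ↦ waveIntegral k a (point p.1 p.2)) 2
      (volume.prod (volume.restrict (Set.Ioc 0 T))) := by
  have hmeas : AEStronglyMeasurable (fun p : E d × ℝ ↦ waveIntegral k a (point p.1 p.2))
      (volume.prod (volume.restrict (Set.Ioc 0 T))) := by
    have h : AEStronglyMeasurable (fun q : (E d × ℝ) × E d ↦
        planeWave k q.2 (point q.1.1 q.1.2) * a q.2)
        ((volume.prod (volume.restrict (Set.Ioc 0 T))).prod volume) := by
      have h2 := measurable_planeWave_point (d := d) k
      exact h2.aestronglyMeasurable.mul ha.1.comp_snd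
    exact h.integral_prod_right'
  have hK := integrable_norm_exp_verticalWavenumber_sq ha.1 hk h2 T
  have hslice : ∀ᵐ t ∂(volume.restrict (Set.Ioc 0 T)),
      MemLp (fun x : E d ↦ waveIntegral k a (point x t)) 2 ∧
      ∫ x : E d, ‖waveIntegral k a (point x t)‖ ^ 2 =
        ∫ η, ‖Complex.exp (Complex.I * t * verticalWavenumber k η) * a η‖ ^ 2 := by
    filter_upwards [ae_restrict_mem measurableSet_Ioc, hK.prod_left_ae] with t ht hKt
    have hL1 : Integrable fun η ↦
        Complex.exp (Complex.I * t * verticalWavenumber k η) * a η := by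
      have h := ha.integrable hk (X := point (0 : E d) t) (by rw [point_last]; exact ht.1)
      simpa only [planeWave_point, inner_zero_left, Complex.ofReal_zero, mul_zero,
        Complex.exp_zero, mul_one] using h
    have hL2 := (memLp_two_iff_integrable_sq_norm hL1.1).2 hKt
    simp only [waveIntegral_point]
    exact memLp_fourierInv hL1 hL2
  rw [memLp_two_iff_integrable_sq_norm hmeas]
  refine (integrable_prod_iff' (hmeas.norm.pow 2)).2 ⟨?_, ?_⟩
  · filter_upwards [hslice] with t ht
    exact (memLp_two_iff_integrable_sq_norm ht.1.1).1 ht.1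
  · refine hK.integral_prod_right.congr ?_
    filter_upwards [hslice] with t ht
    simp only [Pi.pow_apply, norm_pow, norm_norm]
    exact ht.2.symm

theorem exists_last_le_of_hasCompactSupport {w : E (d + 1) → ℂ} (hc : HasCompactSupport w) :
    ∃ T : ℝ, 0 ≤ T ∧ ∀ X, T < X (Fin.last d) → w X = 0 := by
  obtain ⟨R, hR⟩ := hc.isCompact.isBounded.subset_closedBall 0
  refine ⟨max R 0, le_max_right _ _, fun X hX ↦ image_eq_zero_of_notMem_tsupport fun hmem ↦ ?_⟩
  have h := hR hmem
  rw [mem_closedBall_zero_iff] at h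
  have h2 := (le_abs_self _).trans (PiLp.norm_apply_le X (Fin.last d))
  exact absurd hX (not_lt.2 ((h2.trans h).trans (le_max_left _ _)))

/-- Superpositions of plane waves are integrable up to the boundary against compactly supported
functions. In particular, the integral that defines the weak normal derivative is absolutely
convergent. -/
theorem IsAmplitude.integrableOn_mul {a : E d → ℂ} (ha : IsAmplitude a) {k : ℝ} (hk : 0 ≤ k)
    (h2 : Integrable fun η ↦ (1 + ‖η‖)⁻¹ * ‖a η‖ ^ 2) {w : E (d + 1) → ℂ} (hw : Continuous w)
    (hc : HasCompactSupport w) :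
    IntegrableOn (fun X ↦ waveIntegral k a X * w X) (upperHalfSpace d) := by
  obtain ⟨T, -, hT⟩ := exists_last_le_of_hasCompactSupport hc
  rw [upperHalfSpace, integrableOn_last_gt_iff]
  have hset : ∀ s : Set ℝ, (volume : Measure (E d)).prod ((volume : Measure ℝ).restrict s) =
      ((volume : Measure (E d)).prod volume).restrict (Set.univ ×ˢ s) := fun s ↦ by
    rw [← Measure.prod_restrict, Measure.restrict_univ]
  have hwm : MemLp (fun p : E d × ℝ ↦ w (point p.1 p.2)) 2
      (volume.prod (volume.restrict (Set.Ioc 0 T))) := by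
    rw [hset]
    refine MemLp.restrict _ ?_
    have h := (hw.memLp_of_hasCompactSupport (p := 2) (μ := (volume : Measure (E (d + 1))))
      hc).comp_measurePreserving (measurePreserving_pointEquiv d)
    simpa only [Function.comp_def, pointEquiv_apply] using h
  have h := (ha.memLp_waveIntegral hk h2 T).integrable_mul hwm
  rw [hset] at h ⊢
  refine IntegrableOn.of_forall_sdiff_eq_zero h (MeasurableSet.univ.prod measurableSet_Ioi) ?_
  rintro ⟨x, t⟩ ⟨⟨-, ht⟩, hnot⟩
  have h1 : T < t := by
    by_contra hle
    exact hnot ⟨trivial, ht, not_lt.1 hle⟩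
  simp only
  rw [hT _ (by rwa [point_last]), mul_zero]

/-! ### Green's formula for superpositions of plane waves -/

/-- The Fourier integral of the slice of `F` at height `t`. -/
def sliceFourier (F : E (d + 1) → ℂ) (η : E d) (t : ℝ) : ℂ :=
  ∫ x : E d, Complex.exp (2 * Real.pi * Complex.I * (inner ℝ x η : ℝ)) * F (point x t)

theorem exists_norm_slice_le {F : E (d + 1) → ℂ} (hF : Continuous F)
    (hc : HasCompactSupport F) : ∃ B : E d → ℝ, Integrable B ∧ ∀ x t, ‖F (point x t)‖ ≤ B x := by
  obtain ⟨R, hR⟩ := hc.isCompact.isBounded.subset_closedBall 0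
  obtain ⟨M, hM⟩ := hF.bounded_above_of_compact_support hc
  refine ⟨(Metric.closedBall (0 : E d) R).indicator fun _ ↦ M, ?_, fun x t ↦ ?_⟩
  · exact (integrable_indicator_iff measurableSet_closedBall).2
      (integrableOn_const (isCompact_closedBall _ _).measure_lt_top.ne)
  · by_cases hx : x ∈ Metric.closedBall (0 : E d) R
    · rw [Set.indicator_of_mem hx]; exact hM _
    · have h0 : F (point x t) = 0 := by
        refine image_eq_zero_of_notMem_tsupport fun hmem ↦ hx ?_
        have := hR hmem
        rw [mem_closedBall_zero_iff] at this ⊢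
        exact (norm_le_norm_point x t).trans this
      rw [Set.indicator_of_notMem hx, h0, norm_zero]

theorem exists_norm_sliceFourier_le {F : E (d + 1) → ℂ} (hF : Continuous F)
    (hc : HasCompactSupport F) : ∃ M : ℝ, ∀ η t, ‖sliceFourier F η t‖ ≤ M := by
  obtain ⟨B, hB, hFB⟩ := exists_norm_slice_le hF hc
  refine ⟨∫ x, B x, fun η t ↦ norm_integral_le_of_norm_le hB
    (Filter.Eventually.of_forall fun x ↦ ?_)⟩
  rw [norm_mul, norm_exp_inner, one_mul]
  exact hFB x t

theorem continuous_sliceFourier {F : E (d + 1) → ℂ} (hF : Continuous F)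
    (hc : HasCompactSupport F) (η : E d) : Continuous (sliceFourier F η) := by
  obtain ⟨B, hB, hFB⟩ := exists_norm_slice_le hF hc
  refine continuous_of_dominated (bound := B) (fun t ↦ ?_)
    (fun t ↦ Filter.Eventually.of_forall fun x ↦ ?_) hB (Filter.Eventually.of_forall fun x ↦ ?_)
  · have : Continuous fun x : E d ↦ F (point x t) :=
      hF.comp (continuous_point.comp (by fun_prop : Continuous fun x : E d ↦ (x, t)))
    exact ((by fun_prop : Continuous fun x : E d ↦
      Complex.exp (2 * Real.pi * Complex.I * (inner ℝ x η : ℝ))).mul this).aestronglyMeasurable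
  · rw [norm_mul, norm_exp_inner, one_mul]
    exact hFB x t
  · exact continuous_const.mul
      (hF.comp (continuous_point.comp (by fun_prop : Continuous fun t : ℝ ↦ (x, t))))

theorem aestronglyMeasurable_sliceFourier {F : E (d + 1) → ℂ} (hF : Continuous F) (t : ℝ) :
    AEStronglyMeasurable fun η : E d ↦ sliceFourier F η t := by
  have h : Continuous fun p : E d × E d ↦
      Complex.exp (2 * Real.pi * Complex.I * (inner ℝ p.2 p.1 : ℝ)) * F (point p.2 t) := by
    have : Continuous fun p : E d × E d ↦ F (point p.2 t) :=
      hF.comp (continuous_point.comp (by fun_prop : Continuous fun p : E d × E d ↦ (p.2, t)))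
    exact (by fun_prop : Continuous fun p : E d × E d ↦
      Complex.exp (2 * Real.pi * Complex.I * (inner ℝ p.2 p.1 : ℝ))).mul this
  exact (h.aestronglyMeasurable (μ := (volume : Measure (E d)).prod volume)).integral_prod_right'

theorem contDiff_planeWave (k : ℝ) (η : E d) {n : WithTop ℕ∞} : ContDiff ℝ n (planeWave k η) := by
  unfold planeWave
  refine ContDiff.cexp (ContDiff.sum fun i _ ↦ contDiff_const.mul ?_)
  exact (Complex.ofRealCLM ∘L (EuclideanSpace.proj i : E (d + 1) →L[ℝ] ℝ)).contDiff

theorem partialDeriv_planeWave_mul (k : ℝ) (η : E d) {F : E (d + 1) → ℂ} (hF : ContDiff ℝ 1 F)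
    (i : Fin (d + 1)) (X : E (d + 1)) :
    partialDeriv i (fun X ↦ planeWave k η X * F X) X =
      planeWave k η X * (waveVector k η i * F X + partialDeriv i F X) := by
  rw [partialDeriv, ((hasFDerivAt_planeWave k η X).fun_mul
    (hF.differentiable one_ne_zero).differentiableAt.hasFDerivAt).fderiv]
  simp only [add_apply, smul_apply, smul_eq_mul, sum_smul_ofReal_proj_apply, partialDeriv]
  ring

theorem sliceFourier_partialDeriv {F : E (d + 1) → ℂ} (hF : ContDiff ℝ 1 F)
    (hc : HasCompactSupport F) (i : Fin d) (η : E d) (t : ℝ) :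
    sliceFourier (partialDeriv i.castSucc F) η t =
      -(2 * Real.pi * Complex.I * η i) * sliceFourier F η t := by
  have h := integral_slice_partialDeriv ((contDiff_planeWave 0 η).mul hF)
    (hc.mul_left (f := planeWave 0 η)) i t
  simp only [partialDeriv_planeWave_mul 0 η hF, planeWave_point, waveVector_castSucc] at h
  have hcont : Continuous fun x : E d ↦ point x t :=
    continuous_point.comp (by fun_prop : Continuous fun x : E d ↦ (x, t))
  have hi : ∀ {G : E (d + 1) → ℂ}, Continuous G → HasCompactSupport G → Integrable fun x : E d ↦
      Complex.exp (2 * Real.pi * Complex.I * (inner ℝ x η : ℝ)) * G (point x t) := by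
    intro G hG hGc
    have h1 : Continuous fun x : E d ↦ G (point x t) := hG.comp hcont
    have h2 : Continuous fun x : E d ↦
        Complex.exp (2 * Real.pi * Complex.I * (inner ℝ x η : ℝ)) := by fun_prop
    exact (h2.mul h1).integrable_of_hasCompactSupport
      ((hasCompactSupport_slice hGc t).mul_left)
  have h2 : ∫ x : E d, Complex.exp (Complex.I * t * verticalWavenumber 0 η) *
      Complex.exp (2 * Real.pi * Complex.I * (inner ℝ x η : ℝ)) *
      (2 * Real.pi * Complex.I * η i * F (point x t) + partialDeriv i.castSucc F (point x t)) =
      Complex.exp (Complex.I * t * verticalWavenumber 0 η) *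
      (2 * Real.pi * Complex.I * η i * sliceFourier F η t +
        sliceFourier (partialDeriv i.castSucc F) η t) := by
    unfold sliceFourier
    rw [← integral_const_mul, ← integral_add ((hi hF.continuous hc).const_mul _)
      (hi (continuous_partialDeriv hF _) (hasCompactSupport_partialDeriv hc _)),
      ← integral_const_mul]
    refine integral_congr_ae (Filter.Eventually.of_forall fun x ↦ ?_)
    simp only; ring
  rw [h2] at h
  linear_combination (mul_eq_zero.1 h).resolve_left (Complex.exp_ne_zero _)

/-- Two integrations by parts in each horizontal direction give quadratic decay, uniformly in the
height. -/
theorem exists_sliceFourier_decay {v : E (d + 1) → ℂ} (hv : ContDiff ℝ ∞ v)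
    (hc : HasCompactSupport v) :
    ∃ M : ℝ, ∀ η t, (1 + ‖η‖) ^ 2 * ‖sliceFourier v η t‖ ≤ M := by
  obtain ⟨M₀, hM₀⟩ := exists_norm_sliceFourier_le hv.continuous hc
  have h1 : ∀ i : Fin d, ContDiff ℝ ∞ (partialDeriv i.castSucc v) := fun i ↦
    contDiff_partialDeriv hv _
  choose M hM using fun i : Fin d ↦ exists_norm_sliceFourier_le
    (contDiff_partialDeriv (h1 i) i.castSucc).continuous
    (hasCompactSupport_partialDeriv (hasCompactSupport_partialDeriv hc _) _)
  refine ⟨2 * (M₀ + ∑ i, M i), fun η t ↦ ?_⟩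
  have hp := Real.pi_gt_three
  have h2 : ∀ i, ‖η i‖ ^ 2 * ‖sliceFourier v η t‖ ≤ M i := by
    intro i
    have h := hM i η t
    rw [sliceFourier_partialDeriv ((h1 i).of_le (by exact_mod_cast le_top))
      (hasCompactSupport_partialDeriv hc _),
      sliceFourier_partialDeriv (hv.of_le (by exact_mod_cast le_top)) hc] at h
    simp only [norm_mul, norm_neg, Complex.norm_ofNat, Complex.norm_real, Complex.norm_I] at h
    rw [Real.norm_of_nonneg Real.pi_pos.le] at h
    refine le_trans ?_ h
    have h3 : 0 ≤ ‖η i‖ ^ 2 * ‖sliceFourier v η t‖ := by positivity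
    nlinarith [mul_le_mul_of_nonneg_right hp.le h3,
      mul_le_mul_of_nonneg_right (by nlinarith : (1 : ℝ) ≤ 4 * Real.pi ^ 2) h3]
  have h3 : ‖η‖ ^ 2 * ‖sliceFourier v η t‖ ≤ ∑ i, M i := by
    rw [EuclideanSpace.norm_sq_eq, Finset.sum_mul]
    exact Finset.sum_le_sum fun i _ ↦ h2 i
  nlinarith [hM₀ η t, mul_nonneg (sq_nonneg (1 - ‖η‖)) (norm_nonneg (sliceFourier v η t))]

/-- Green's formula on the half-space above height `ε`, for a plane wave and a test function. -/
theorem setIntegral_planeWave_mul {k : ℝ} (η : E d) {v : E (d + 1) → ℂ}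
    (hv : ContDiff ℝ 1 v) (hc : HasCompactSupport v) (ε : ℝ) :
    ∫ X in {X : E (d + 1) | ε < X (Fin.last d)}, planeWave k η X *
        ((∑ i, waveVector k η i * partialDeriv i v X) - (k : ℂ) ^ 2 * v X) =
      -(Complex.I * verticalWavenumber k η *
        (Complex.exp (Complex.I * ε * verticalWavenumber k η) * sliceFourier v η ε)) := by
  have hF : ContDiff ℝ 1 fun X ↦ planeWave k η X * v X := (contDiff_planeWave k η).mul hv
  have hFc : HasCompactSupport fun X ↦ planeWave k η X * v X := hc.mul_left
  have h1 : ∀ X, planeWave k η X *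
        ((∑ i, waveVector k η i * partialDeriv i v X) - (k : ℂ) ^ 2 * v X) =
      ∑ i, waveVector k η i * partialDeriv i (fun X ↦ planeWave k η X * v X) X := by
    intro X
    have h2 : -(k : ℂ) ^ 2 * v X = ∑ i, waveVector k η i * waveVector k η i * v X := by
      rw [← Finset.sum_mul, sum_waveVector_sq]
    rw [sub_eq_add_neg, ← neg_mul, h2, ← Finset.sum_add_distrib, Finset.mul_sum]
    refine Finset.sum_congr rfl fun i _ ↦ ?_
    rw [partialDeriv_planeWave_mul k η hv]
    ring
  simp only [h1]
  rw [integral_finsetSum _ fun i _ ↦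
    (((continuous_partialDeriv hF i).integrable_of_hasCompactSupport
      (hasCompactSupport_partialDeriv hFc i)).integrableOn).const_mul _, Fin.sum_univ_castSucc]
  simp only [integral_const_mul, setIntegral_partialDeriv_castSucc hF hFc,
    setIntegral_partialDeriv_last hF hFc, mul_zero, Finset.sum_const_zero, zero_add,
    waveVector_last, planeWave_point, sliceFourier, mul_assoc]
  ring

/-! ### The weak normal derivative of the double layer potential -/

theorem IsAmplitude.integrable_prod_mul {a : E d → ℂ} (ha : IsAmplitude a) {k ε : ℝ}
    (hk : 0 ≤ k) (hε : 0 < ε) {w : E (d + 1) → ℂ} (hw : Continuous w) (hc : HasCompactSupport w) :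
    Integrable (fun p : E (d + 1) × E d ↦ planeWave k p.2 p.1 * a p.2 * w p.1)
      ((volume.restrict {X : E (d + 1) | ε < X (Fin.last d)}).prod volume) := by
  have hp := Real.pi_pos
  obtain ⟨T, hT0, hT⟩ := exists_last_le_of_hasCompactSupport hc
  have hS : MeasurableSet {X : E (d + 1) | ε < X (Fin.last d)} :=
    measurableSet_lt measurable_const (by fun_prop)
  have h1 : Integrable (fun p : E (d + 1) × E d ↦ (Real.exp (T * k) * ‖w p.1‖) *
      (Real.exp (-(ε * (2 * Real.pi) * ‖p.2‖)) * ‖a p.2‖))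
      ((volume.restrict {X : E (d + 1) | ε < X (Fin.last d)}).prod volume) :=
    Integrable.mul_prod
      (((hw.integrable_of_hasCompactSupport hc).norm.const_mul _).integrableOn)
      (ha.2 _ (by positivity))
  refine h1.mono' (((measurable_planeWave k).aestronglyMeasurable.mul ha.1.comp_snd).mul
    (hw.comp continuous_fst).aestronglyMeasurable) ?_
  have hmem : ∀ᵐ p : E (d + 1) × E d
      ∂((volume.restrict {X : E (d + 1) | ε < X (Fin.last d)}).prod volume),
      ε < p.1 (Fin.last d) :=
    Measure.quasiMeasurePreserving_fst.ae (ae_restrict_mem hS)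
  filter_upwards [hmem] with p hpε
  rcases lt_or_ge T (p.1 (Fin.last d)) with h | h
  · rw [hT _ h, mul_zero, norm_zero]; positivity
  · have h2 : ‖planeWave k p.2 p.1‖ ≤
        Real.exp (T * k) * Real.exp (-(ε * (2 * Real.pi) * ‖p.2‖)) := by
      refine (norm_planeWave_le hk p.2 (hε.trans hpε).le).trans ?_
      rw [← Real.exp_add]
      refine Real.exp_le_exp.2 ?_
      nlinarith [mul_le_mul_of_nonneg_right h hk,
        mul_le_mul_of_nonneg_right hpε.le (mul_nonneg hp.le (norm_nonneg p.2))]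
    rw [norm_mul, norm_mul]
    calc ‖planeWave k p.2 p.1‖ * ‖a p.2‖ * ‖w p.1‖
        ≤ Real.exp (T * k) * Real.exp (-(ε * (2 * Real.pi) * ‖p.2‖)) * ‖a p.2‖ * ‖w p.1‖ := by
          gcongr
      _ = _ := by ring

theorem IsAmplitude.setIntegral_mul {a : E d → ℂ} (ha : IsAmplitude a) {k ε : ℝ}
    (hk : 0 ≤ k) (hε : 0 < ε) {w : E (d + 1) → ℂ} (hw : Continuous w) (hc : HasCompactSupport w) :
    IntegrableOn (fun X ↦ waveIntegral k a X * w X) {X : E (d + 1) | ε < X (Fin.last d)} ∧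
    (Integrable fun η ↦ a η * ∫ X in {X : E (d + 1) | ε < X (Fin.last d)}, planeWave k η X * w X) ∧
    ∫ X in {X : E (d + 1) | ε < X (Fin.last d)}, waveIntegral k a X * w X =
      ∫ η, a η * ∫ X in {X : E (d + 1) | ε < X (Fin.last d)}, planeWave k η X * w X := by
  have h := ha.integrable_prod_mul hk hε hw hc
  have h1 : ∀ X, waveIntegral k a X * w X = ∫ η, planeWave k η X * a η * w X := fun X ↦
    (integral_mul_const _ _).symm
  have h2 : ∀ η, a η * ∫ X in {X : E (d + 1) | ε < X (Fin.last d)}, planeWave k η X * w X =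
      ∫ X in {X : E (d + 1) | ε < X (Fin.last d)}, planeWave k η X * a η * w X := fun η ↦ by
    rw [← integral_const_mul]
    refine integral_congr_ae (Filter.Eventually.of_forall fun X ↦ ?_)
    simp only; ring
  simp only [h1, h2]
  exact ⟨h.integral_prod_left, h.integral_prod_right, integral_integral_swap h⟩

/-- Green's formula above height `ε`, where the superposition of plane waves is smooth up to the
boundary. -/
theorem IsAmplitude.setIntegral_green {a : E d → ℂ} (ha : IsAmplitude a) {k ε : ℝ}
    (hk : 0 ≤ k) (hε : 0 < ε) {v : E (d + 1) → ℂ} (hv : ContDiff ℝ 1 v)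
    (hc : HasCompactSupport v) :
    ∫ X in {X : E (d + 1) | ε < X (Fin.last d)},
      ((∑ i, waveIntegral k (fun η ↦ waveVector k η i * a η) X * partialDeriv i v X) +
        waveIntegral k a X * (-(k : ℂ) ^ 2 * v X)) =
    -∫ η, Complex.I * verticalWavenumber k η * a η *
      (Complex.exp (Complex.I * ε * verticalWavenumber k η) * sliceFourier v η ε) := by
  have hA : ∀ i, _ := fun i ↦ (ha.waveVector_mul hk i).setIntegral_mul hk hε
    (continuous_partialDeriv hv i) (hasCompactSupport_partialDeriv hc i)
  have hvc : Continuous fun X ↦ -(k : ℂ) ^ 2 * v X := continuous_const.mul hv.continuous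
  have hvs : HasCompactSupport fun X ↦ -(k : ℂ) ^ 2 * v X :=
    hc.mul_left (f := fun _ ↦ -(k : ℂ) ^ 2)
  have hB := ha.setIntegral_mul hk hε hvc hvs
  rw [integral_add (integrable_finsetSum _ fun i _ ↦ (hA i).1) hB.1,
    integral_finsetSum _ fun i _ ↦ (hA i).1, hB.2.2]
  simp only [(hA _).2.2]
  rw [← integral_finsetSum _ fun i _ ↦ (hA i).2.1,
    ← integral_add (integrable_finsetSum _ fun i _ ↦ (hA i).2.1) hB.2.1, ← integral_neg]
  refine integral_congr_ae (Filter.Eventually.of_forall fun η ↦ ?_)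
  have hpw : ∀ {w : E (d + 1) → ℂ}, Continuous w → HasCompactSupport w →
      IntegrableOn (fun X ↦ planeWave k η X * w X) {X : E (d + 1) | ε < X (Fin.last d)} :=
    fun hw hwc ↦ (((contDiff_planeWave (n := 1) k η).continuous.mul
      hw).integrable_of_hasCompactSupport hwc.mul_left).integrableOn
  have h1 := setIntegral_planeWave_mul (k := k) η hv hc ε
  have h2 : ∀ X, planeWave k η X * ((∑ i, waveVector k η i * partialDeriv i v X) -
      (k : ℂ) ^ 2 * v X) = (∑ i, waveVector k η i * (planeWave k η X * partialDeriv i v X)) +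
        planeWave k η X * (-(k : ℂ) ^ 2 * v X) := by
    intro X
    rw [sub_eq_add_neg, mul_add, Finset.mul_sum]
    congr 1
    · exact Finset.sum_congr rfl fun i _ ↦ by ring
    · ring
  simp only [h2] at h1
  rw [integral_add (integrable_finsetSum _ fun i _ ↦ (hpw (continuous_partialDeriv hv i)
    (hasCompactSupport_partialDeriv hc i)).const_mul _)
    (hpw hvc hvs), integral_finsetSum _ fun i _ ↦ (hpw (continuous_partialDeriv hv i)
    (hasCompactSupport_partialDeriv hc i)).const_mul _] at h1
  simp only [integral_const_mul] at h1
  have h3 : ∀ b : ℂ, (∑ i, waveVector k η i * a η *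
      ∫ X in {X : E (d + 1) | ε < X (Fin.last d)}, planeWave k η X * partialDeriv i v X) + a η * b =
      a η * ((∑ i, waveVector k η i *
        ∫ X in {X : E (d + 1) | ε < X (Fin.last d)}, planeWave k η X * partialDeriv i v X) +
          b) := by
    intro b
    rw [mul_add, Finset.mul_sum]
    congr 1
    exact Finset.sum_congr rfl fun i _ ↦ by ring
  simp only
  rw [h3, h1]
  ring

/-- The weak normal derivative of a superposition of plane waves, as a Fourier integral on the
boundary. The amplitude is square integrable with weight `1 + ‖η‖`, so that Green's formula on the
half-space above height `ε` passes to the limit `ε → 0`. -/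
theorem IsAmplitude.weakNormalDerivative_eq (hd : d ≤ 2) {a : E d → ℂ} (ha : IsAmplitude a)
    (h2 : Integrable fun η ↦ (1 + ‖η‖) * ‖a η‖ ^ 2) {k : ℝ} (hk : 0 ≤ k) {u : E (d + 1) → ℂ}
    (hu : Set.EqOn u (waveIntegral k a) (upperHalfSpace d)) {v : E (d + 1) → ℂ}
    (hv : ContDiff ℝ ∞ v) (hc : HasCompactSupport v) :
    weakNormalDerivative u v =
      ∫ η, Complex.I * verticalWavenumber k η * a η * sliceFourier v η 0 := by
  have hp := Real.pi_pos
  have hv1 : ContDiff ℝ 1 v := hv.of_le (by exact_mod_cast le_top)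
  -- The integrand of the weak normal derivative, in terms of superpositions of plane waves.
  set J : E (d + 1) → ℂ := fun X ↦
    (∑ i, waveIntegral k (fun η ↦ waveVector k η i * a η) X * partialDeriv i v X) +
        waveIntegral k a X * (-(k : ℂ) ^ 2 * v X) with hJ
  have hw1 : weakNormalDerivative u v = -∫ X in upperHalfSpace d, J X := by
    rw [weakNormalDerivative]
    congr 1
    refine setIntegral_congr_fun isOpen_upperHalfSpace.measurableSet fun X hX ↦ ?_
    simp only [hJ]
    rw [ha.laplacian_eq hk hu hX, hu hX]
    congr 1
    · refine Finset.sum_congr rfl fun i _ ↦ ?_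
      rw [ha.fderiv_apply hk hu hX i, partialDeriv]
    · ring
  have hJint : IntegrableOn J (upperHalfSpace d) := by
    refine Integrable.add (integrable_finsetSum _ fun i _ ↦ ?_) ?_
    · refine (ha.waveVector_mul hk i).integrableOn_mul hk ?_ (continuous_partialDeriv hv1 i)
        (hasCompactSupport_partialDeriv hc i)
      refine (h2.const_mul ((k + 2 * Real.pi) ^ 2)).mono' ?_
        (Filter.Eventually.of_forall fun η ↦ ?_)
      · exact (by fun_prop : Measurable fun η : E d ↦ (1 + ‖η‖)⁻¹).aestronglyMeasurable.mul
          ((ha.waveVector_mul hk i).1.norm.pow 2)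
      · have hn := norm_nonneg η
        rw [Real.norm_eq_abs, abs_of_nonneg (by positivity), norm_mul, mul_pow]
        calc (1 + ‖η‖)⁻¹ * (‖waveVector k η i‖ ^ 2 * ‖a η‖ ^ 2)
            ≤ (1 + ‖η‖)⁻¹ * (((k + 2 * Real.pi) * (1 + ‖η‖)) ^ 2 * ‖a η‖ ^ 2) := by
              gcongr
              exact norm_waveVector_le hk η i
          _ = _ := by field_simp
    · refine ha.integrableOn_mul hk ?_ (continuous_const.mul hv.continuous)
        (hc.mul_left (f := fun _ ↦ -(k : ℂ) ^ 2))
      refine h2.mono' ?_ (Filter.Eventually.of_forall fun η ↦ ?_)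
      · exact (by fun_prop : Measurable fun η : E d ↦ (1 + ‖η‖)⁻¹).aestronglyMeasurable.mul
          (ha.1.norm.pow 2)
      · have hn := norm_nonneg η
        rw [Real.norm_eq_abs, abs_of_nonneg (by positivity)]
        refine mul_le_mul_of_nonneg_right ?_ (by positivity)
        exact (inv_le_one_of_one_le₀ (by linarith)).trans (by linarith)
  -- Exhaustion of the half-space by the half-spaces above height `1 / (n + 1)`.
  set S : ℕ → Set (E (d + 1)) := fun n ↦ {X | 1 / ((n : ℝ) + 1) < X (Fin.last d)} with hS
  have hSU : ⋃ n, S n = upperHalfSpace d := by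
    ext X
    simp only [Set.mem_iUnion]
    constructor
    · rintro ⟨n, hn⟩
      have hn' : 1 / ((n : ℝ) + 1) < X (Fin.last d) := hn
      exact lt_trans (by positivity) hn'
    · intro hX
      obtain ⟨n, hn⟩ := exists_nat_one_div_lt (show 0 < X (Fin.last d) from hX)
      exact ⟨n, hn⟩
  have hSmono : Monotone S := fun m n hmn X hX ↦ by
    have hX' : 1 / ((m : ℝ) + 1) < X (Fin.last d) := hX
    exact lt_of_le_of_lt (Nat.one_div_le_one_div hmn) hX'
  have hlim1 := tendsto_setIntegral_of_monotone (μ := volume) (f := J)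
    (fun n ↦ (measurableSet_lt measurable_const (by fun_prop) : MeasurableSet (S n))) hSmono
    (by rw [hSU]; exact hJint)
  rw [hSU] at hlim1
  have hSn : ∀ n : ℕ, ∫ X in S n, J X = -∫ η, Complex.I * verticalWavenumber k η * a η *
      (Complex.exp (Complex.I * ((1 / ((n : ℝ) + 1) : ℝ) : ℂ) * verticalWavenumber k η) *
        sliceFourier v η (1 / ((n : ℝ) + 1))) := fun n ↦
    ha.setIntegral_green hk (by positivity) hv1 hc
  replace hlim1 := hlim1.congr hSn
  obtain ⟨M, hM⟩ := exists_sliceFourier_decay hv hc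
  have hM0 : 0 ≤ M := le_trans (by positivity) (hM 0 0)
  have hbound : Integrable fun η : E d ↦ (k + 2 * Real.pi) * Real.exp k * M *
      ((1 + ‖η‖) * ‖a η‖ ^ 2 + (1 + ‖η‖) ^ (-3 : ℝ)) := by
    refine (h2.add (integrable_one_add_norm ?_)).const_mul _
    rw [finrank_euclideanSpace_fin]
    have : (d : ℝ) ≤ 2 := by exact_mod_cast hd
    linarith
  have hlim2 : Filter.Tendsto (fun n : ℕ ↦ ∫ η, Complex.I * verticalWavenumber k η * a η *
      (Complex.exp (Complex.I * ((1 / ((n : ℝ) + 1) : ℝ) : ℂ) * verticalWavenumber k η) *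
        sliceFourier v η (1 / ((n : ℝ) + 1)))) Filter.atTop
      (nhds (∫ η, Complex.I * verticalWavenumber k η * a η * sliceFourier v η 0)) := by
    refine tendsto_integral_of_dominated_convergence _ (fun n ↦ ?_) hbound
      (fun n ↦ Filter.Eventually.of_forall fun η ↦ ?_) (Filter.Eventually.of_forall fun η ↦ ?_)
    · have hZ := (measurable_verticalWavenumber (d := d) k)
      exact ((hZ.const_mul Complex.I).aestronglyMeasurable.mul ha.1).mul
        ((Complex.measurable_exp.comp (hZ.const_mul _)).aestronglyMeasurable.mul
          (aestronglyMeasurable_sliceFourier hv.continuous _))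
    · have hn := norm_nonneg η
      set ε : ℝ := 1 / ((n : ℝ) + 1) with hε
      have hε0 : 0 ≤ ε := by positivity
      have hε1 : ε ≤ 1 := by
        rw [hε, div_le_one (by positivity)]
        have : (0 : ℝ) ≤ n := n.cast_nonneg
        linarith
      have he : ‖Complex.exp (Complex.I * (ε : ℂ) * verticalWavenumber k η)‖ ≤ Real.exp k := by
        refine (norm_exp_verticalWavenumber_le hk hε0 η).trans (Real.exp_le_exp.2 ?_)
        nlinarith [mul_nonneg hε0 (mul_nonneg hp.le hn)]
      have hV : ‖sliceFourier v η ε‖ ≤ M / (1 + ‖η‖) ^ 2 := by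
        rw [le_div_iff₀ (by positivity), mul_comm]
        exact hM η ε
      -- The arithmetic-geometric mean inequality splits the two square integrable factors.
      have hyoung : (1 + ‖η‖) * ‖a η‖ * ((1 + ‖η‖) ^ 2)⁻¹ ≤
          (1 + ‖η‖) * ‖a η‖ ^ 2 + (1 + ‖η‖) ^ (-3 : ℝ) := by
        have h4 : (1 + ‖η‖) ^ (-3 : ℝ) = (1 + ‖η‖) * (((1 + ‖η‖) ^ 2)⁻¹) ^ 2 := by
          rw [Real.rpow_neg (by positivity), show (3 : ℝ) = ((3 : ℕ) : ℝ) by norm_num,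
            Real.rpow_natCast]
          field_simp
        rw [h4]
        have h5 : 0 ≤ ((1 + ‖η‖) ^ 2)⁻¹ := by positivity
        have h6 : 0 ≤ 1 + ‖η‖ := by positivity
        nlinarith [mul_nonneg h6 (sq_nonneg (‖a η‖ - ((1 + ‖η‖) ^ 2)⁻¹)),
          mul_nonneg h6 (sq_nonneg (‖a η‖ + ((1 + ‖η‖) ^ 2)⁻¹))]
      rw [norm_mul, norm_mul, norm_mul, norm_mul, Complex.norm_I, one_mul]
      calc ‖verticalWavenumber k η‖ * ‖a η‖ *
            (‖Complex.exp (Complex.I * (ε : ℂ) * verticalWavenumber k η)‖ * ‖sliceFourier v η ε‖)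
          ≤ (k + 2 * Real.pi) * (1 + ‖η‖) * ‖a η‖ * (Real.exp k * (M / (1 + ‖η‖) ^ 2)) := by
            gcongr
            exact norm_verticalWavenumber_le hk η
        _ = (k + 2 * Real.pi) * Real.exp k * M * ((1 + ‖η‖) * ‖a η‖ * ((1 + ‖η‖) ^ 2)⁻¹) := by
            rw [div_eq_mul_inv]; ring
        _ ≤ _ := by gcongr
    · refine Filter.Tendsto.const_mul _ ?_
      have ht : Filter.Tendsto (fun n : ℕ ↦ 1 / ((n : ℝ) + 1)) Filter.atTop (nhds 0) :=
        tendsto_one_div_add_atTop_nhds_zero_nat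
      have h5 : Continuous fun t : ℝ ↦
          Complex.exp (Complex.I * (t : ℂ) * verticalWavenumber k η) * sliceFourier v η t :=
        (by fun_prop : Continuous fun t : ℝ ↦
          Complex.exp (Complex.I * (t : ℂ) * verticalWavenumber k η)).mul
          (continuous_sliceFourier hv.continuous hc η)
      have h6 := (h5.tendsto 0).comp ht
      simpa [Function.comp_def] using h6
  rw [hw1, tendsto_nhds_unique hlim1 hlim2.neg, neg_neg]

theorem sliceFourier_zero_eq {v : E (d + 1) → ℂ} {ψ : E d → ℂ} (h : ∀ x, v (point x 0) = ψ x)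
    (η : E d) : sliceFourier v η 0 = 𝓕⁻ ψ η := by
  rw [sliceFourier, Real.fourierInv_eq']
  refine integral_congr_ae (Filter.Eventually.of_forall fun x ↦ ?_)
  simp only [smul_eq_mul, h]
  congr 2
  push_cast; ring

/-! ### The hypersingular operator on the screen -/

theorem one_add_norm_le (η : E d) : 1 + ‖η‖ ≤ 2 * (1 + ‖η‖ ^ 2) ^ (1 / 2 : ℝ) := by
  rw [← Real.sqrt_eq_rpow]
  have h1 : √(1 + ‖η‖ ^ 2) ^ 2 = 1 + ‖η‖ ^ 2 := Real.sq_sqrt (by positivity)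
  have h2 : 0 ≤ √(1 + ‖η‖ ^ 2) := Real.sqrt_nonneg _
  nlinarith [norm_nonneg η, sq_nonneg (1 - ‖η‖)]

theorem rpow_quarter_sq (η : E d) :
    ((1 + ‖η‖ ^ 2) ^ ((1 / 2 : ℝ) / 2)) ^ 2 = (1 + ‖η‖ ^ 2) ^ (1 / 2 : ℝ) := by
  rw [← Real.rpow_natCast, ← Real.rpow_mul (by positivity)]
  norm_num

/-- The Fourier transform of the hypersingular operator applied to a density with Fourier
transform `g`. -/
def hypersingularAmplitude (k : ℝ) (g : E d → ℂ) (η : E d) : ℂ :=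
  Complex.I / 2 * verticalWavenumber k η * g η

theorem memLp_hypersingularAmplitude {k : ℝ} (hk : 0 ≤ k) {g : E d → ℂ}
    (hgm : AEStronglyMeasurable g)
    (hg : MemLp (fun η : E d ↦ (((1 + ‖η‖ ^ 2) ^ ((1 / 2 : ℝ) / 2) : ℝ) : ℂ) * g η) 2) :
    MemLp (fun η : E d ↦ (((1 + ‖η‖ ^ 2) ^ (-(1 / 2 : ℝ) / 2) : ℝ) : ℂ) *
      hypersingularAmplitude k g η) 2 := by
  have hp := Real.pi_pos
  refine hg.of_le_mul (c := k + 2 * Real.pi) ?_ (Filter.Eventually.of_forall fun η ↦ ?_)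
  · refine AEStronglyMeasurable.mul (Measurable.aestronglyMeasurable (by fun_prop)) ?_
    exact ((measurable_verticalWavenumber k).const_mul _).aestronglyMeasurable.mul hgm
  · set q := (1 + ‖η‖ ^ 2) ^ ((1 / 2 : ℝ) / 2) with hq
    have hq0 : 0 < q := by positivity
    have h1 : (1 + ‖η‖ ^ 2) ^ (-(1 / 2 : ℝ) / 2) = q⁻¹ := by
      rw [hq, ← Real.rpow_neg (by positivity)]; norm_num
    have h2 : ‖verticalWavenumber k η‖ ≤ (k + 2 * Real.pi) * (2 * q ^ 2) := by
      refine (norm_verticalWavenumber_le hk η).trans ?_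
      rw [hq, rpow_quarter_sq]
      exact mul_le_mul_of_nonneg_left (one_add_norm_le η) (by positivity)
    rw [h1, hypersingularAmplitude]
    simp only [norm_mul, norm_div, Complex.norm_I, Complex.norm_ofNat, Complex.norm_real,
      norm_inv, Real.norm_eq_abs, abs_of_pos hq0]
    calc q⁻¹ * (1 / 2 * ‖verticalWavenumber k η‖ * ‖g η‖)
        ≤ q⁻¹ * (1 / 2 * ((k + 2 * Real.pi) * (2 * q ^ 2)) * ‖g η‖) := by gcongr
      _ = _ := by field_simp

/-- Fourier representation of the hypersingular operator: the distribution with Fourier transform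
`(i/2) Z 𝓕φ` is the weak normal derivative of the double layer potential of `φ`. -/
theorem exists_extendsHypersingular (hd : d = 1 ∨ d = 2) {Γ : Set (E d)} (hΓ : IsOpen Γ)
    (hb : Bornology.IsBounded Γ) {k : ℝ} (hk : 0 < k) {φ : Lp ℂ 2 (volume : Measure (E d))}
    (hφ : MemTildeH (1 / 2) Γ (φ : 𝓢'(E d, ℂ))) :
    ∃ U : 𝓢'(E d, ℂ), ExtendsHypersingular Γ k φ U ∧
      HasFourierSobolev (-(1 / 2)) U (hypersingularAmplitude k (𝓕 (φ : E d → ℂ))) := by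
  have hφi := hφ.integrable hΓ.measurableSet hb
  have hg := (hφ.hasFourierSobolev hΓ.measurableSet hb).1
  have hgm : AEStronglyMeasurable (𝓕 (φ : E d → ℂ)) :=
    (memLp_fourier hφi (Lp.memLp φ)).1.1
  obtain ⟨U, hU⟩ := exists_distribution_hasFourierSobolev
    (memLp_hypersingularAmplitude hk.le hgm hg)
  refine ⟨U, ⟨hU.memSobolev, fun ψ v hψ hv hvc hvψ ↦ ?_⟩, hU⟩
  have ha : IsAmplitude fun η ↦ 1 / 2 * 𝓕 (φ : E d → ℂ) η :=
    isAmplitude_of_bounded (hgm.const_mul _) (M := 1 / 2 * ∫ x, ‖φ x‖) fun η ↦ by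
      rw [norm_mul]
      refine mul_le_mul (by simp) ?_ (norm_nonneg _) (by norm_num)
      exact VectorFourier.norm_fourierIntegral_le_integral_norm _ _ _ _ _
  have h2 : Integrable fun η ↦ (1 + ‖η‖) * ‖1 / 2 * 𝓕 (φ : E d → ℂ) η‖ ^ 2 := by
    refine ((hg.integrable_norm_pow (by norm_num)).const_mul (1 / 2)).mono'
      ((by fun_prop : Measurable fun η : E d ↦ 1 + ‖η‖).aestronglyMeasurable.mul
        ((hgm.const_mul _).norm.pow 2)) (Filter.Eventually.of_forall fun η ↦ ?_)
    have hn := norm_nonneg η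
    rw [Real.norm_eq_abs, abs_of_nonneg (by positivity)]
    have h3 := rpow_quarter_sq η
    simp only [norm_mul, Complex.norm_real, norm_div, norm_one,
      Complex.norm_ofNat, mul_pow, Real.norm_eq_abs, sq_abs]
    rw [h3]
    nlinarith [mul_le_mul_of_nonneg_right (one_add_norm_le η) (sq_nonneg ‖𝓕 (φ : E d → ℂ) η‖)]
  rw [ha.weakNormalDerivative_eq (by omega) h2 hk.le (doubleLayer_eq_waveIntegral hd hk hφi) hv hvc]
  have h4 : U ψ = 𝓕 U (𝓕⁻ ψ : 𝓢(E d, ℂ)) := by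
    rw [TemperedDistribution.fourier_apply, FourierTransform.fourier_fourierInv_eq]
  rw [h4, hU.2]
  refine integral_congr_ae (Filter.Eventually.of_forall fun η ↦ ?_)
  simp only
  rw [sliceFourier_zero_eq hvψ, SchwartzMap.fourierInv_coe, hypersingularAmplitude]
  ring

/-- A test function on the screen extends to the whole space, by a product with a bump function in
the last coordinate. -/
theorem exists_extension {ψ : E d → ℂ} (hψ : ContDiff ℝ ∞ ψ) (hc : HasCompactSupport ψ) :
    ∃ v : E (d + 1) → ℂ, ContDiff ℝ ∞ v ∧ HasCompactSupport v ∧ ∀ x, v (point x 0) = ψ x := by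
  let χ : ContDiffBump (0 : ℝ) := default
  let P : E (d + 1) → E d := fun X ↦ WithLp.toLp 2 fun i ↦ X i.castSucc
  have hP : ContDiff ℝ ∞ P := (PiLp.contDiff_toLp).comp (contDiff_pi.2 fun i ↦ by fun_prop)
  have hPp : ∀ x t, P (point x t) = x := fun x t ↦ by
    ext i; simp [P, point]
  refine ⟨fun X ↦ ψ (P X) * (χ (X (Fin.last d)) : ℂ), ?_, ?_, fun x ↦ ?_⟩
  · refine (hψ.comp hP).mul ?_
    exact Complex.ofRealCLM.contDiff.comp (χ.contDiff.comp (by fun_prop))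
  · refine HasCompactSupport.intro
      ((hc.isCompact.prod χ.hasCompactSupport.isCompact).image continuous_point) fun X hX ↦ ?_
    obtain ⟨x, hx⟩ := exists_eq_point X
    by_contra hne
    rw [hx, hPp, point_last] at hne
    refine hX ⟨(x, X (Fin.last d)), ⟨subset_tsupport _ (left_ne_zero_of_mul hne),
      subset_tsupport _ fun h0 ↦ right_ne_zero_of_mul hne (by rw [h0]; simp)⟩, hx.symm⟩
  · simp only [hPp, point_last]
    rw [χ.one_of_mem_closedBall (Metric.mem_closedBall_self χ.rIn_pos.le)]
    simp

/-- All extensions of `T_k φ` have the same restriction to `Γ`, as every test function on `Γ` has an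
extension to the whole space. -/
theorem ExtendsHypersingular.dualPairing_eq {Γ : Set (E d)} {k : ℝ}
    {φ ψ : Lp ℂ 2 (volume : Measure (E d))} (hψ : MemTildeH (1 / 2) Γ (ψ : 𝓢'(E d, ℂ)))
    {U : 𝓢'(E d, ℂ)} (hU : ExtendsHypersingular Γ k φ U) :
    dualPairing (1 / 2) U (ψ : 𝓢'(E d, ℂ)) = hypersingularForm Γ k φ ψ := by
  have hex : ∃ U : 𝓢'(E d, ℂ), ExtendsHypersingular Γ k φ U := ⟨U, hU⟩
  rw [hypersingularForm, dif_pos hex]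
  refine dualPairing_eq_of_eq_on_testFunctions hU.1 hex.choose_spec.1 (fun χ hχ ↦ ?_) hψ
  obtain ⟨v, hv, hvc, hvχ⟩ := exists_extension (χ.smooth ⊤) hχ.1
  rw [hU.2 χ v hχ hv hvc hvχ, hex.choose_spec.2 χ v hχ hv hvc hvχ]

/-- The lower bound for the form, with the loss `(kL)^{1/2}` in both dimensions. -/
theorem sobolevNorm_sq_le_hypersingularForm (hd : d = 1 ∨ d = 2) {Γ : Set (E d)}
    (hΓ : IsOpen Γ) (hb : Bornology.IsBounded Γ) (hne : Γ.Nonempty) {k k₀ : ℝ} (hk : 0 < k)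
    (hk₀ : 0 < k₀) (hkL : k₀ ≤ k * Metric.diam Γ) {φ : Lp ℂ 2 (volume : Measure (E d))}
    (hφ : MemTildeH (1 / 2) Γ (φ : 𝓢'(E d, ℂ))) :
    sobolevNorm k (1 / 2) (φ : 𝓢'(E d, ℂ)) ^ 2 ≤
      4 * (216 + 2 / √k₀) * √(k * Metric.diam Γ) * ‖hypersingularForm Γ k φ φ‖ := by
  obtain ⟨U, hU, hUF⟩ := exists_extendsHypersingular hd hΓ hb hk hφ
  obtain ⟨x₀, hx₀⟩ := hne
  have hφi := hφ.integrable hΓ.measurableSet hb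
  have hφF := hφ.hasFourierSobolev hΓ.measurableSet hb
  have hint : Integrable fun η : E d ↦
      (k ^ 2 + (2 * Real.pi * ‖η‖) ^ 2) ^ (1 / 2 : ℝ) * ‖𝓕 (φ : E d → ℂ) η‖ ^ 2 := by
    refine ((memLp_besselSymbol_mul hk hφF.1).integrable_norm_pow (by norm_num)).congr
      (Filter.Eventually.of_forall fun η ↦ ?_)
    simp only [norm_mul, Complex.norm_real, Real.norm_eq_abs]
    rw [mul_pow, sq_abs, besselSymbol_sq hk]
  have hgm : AEStronglyMeasurable (𝓕 (φ : E d → ℂ)) :=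
    (memLp_fourier hφi (Lp.memLp φ)).1.1
  have hW : Integrable fun η : E d ↦ verticalWeight k η * ‖𝓕 (φ : E d → ℂ) η‖ ^ 2 := by
    refine hint.mono' ?_ (Filter.Eventually.of_forall fun η ↦ ?_)
    · refine AEStronglyMeasurable.mul (Measurable.aestronglyMeasurable ?_) (hgm.norm.pow 2)
      unfold verticalWeight; fun_prop
    · have h0 : 0 ≤ verticalWeight k η := add_nonneg (Real.sqrt_nonneg _) (Real.sqrt_nonneg _)
      rw [Real.norm_eq_abs, abs_of_nonneg (by positivity)]
      exact mul_le_mul_of_nonneg_right (verticalWeight_le k η) (by positivity)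
  have h1 := sobolev_energy_le_verticalWeight_energy hd hb hx₀ hφi (Lp.memLp φ)
    (hφ.ae_eq_zero hΓ.measurableSet) hk hk₀ hkL hint
  have h2 := norm_integral_verticalWavenumber_ge hW hgm
  rw [← hU.dualPairing_eq hφ, hUF.dualPairing_eq hφF, hφF.sobolevNorm_sq hk]
  refine h1.trans ((mul_le_mul_of_nonneg_left h2 (by positivity)).trans_eq ?_)
  simp only [hypersingularAmplitude]
  ring

end ScreenScattering

end

open ScreenScattering
/-- Wavenumber-explicit coercivity of the hypersingular operator on a planar screen `Γ ⊆ ℝ^d`,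
`d = n - 1`, in `ℝ^n`, `n = 2, 3`. The first two conclusions say that the form `b` is well defined
on `H̃^{1/2}(Γ)`: `T_k φ` has an extension in `H^{-1/2}(ℝ^d)`, and `⟨U, ψ⟩` does not depend on the
choice of the extension `U`. -/
theorem theorem6p2 (k₀ : ℝ) (hk₀ : 0 < k₀) :
    ∃ C : ℝ, 0 < C ∧
      ∀ (d : ℕ), d = 1 ∨ d = 2 →
      ∀ (Γ : Set (E d)), IsOpen Γ → Bornology.IsBounded Γ → Γ.Nonempty →
      ∀ (k : ℝ), 0 < k → k₀ ≤ k * Metric.diam Γ →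
        (∀ φ : Lp ℂ 2 (volume : Measure (E d)), MemTildeH (1 / 2) Γ (φ : 𝓢'(E d, ℂ)) →
          ∃ U : 𝓢'(E d, ℂ), ExtendsHypersingular Γ k φ U) ∧
        (∀ φ ψ : Lp ℂ 2 (volume : Measure (E d)), MemTildeH (1 / 2) Γ (φ : 𝓢'(E d, ℂ)) →
          MemTildeH (1 / 2) Γ (ψ : 𝓢'(E d, ℂ)) →
          ∀ U : 𝓢'(E d, ℂ), ExtendsHypersingular Γ k φ U →
            dualPairing (1 / 2) U (ψ : 𝓢'(E d, ℂ)) = hypersingularForm Γ k φ ψ) ∧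
        (∀ φ : Lp ℂ 2 (volume : Measure (E d)), MemTildeH (1 / 2) Γ (φ : 𝓢'(E d, ℂ)) →
          C * (k * Metric.diam Γ) ^ (if d = 2 then -(2 / 3) else -(1 / 2) : ℝ) *
              sobolevNorm k (1 / 2) (φ : 𝓢'(E d, ℂ)) ^ 2 ≤
            ‖hypersingularForm Γ k φ φ‖) := by
  have hA : 0 < 4 * (216 + 2 / √k₀) := by positivity
  refine ⟨min 1 (k₀ ^ (1 / 6 : ℝ)) / (4 * (216 + 2 / √k₀)), by positivity,
    fun d hd Γ hΓ hb hne k hk hkL ↦ ⟨fun φ hφ ↦ ?_, fun φ ψ _ hψ U hU ↦ hU.dualPairing_eq hψ,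
      fun φ hφ ↦ ?_⟩⟩
  · obtain ⟨U, hU, -⟩ := exists_extendsHypersingular hd hΓ hb hk hφ
    exact ⟨U, hU⟩
  · have hL : 0 < k * Metric.diam Γ := hk₀.trans_le hkL
    set L := k * Metric.diam Γ with hLdef
    -- For `d = 2` the proof gives the better exponent `-1/2`; the lower bound `k₀ ≤ kL` turns it
    -- into the exponent `-2/3`.
    have hexp : min 1 (k₀ ^ (1 / 6 : ℝ)) * L ^ (if d = 2 then -(2 / 3) else -(1 / 2) : ℝ) ≤
        L ^ (-(1 / 2) : ℝ) := by
      split_ifs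
      · have h1 : L ^ (-(1 / 2) : ℝ) = L ^ (1 / 6 : ℝ) * L ^ (-(2 / 3) : ℝ) := by
          rw [← Real.rpow_add hL]; norm_num
        rw [h1]
        refine mul_le_mul_of_nonneg_right ((min_le_right _ _).trans ?_) (by positivity)
        exact Real.rpow_le_rpow hk₀.le hkL (by norm_num)
      · exact mul_le_of_le_one_left (by positivity) (min_le_left _ _)
    have hmain := sobolevNorm_sq_le_hypersingularForm hd hΓ hb hne hk hk₀ hkL hφ
    have hsq : L ^ (-(1 / 2) : ℝ) * √L = 1 := by
      rw [Real.sqrt_eq_rpow, ← Real.rpow_add hL]; norm_num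
    calc min 1 (k₀ ^ (1 / 6 : ℝ)) / (4 * (216 + 2 / √k₀)) *
          L ^ (if d = 2 then -(2 / 3) else -(1 / 2) : ℝ) *
          sobolevNorm k (1 / 2) (φ : 𝓢'(E d, ℂ)) ^ 2
        = (4 * (216 + 2 / √k₀))⁻¹ * (min 1 (k₀ ^ (1 / 6 : ℝ)) *
          L ^ (if d = 2 then -(2 / 3) else -(1 / 2) : ℝ)) *
          sobolevNorm k (1 / 2) (φ : 𝓢'(E d, ℂ)) ^ 2 := by rw [div_eq_mul_inv]; ring
      _ ≤ (4 * (216 + 2 / √k₀))⁻¹ * L ^ (-(1 / 2) : ℝ) *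
          (4 * (216 + 2 / √k₀) * √L * ‖hypersingularForm Γ k φ φ‖) := by
          gcongr
      _ = (4 * (216 + 2 / √k₀))⁻¹ * (4 * (216 + 2 / √k₀)) * (L ^ (-(1 / 2) : ℝ) * √L) *
          ‖hypersingularForm Γ k φ φ‖ := by ring
      _ = ‖hypersingularForm Γ k φ φ‖ := by
          rw [hsq, inv_mul_cancel₀ hA.ne', one_mul, one_mul]
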